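/- Consider asynchronous shared-memory fork--join programs: threads execute atomic reads, writes and compare-and-swap operations on a shared memory, interleaved in an arbitrary order, and synchronize only by these operations and by binary fork and join. Keys come from an arbitrary totally ordered set and can only be copied and compared. The work of an execution is the total number of its steps, and its depth is the length of a longest chain of sequentially dependent steps in the fork--join graph. A binary min-heap of size $n$ is a complete binary tree with nodes $1,\dots,n$ (the parent of node $w>1$ is node $\lfloor w/2\rfloor$), stored in a flat array, in which no key is smaller than the key of the parent node. A batch of size $m$ is a sequence of $m$ updates, each of which inserts a new key, deletes a given node of the heap, or increases or decreases the key of a given node of the heap to a given value; no two updates of a batch refer to the same node. There are fixed programs Update and FindMin and a constant $C$ such that for every totally ordered set of keys and every stored binary min-heap of size $n\ge 0$ the following hold. 1. For every $m\ge 1$ and every stored batch of $m$ updates (an arbitrary mix of inserts, deletes and increase/decrease-keys), every execution of Update terminates with a stored binary min-heap (with its workspace again in the clean state in which it started) whose multiset of keys is the one obtained by performing all updates of the batch. It takes at most $C\,m\log\bigl(1+\frac{n+m}{m}\bigr)$ work and has depth at most $C\log(1+n+m)$. 2. If $n\ge 1$, every execution of FindMin terminates after at most $C$ work, leaves the memory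 unchanged, and returns the minimum key of the heap. -/

import Mathlib

universe u

namespace ParHeap

/-! ### The machine: asynchronous shared-memory fork-join programs

Numbers and keys are kept apart.  Numbers serve as addresses, sizes and flags; keys can only be
copied and compared, so programs are comparison based and do not depend on the type of keys.
Key words are elements of `WithTop K`: the value `⊤` is the blank word, which compares as `∞`. -/

/-- The shared memory: numeric arrays and key arrays; `num b i` is cell `i` of array `b`.
A program can mention only finitely many arrays. -/
structure Mem (K : Type u) where
  num : ℕ → ℕ → ℕ
  key : ℕ → ℕ → WithTop K

/-- The private registers of a thread. -/
structure Frame (K : Type u) where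
  num : ℕ → ℕ
  key : ℕ → WithTop K

/-- Initial registers: all numbers are `0` and all keys are blank. -/
def Frame.init (K : Type u) : Frame K := ⟨fun _ => 0, fun _ => ⊤⟩

/-- Atomic instructions.  `r s t u` are register names, `b` is the (fixed) name of an array. -/
inductive Instr : Type where
  /-- do nothing -/
  | skip
  /-- register `r := c` -/
  | const (r c : ℕ)
  /-- register `r := s + t` -/
  | add (r s t : ℕ)
  /-- register `r := s - t`, and `0` if `s < t` -/
  | sub (r s t : ℕ)
  /-- register `r := ⌊s / 2⌋` -/
  | half (r s : ℕ)
  /-- register `r :=` cell `s` of numeric array `b` -/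
  | load (r b s : ℕ)
  /-- cell `s` of numeric array `b := t` -/
  | store (b s t : ℕ)
  /-- compare-and-swap on cell `s` of numeric array `b`: if the cell contains `t`, then it is
  overwritten by `u` and register `r := 1`; otherwise it is unchanged and register `r := 0` -/
  | cas (r b s t u : ℕ)
  /-- key register `r :=` cell `s` of key array `b` -/
  | keyLoad (r b s : ℕ)
  /-- cell `s` of key array `b := ` key register `t` -/
  | keyStore (b s t : ℕ)

/-- Tests: strict comparison of two numeric registers or of two key registers. -/
inductive Test : Type where
  | lt (r s : ℕ)
  | keyLt (r s : ℕ)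

/-- Commands.  Calls and parallel branches receive a copy of the caller's registers; the caller gets
its own registers back when the call returns, or when both branches have been joined, so results
are communicated through the shared memory. -/
inductive Cmd : Type where
  | instr (i : Instr)
  | seq (c d : Cmd)
  | ite (b : Test) (c d : Cmd)
  /-- call of procedure number `p` (recursion is allowed) -/
  | call (p : ℕ)
  /-- binary fork: run `c` and `d` in parallel, then join -/
  | par (c d : Cmd)

/-- A program is a main command with a finite list of procedures. -/
structure Program : Type where
  main : Cmd
  procs : List Cmd

section Semantics

variable {K : Type u}

def Frame.setNum (ρ : Frame K) (r x : ℕ) : Frame K :=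
  { ρ with num := Function.update ρ.num r x }

def Frame.setKey (ρ : Frame K) (r : ℕ) (x : WithTop K) : Frame K :=
  { ρ with key := Function.update ρ.key r x }

def Mem.setNum (μ : Mem K) (b i x : ℕ) : Mem K :=
  { μ with num := Function.update μ.num b (Function.update (μ.num b) i x) }

def Mem.setKey (μ : Mem K) (b i : ℕ) (x : WithTop K) : Mem K :=
  { μ with key := Function.update μ.key b (Function.update (μ.key b) i x) }

/-- The effect of an atomic instruction on the shared memory and the registers of its thread. -/
def Instr.run : Instr → Mem K → Frame K → Mem K × Frame K
  | .skip, μ, ρ => (μ, ρ)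
  | .const r c, μ, ρ => (μ, ρ.setNum r c)
  | .add r s t, μ, ρ => (μ, ρ.setNum r (ρ.num s + ρ.num t))
  | .sub r s t, μ, ρ => (μ, ρ.setNum r (ρ.num s - ρ.num t))
  | .half r s, μ, ρ => (μ, ρ.setNum r (ρ.num s / 2))
  | .load r b s, μ, ρ => (μ, ρ.setNum r (μ.num b (ρ.num s)))
  | .store b s t, μ, ρ => (μ.setNum b (ρ.num s) (ρ.num t), ρ)
  | .cas r b s t u, μ, ρ =>
      if μ.num b (ρ.num s) = ρ.num t then (μ.setNum b (ρ.num s) (ρ.num u), ρ.setNum r 1)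
      else (μ, ρ.setNum r 0)
  | .keyLoad r b s, μ, ρ => (μ, ρ.setKey r (μ.key b (ρ.num s)))
  | .keyStore b s t, μ, ρ => (μ.setKey b (ρ.num s) (ρ.key t), ρ)

def Test.Holds [LinearOrder K] (ρ : Frame K) : Test → Prop
  | .lt r s => ρ.num r < ρ.num s
  | .keyLt r s => ρ.key r < ρ.key s

/-- The tree of threads of a running computation.  The number `t` is a clock: the length of the
longest chain of sequentially dependent steps that leads to this point of the computation. -/
inductive Conf (K : Type u) : Type u where
  /-- about to execute `c` with registers `ρ` -/
  | exec (c : Cmd) (ρ : Frame K) (t : ℕ)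
  /-- finished with registers `ρ` -/
  | done (ρ : Frame K) (t : ℕ)
  /-- first `x`, then `d` -/
  | seq (x : Conf K) (d : Cmd)
  /-- inside a procedure call; `ρ` are the caller's registers -/
  | ret (ρ : Frame K) (x : Conf K)
  /-- two parallel branches; `ρ` are the registers of the thread that waits for the join -/
  | par (ρ : Frame K) (x y : Conf K)

/-- One step of one thread.  Any thread that is not waiting may be the next to move, so an execution
is an arbitrary interleaving of the steps of the threads, with no synchronization but joins and
atomic instructions.  Every step advances the clock of its thread by one; a join waits for the
later one of the two branches. -/
inductive Step [LinearOrder K] (procs : List Cmd) : Mem K → Conf K → Mem K → Conf K → Prop where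
  | instr (i : Instr) (μ : Mem K) (ρ : Frame K) (t : ℕ) :
      Step procs μ (.exec (.instr i) ρ t) (i.run μ ρ).1 (.done (i.run μ ρ).2 (t + 1))
  | iteTrue (b : Test) (c d : Cmd) (μ : Mem K) (ρ : Frame K) (t : ℕ) (h : b.Holds ρ) :
      Step procs μ (.exec (.ite b c d) ρ t) μ (.exec c ρ (t + 1))
  | iteFalse (b : Test) (c d : Cmd) (μ : Mem K) (ρ : Frame K) (t : ℕ) (h : ¬ b.Holds ρ) :
      Step procs μ (.exec (.ite b c d) ρ t) μ (.exec d ρ (t + 1))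
  | seqStart (c d : Cmd) (μ : Mem K) (ρ : Frame K) (t : ℕ) :
      Step procs μ (.exec (.seq c d) ρ t) μ (.seq (.exec c ρ (t + 1)) d)
  | seqMove (d : Cmd) {μ μ' : Mem K} {x x' : Conf K} (h : Step procs μ x μ' x') :
      Step procs μ (.seq x d) μ' (.seq x' d)
  | seqNext (d : Cmd) (μ : Mem K) (ρ : Frame K) (t : ℕ) :
      Step procs μ (.seq (.done ρ t) d) μ (.exec d ρ (t + 1))
  | callStart (p : ℕ) (μ : Mem K) (ρ : Frame K) (t : ℕ) :
      Step procs μ (.exec (.call p) ρ t) μ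
        (.ret ρ (.exec (procs.getD p (.instr .skip)) ρ (t + 1)))
  | callMove (ρ : Frame K) {μ μ' : Mem K} {x x' : Conf K} (h : Step procs μ x μ' x') :
      Step procs μ (.ret ρ x) μ' (.ret ρ x')
  | callReturn (μ : Mem K) (ρ ρ' : Frame K) (t : ℕ) :
      Step procs μ (.ret ρ (.done ρ' t)) μ (.done ρ (t + 1))
  | fork (c d : Cmd) (μ : Mem K) (ρ : Frame K) (t : ℕ) :
      Step procs μ (.exec (.par c d) ρ t) μ (.par ρ (.exec c ρ (t + 1)) (.exec d ρ (t + 1)))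
  | parLeft (ρ : Frame K) (y : Conf K) {μ μ' : Mem K} {x x' : Conf K} (h : Step procs μ x μ' x') :
      Step procs μ (.par ρ x y) μ' (.par ρ x' y)
  | parRight (ρ : Frame K) (x : Conf K) {μ μ' : Mem K} {y y' : Conf K} (h : Step procs μ y μ' y') :
      Step procs μ (.par ρ x y) μ' (.par ρ x y')
  | join (μ : Mem K) (ρ ρ₁ ρ₂ : Frame K) (t₁ t₂ : ℕ) :
      Step procs μ (.par ρ (.done ρ₁ t₁) (.done ρ₂ t₂)) μ (.done ρ (max t₁ t₂ + 1))

/-- `P.Reach μ k ν x`: some execution of `P` that starts with memory `μ` arrives after exactly `k`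
steps (of all threads together) at memory `ν` and thread tree `x`. -/
inductive Program.Reach [LinearOrder K] (P : Program) (μ : Mem K) :
    ℕ → Mem K → Conf K → Prop where
  | start : P.Reach μ 0 μ (.exec P.main (Frame.init K) 0)
  | step {k : ℕ} {ν ν' : Mem K} {x x' : Conf K} (h : P.Reach μ k ν x)
      (h' : Step P.procs ν x ν' x') : P.Reach μ (k + 1) ν' x'

/-- On memory `μ`, *every* execution of `P` terminates, performs at most `work` steps, has depth at
most `depth`, and ends with a memory and registers that satisfy `Post`.  (No execution has more
than `work` steps, and one that cannot be continued has finished properly.) -/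
def Program.RunsWithin [LinearOrder K] (P : Program) (μ : Mem K) (work depth : ℝ)
    (Post : Mem K → Frame K → Prop) : Prop :=
  ∀ (k : ℕ) (ν : Mem K) (x : Conf K), P.Reach μ k ν x →
    (k : ℝ) ≤ work ∧
      ((∃ ν' x', Step P.procs ν x ν' x') ∨
        ∃ ρ t, x = .done ρ t ∧ (t : ℝ) ≤ depth ∧ Post ν ρ)

end Semantics

/-! ### Binary heaps and batches of updates -/

section Heaps

variable {K : Type u}

/-- A complete binary tree with `n` nodes, which are numbered `1, …, n` level by level; the parent of
node `w > 1` is node `⌊w / 2⌋`.  Node number `v + 1` has key `a v`.  It is a min-heap if no key is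
smaller than the key of the parent node. -/
def IsMinHeap [LinearOrder K] {n : ℕ} (a : Fin n → K) : Prop :=
  ∀ v w : Fin n, (w.val + 1) / 2 = v.val + 1 → a v ≤ a w

/-- The updates of a heap with `n` nodes; `setKey v k` is an increase-key or a decrease-key. -/
inductive Update (K : Type u) (n : ℕ) : Type u where
  | insert (k : K)
  | delete (v : Fin n)
  | setKey (v : Fin n) (k : K)

/-- The node that an update refers to. -/
def Update.target {n : ℕ} : Update K n → Option (Fin n)
  | .insert _ => none
  | .delete v => some v
  | .setKey v _ => some v

/-- The key that an update brings into the heap. -/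
def Update.newKey {n : ℕ} : Update K n → Option K
  | .insert k => some k
  | .delete _ => none
  | .setKey _ k => some k

/-- No two updates of the batch refer to the same node. -/
def ValidBatch {n m : ℕ} (B : Fin m → Update K n) : Prop :=
  ∀ i j v, (B i).target = some v → (B j).target = some v → i = j

/-- The multiset of the keys of a heap. -/
def keys {n : ℕ} (a : Fin n → K) : Multiset K :=
  Finset.univ.val.map a

open scoped Classical in
/-- The multiset of keys after the batch: the keys of all nodes that no update refers to,
the inserted keys, and the new keys of the nodes whose key is changed. -/
noncomputable def keysAfter {n m : ℕ} (a : Fin n → K) (B : Fin m → Update K n) : Multiset K :=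
  (Finset.univ.filter fun v => ∀ i, (B i).target ≠ some v).val.map a +
    Finset.univ.val.filterMap fun i => (B i).newKey

/-- The heap is stored as a flat array: key array `0` contains the key of node `w` in cell `w`,
and cell `0` of numeric array `0` contains the size.  The numeric arrays `3, 4, …` are workspace
and contain only zeros while no operation is running. -/
def StoresHeap (μ : Mem K) {n : ℕ} (a : Fin n → K) : Prop :=
  μ.num 0 0 = n ∧ (∀ v : Fin n, μ.key 0 (v.val + 1) = (a v : WithTop K)) ∧
    ∀ b, 3 ≤ b → ∀ i, μ.num b i = 0

/-- The entry of update number `i` in the input arrays: its kind, the number of the node that it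
refers to, and its key. -/
def StoresUpdate {n : ℕ} (μ : Mem K) (i : ℕ) : Update K n → Prop
  | .insert k => μ.num 1 i = 0 ∧ μ.key 1 i = (k : WithTop K)
  | .delete v => μ.num 1 i = 1 ∧ μ.num 2 i = v.val + 1
  | .setKey v k => μ.num 1 i = 2 ∧ μ.num 2 i = v.val + 1 ∧ μ.key 1 i = (k : WithTop K)

/-- The batch is stored in the input arrays, and its size in cell `1` of numeric array `0`. -/
def StoresBatch {n m : ℕ} (μ : Mem K) (B : Fin m → Update K n) : Prop :=
  μ.num 0 1 = m ∧ ∀ i : Fin m, StoresUpdate μ i.val (B i)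

end Heaps

end ParHeap

/-! Up to the repair of the heap order the program is race-free bookkeeping. The batch is spread
over an array of `n + m` nodes, some of which become holes, and every change is confined to `2 * m`
listed nodes. Prefix sums over this list count the holes. With `N` the number of keys, there are as
many holes among the first `N` nodes as keys beyond them (`Prepared.card_tails`), so these keys fill
the holes. All this takes linear work in `m` and logarithmic depth.

Now the order holds between any ancestor and descendant that are both unaffected (`Filled.order`).
All ancestors of affected nodes are marked; a climbing thread stops at the first marked node. A mark
stands for a wave: a key that may be too large for its subtree. A wave may act only when both
children of its node are unmarked, hence when their subtrees are in order; it then ends or exchanges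
its key with the smaller child and moves there. This is bottom-up heap construction in a pipeline,
without rounds: whoever unmarks a node checks the parent, whoever marks a child checks the child,
and compare-and-swap selects the thread that claims a wave.

Correctness is the invariant `SiftInv`. It maintains logical keys `κ`, which ignore half-finished
exchanges, and labels `lab`, which ignore claims. Every unmarked node is dominated by nothing below
it, and every claimable node has a thread that is going to notice this. Once no thread is left, the
marked node of largest number would be claimable, so there is none, and the array is a heap.

A wave is labelled by the node where it started, and along every path from the root the levels of
the labels strictly increase. This has two uses. First, a stale read is harmless: a later wave at
the same node has a label of lower level, so a successful compare-and-swap certifies that the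
children seen unmarked still are (`SiftInv.claim`). Second, it bounds the depth. If all labels on
the way from `x` to the root have level below `e`, then `2 * e - log x` drops with every follow-up
check: after a wave labelled `a` has left `x`, the parent is checked with `e` replaced by `log a <
e`, the child with `log a + 1 ≤ e`. So a chain has `O(log N)` checks (`checkSpec`).

The work is bounded by a potential. A wave at `x` makes at most `1 + min (height of x) (number of
smaller keys below x)` steps, and every step of a wave lowers the sum of these bounds
(`potential_settle`, `potential_swap`). Initially the sum is `O(m * (1 + log ((n + m) / m)))`
(`upset_bound`): the nodes below number `m` cost as much as building a heap of size `m` plus `m`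
paths of length `O(1 + log ((n + m) / m))`; for the others, smaller keys below an unaffected node
belong to affected nodes, and an affected node has few ancestors numbered at least `m`.

Two program logics turn this into statements about all interleavings. `Safe` treats race-free code
through read and write footprints. `WP` treats racing threads through an invariant, owned tokens and
credits, the credits accounting for the amortized work. Both carry the clock in the postcondition,
which gives the depth. -/

namespace ParHeap

/-! ### A logic for race-free programs -/

section Logic

variable {K : Type u}

/-- The cells of the shared memory. -/
inductive Loc : Type where
  | num (b i : ℕ)
  | key (b i : ℕ)

/-- Two memories agree on a set of cells. -/
structure Agree (F : Set Loc) (μ ν : Mem K) : Prop where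
  num : ∀ b i, Loc.num b i ∈ F → μ.num b i = ν.num b i
  key : ∀ b i, Loc.key b i ∈ F → μ.key b i = ν.key b i

theorem Agree.refl (F : Set Loc) (μ : Mem K) : Agree F μ μ := ⟨fun _ _ _ => rfl, fun _ _ _ => rfl⟩

theorem Agree.trans {F : Set Loc} {μ ν ξ : Mem K} (h : Agree F μ ν) (h' : Agree F ν ξ) :
    Agree F μ ξ :=
  ⟨fun b i hi => (h.num b i hi).trans (h'.num b i hi),
    fun b i hi => (h.key b i hi).trans (h'.key b i hi)⟩

theorem Agree.mono {F F' : Set Loc} {μ ν : Mem K} (h : Agree F μ ν) (hF : F' ⊆ F) :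
    Agree F' μ ν :=
  ⟨fun b i hi => h.num b i (hF hi), fun b i hi => h.key b i (hF hi)⟩

theorem Agree.eq {μ ν : Mem K} (h : Agree Set.univ μ ν) : μ = ν := by
  cases μ; cases ν
  congr 1
  · funext b i; exact h.num b i trivial
  · funext b i; exact h.key b i trivial

theorem agree_setNum (F : Set Loc) {μ ν : Mem K} (h : Agree F μ ν) (b i v : ℕ) :
    Agree F (μ.setNum b i v) (ν.setNum b i v) := by
  refine ⟨fun b' i' hi => ?_, fun b' i' hi => h.key b' i' hi⟩
  by_cases hb : b' = b
  · subst hb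
    by_cases hi' : i' = i
    · simp [Mem.setNum, hi']
    · simpa [Mem.setNum, hi'] using h.num _ _ hi
  · simpa [Mem.setNum, hb] using h.num _ _ hi

theorem agree_setKey (F : Set Loc) {μ ν : Mem K} (h : Agree F μ ν) (b i : ℕ) (v : WithTop K) :
    Agree F (μ.setKey b i v) (ν.setKey b i v) := by
  refine ⟨fun b' i' hi => h.num b' i' hi, fun b' i' hi => ?_⟩
  by_cases hb : b' = b
  · subst hb
    by_cases hi' : i' = i
    · simp [Mem.setKey, hi']
    · simpa [Mem.setKey, hi'] using h.key _ _ hi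
  · simpa [Mem.setKey, hb] using h.key _ _ hi

theorem agree_setNum_compl {W : Set Loc} {b i : ℕ} (h : Loc.num b i ∈ W) (μ : Mem K) (v : ℕ) :
    Agree Wᶜ μ (μ.setNum b i v) := by
  refine ⟨fun b' i' hi => ?_, fun _ _ _ => rfl⟩
  by_cases hb : b' = b
  · subst hb
    by_cases hi' : i' = i
    · subst hi'; exact absurd h hi
    · simp [Mem.setNum, hi']
  · simp [Mem.setNum, hb]

theorem agree_setKey_compl {W : Set Loc} {b i : ℕ} (h : Loc.key b i ∈ W) (μ : Mem K)
    (v : WithTop K) : Agree Wᶜ μ (μ.setKey b i v) := by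
  refine ⟨fun _ _ _ => rfl, fun b' i' hi => ?_⟩
  by_cases hb : b' = b
  · subst hb
    by_cases hi' : i' = i
    · subst hi'; exact absurd h hi
    · simp [Mem.setKey, hi']
  · simp [Mem.setKey, hb]

/-- The instruction reads only cells in `F` and writes only cells in `W`. -/
def Instr.Ok (F W : Set Loc) (ρ : Frame K) : Instr → Prop
  | .load _ b s => Loc.num b (ρ.num s) ∈ F
  | .store b s _ => Loc.num b (ρ.num s) ∈ W
  | .cas _ b s _ _ => Loc.num b (ρ.num s) ∈ F ∩ W
  | .keyLoad _ b s => Loc.key b (ρ.num s) ∈ F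
  | .keyStore b s _ => Loc.key b (ρ.num s) ∈ W
  | _ => True

/-- The effect depends only on the cells in `F`, so a run on one memory predicts the run on every
memory that agrees with it there. This lets the footprint logic ignore what other threads do
elsewhere. -/
theorem Instr.Ok.run {F W : Set Loc} {μ : Mem K} {i : Instr} {ρ : Frame K} (h : i.Ok F W ρ) {ν : Mem K} (ha : Agree F μ ν) :
    (i.run ν ρ).2 = (i.run μ ρ).2 ∧ Agree F (i.run μ ρ).1 (i.run ν ρ).1 ∧
      Agree Wᶜ ν (i.run ν ρ).1 := by
  cases i with
  | load r b s => exact ⟨by simp [Instr.run, ha.num _ _ h], ha, .refl _ _⟩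
  | store b s t => exact ⟨rfl, agree_setNum F ha _ _ _, agree_setNum_compl h _ _⟩
  | cas r b s t u =>
    simp only [Instr.run, ← ha.num _ _ h.1]
    split
    · exact ⟨rfl, agree_setNum F ha _ _ _, agree_setNum_compl h.2 _ _⟩
    · exact ⟨rfl, ha, .refl _ _⟩
  | keyLoad r b s => exact ⟨by simp [Instr.run, ha.key _ _ h], ha, .refl _ _⟩
  | keyStore b s t => exact ⟨rfl, agree_setKey F ha _ _ _, agree_setKey_compl h _ _⟩
  | _ => exact ⟨rfl, ha, .refl _ _⟩

variable [LinearOrder K]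

/-- A thread tree that is not finished can always move. -/
theorem Conf.progress (procs : List Cmd) (μ : Mem K) (x : Conf K) :
    (∃ ρ t, x = .done ρ t) ∨ ∃ μ' x', Step procs μ x μ' x' := by
  induction x with
  | exec c ρ t =>
    right
    cases c with
    | instr i => exact ⟨_, _, .instr i μ ρ t⟩
    | seq c d => exact ⟨_, _, .seqStart c d μ ρ t⟩
    | ite b c d =>
      by_cases h : b.Holds ρ
      · exact ⟨_, _, .iteTrue b c d μ ρ t h⟩
      · exact ⟨_, _, .iteFalse b c d μ ρ t h⟩
    | call p => exact ⟨_, _, .callStart p μ ρ t⟩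
    | par c d => exact ⟨_, _, .fork c d μ ρ t⟩
  | done ρ t => exact .inl ⟨ρ, t, rfl⟩
  | seq x d ih =>
    right
    obtain ⟨ρ, t, rfl⟩ | ⟨μ', x', h⟩ := ih
    · exact ⟨_, _, .seqNext d μ ρ t⟩
    · exact ⟨_, _, .seqMove d h⟩
  | ret ρ x ih =>
    right
    obtain ⟨ρ', t, rfl⟩ | ⟨μ', x', h⟩ := ih
    · exact ⟨_, _, .callReturn μ ρ ρ' t⟩
    · exact ⟨_, _, .callMove ρ h⟩
  | par ρ x y ihx ihy =>
    right
    obtain ⟨ρ₁, t₁, rfl⟩ | ⟨μ', x', h⟩ := ihx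
    · obtain ⟨ρ₂, t₂, rfl⟩ | ⟨μ', y', h⟩ := ihy
      · exact ⟨_, _, .join μ ρ ρ₁ ρ₂ t₁ t₂⟩
      · exact ⟨_, _, .parRight ρ _ h⟩
    · exact ⟨_, _, .parLeft ρ y h⟩

/-- Postconditions: predicates of the final memory, registers and clock. -/
abbrev Post (K : Type u) := Mem K → Frame K → ℕ → Prop

/-- From memory `μ`, the thread tree `x` finishes after at most `k` own steps with the
postcondition `Q`, and writes only cells in `W`, as long as the other threads do not write cells
in `F`. -/
def Safe (procs : List Cmd) (F W : Set Loc) (Q : Post K) : ℕ → Mem K → Conf K → Prop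
  | 0, μ, x => ∀ μ₁, Agree F μ μ₁ → ∃ ρ t, x = .done ρ t ∧ Q μ₁ ρ t
  | k + 1, μ, x => ∀ μ₁, Agree F μ μ₁ → (∀ ρ t, x = .done ρ t → Q μ₁ ρ t) ∧
      ∀ μ₂ x₂, Step procs μ₁ x μ₂ x₂ → Agree Wᶜ μ₁ μ₂ ∧ Safe procs F W Q k μ₂ x₂

variable {procs : List Cmd} {F W : Set Loc} {Q : Post K} {k : ℕ} {μ : Mem K} {x : Conf K}

/-- Interference outside `F` is already allowed before each step by the definition of `Safe`, and
agreement on `F` is transitive. -/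
theorem Safe.stable {μ' : Mem K} (h : Safe procs F W Q k μ x) (hμ : Agree F μ μ') :
    Safe procs F W Q k μ' x := by
  cases k with
  | zero => exact fun μ₁ h₁ => h μ₁ (hμ.trans h₁)
  | succ k => exact fun μ₁ h₁ => h μ₁ (hμ.trans h₁)

theorem Safe.post {ρ : Frame K} {t : ℕ} (h : Safe procs F W Q k μ (.done ρ t)) : Q μ ρ t := by
  cases k with
  | zero =>
    obtain ⟨ρ', t', h', hQ⟩ := h μ (.refl _ _)
    cases h'; exact hQ
  | succ k => exact (h μ (.refl _ _)).1 ρ t rfl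

theorem Safe.done {ρ : Frame K} {t : ℕ} (h : ∀ μ₁, Agree F μ μ₁ → Q μ₁ ρ t) :
    Safe procs F W Q k μ (.done ρ t) := by
  cases k with
  | zero => exact fun μ₁ h₁ => ⟨ρ, t, rfl, h μ₁ h₁⟩
  | succ k =>
    refine fun μ₁ h₁ => ⟨fun ρ' t' he => ?_, fun μ₂ x₂ hs => nomatch hs⟩
    cases he; exact h μ₁ h₁

/-- A thread tree that moves is unfinished, so it has fuel left. -/
theorem Safe.step {μ' : Mem K} {x' : Conf K} (h : Safe procs F W Q k μ x)
    (hs : Step procs μ x μ' x') :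
    ∃ j, k = j + 1 ∧ Agree Wᶜ μ μ' ∧ Safe procs F W Q j μ' x' := by
  cases k with
  | zero =>
    obtain ⟨ρ', t', rfl, hQ⟩ := h μ (.refl _ _)
    exact nomatch hs
  | succ k => exact ⟨k, rfl, (h μ (.refl _ _)).2 _ _ hs⟩

theorem Safe.of_step (hx : ∀ ρ t, x ≠ .done ρ t)
    (h : ∀ μ₁, Agree F μ μ₁ → ∀ μ₂ x₂, Step procs μ₁ x μ₂ x₂ →
      Agree Wᶜ μ₁ μ₂ ∧ Safe procs F W Q k μ₂ x₂) :
    Safe procs F W Q (k + 1) μ x :=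
  fun μ₁ h₁ => ⟨fun ρ t e => absurd e (hx ρ t), h μ₁ h₁⟩

/-- Larger footprints, weaker postconditions; the cells outside the write footprint that are
protected from the other threads keep their values. -/
theorem Safe.frame {F' W' : Set Loc} {Q' : Post K} {k' : ℕ} (hF : F ⊆ F') (hW : W ⊆ W')
    (hk : k ≤ k') (h : Safe procs F W Q k μ x)
    (hQ : ∀ μ' ρ t, Q μ' ρ t → Agree (F' \ W) μ μ' → Q' μ' ρ t) :
    Safe procs F' W' Q' k' μ x := by
  -- The initial memory must stay fixed while the current one varies in the induction; all that is
  -- kept is their agreement on `F' \ W`.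
  obtain ⟨μ₀, hμ₀⟩ : ∃ μ₀, μ₀ = μ := ⟨μ, rfl⟩
  rw [← hμ₀] at hQ
  replace hμ₀ : Agree (F' \ W) μ₀ μ := hμ₀ ▸ .refl _ _
  induction k' generalizing k μ x with
  | zero =>
    obtain rfl : k = 0 := by omega
    intro μ₁ h₁
    obtain ⟨ρ, t, e, hq⟩ := h μ₁ (h₁.mono hF)
    exact ⟨ρ, t, e, hQ _ _ _ hq (hμ₀.trans (h₁.mono Set.sdiff_subset))⟩
  | succ k' ih =>
    intro μ₁ h₁
    have hs := h.stable (h₁.mono hF)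
    refine ⟨?_, fun μ₂ x₂ hst => ?_⟩
    · rintro ρ t rfl
      exact hQ _ _ _ hs.post (hμ₀.trans (h₁.mono Set.sdiff_subset))
    · obtain ⟨j, rfl, ha, hj⟩ := hs.step hst
      refine ⟨ha.mono (Set.compl_subset_compl.2 hW), ih (by omega) hj ?_⟩
      exact (hμ₀.trans (h₁.mono Set.sdiff_subset)).trans (ha.mono fun l hl => hl.2)

theorem Safe.mono {Q' : Post K} {k' : ℕ} (h : Safe procs F W Q k μ x) (hk : k ≤ k')
    (hQ : ∀ μ' ρ t, Q μ' ρ t → Q' μ' ρ t) : Safe procs F W Q' k' μ x :=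
  h.frame subset_rfl subset_rfl hk fun μ' ρ t hq _ => hQ μ' ρ t hq

theorem Safe.seq {Q' : Post K} {d : Cmd} {k' : ℕ} (h : Safe procs F W Q k μ x)
    (hd : ∀ μ' ρ t, Q μ' ρ t → Safe procs F W Q' k' μ' (.exec d ρ (t + 1))) :
    Safe procs F W Q' (k + 1 + k') μ (.seq x d) := by
  induction k generalizing μ x with
  | zero =>
    rw [show 0 + 1 + k' = k' + 1 by omega]
    refine Safe.of_step (by simp) fun μ₁ h₁ μ₂ x₂ hs => ?_
    obtain ⟨ρ, t, rfl, hq⟩ := h μ₁ h₁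
    cases hs with
    | seqMove _ hs => exact nomatch hs
    | seqNext => exact ⟨.refl _ _, hd _ _ _ hq⟩
  | succ k ih =>
    rw [show k + 1 + 1 + k' = (k + 1 + k') + 1 by omega]
    refine Safe.of_step (by simp) fun μ₁ h₁ μ₂ x₂ hs => ?_
    have h' := h.stable h₁
    cases hs with
    | seqMove _ hs =>
      obtain ⟨j, hj, ha, hj'⟩ := h'.step hs
      obtain rfl : k = j := by omega
      exact ⟨ha, ih hj'⟩
    | seqNext =>
      exact ⟨.refl _ _, (hd _ _ _ h'.post).mono (by omega) fun _ _ _ h => h⟩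

theorem Safe.ret {ρ : Frame K} (h : Safe procs F W Q k μ x) :
    Safe procs F W (fun μ' ρ' t' => ρ' = ρ ∧ ∃ ρ'' t'', t' = t'' + 1 ∧ Q μ' ρ'' t'') (k + 1) μ
      (.ret ρ x) := by
  induction k generalizing μ x with
  | zero =>
    refine Safe.of_step (by simp) fun μ₁ h₁ μ₂ x₂ hs => ?_
    obtain ⟨ρ', t, rfl, hq⟩ := h μ₁ h₁
    cases hs with
    | callMove _ hs => exact nomatch hs
    | callReturn =>
      exact ⟨.refl _ _, Safe.done fun μ₃ h₃ => ⟨rfl, ρ', t, rfl, (h.stable (h₁.trans h₃)).post⟩⟩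
  | succ k ih =>
    refine Safe.of_step (by simp) fun μ₁ h₁ μ₂ x₂ hs => ?_
    have h' := h.stable h₁
    cases hs with
    | callMove _ hs =>
      obtain ⟨j, hj, ha, hj'⟩ := h'.step hs
      obtain rfl : k = j := by omega
      exact ⟨ha, ih hj'⟩
    | callReturn =>
      exact ⟨.refl _ _, Safe.done fun μ₃ h₃ => ⟨rfl, _, _, rfl, (h'.stable h₃).post⟩⟩

/-- A step of one branch writes outside the cells on which the other relies, so the other stays safe
by stability. The induction is on the fuel of both branches together, since the interleaving is
arbitrary. -/
theorem Safe.par {F₁ W₁ F₂ W₂ : Set Loc} {Q₁ Q₂ : Post K} {k₁ k₂ : ℕ} {y : Conf K} {ρ : Frame K}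
    (hx : Safe procs F₁ W₁ Q₁ k₁ μ x) (hy : Safe procs F₂ W₂ Q₂ k₂ μ y)
    (h₁₂ : Disjoint W₁ F₂) (h₂₁ : Disjoint W₂ F₁)
    (hQ : ∀ μ' ρ₁ t₁ ρ₂ t₂, Q₁ μ' ρ₁ t₁ → Q₂ μ' ρ₂ t₂ → Q μ' ρ (max t₁ t₂ + 1)) :
    Safe procs (F₁ ∪ F₂) (W₁ ∪ W₂) Q (k₁ + k₂ + 1) μ (.par ρ x y) := by
  obtain ⟨k, hk⟩ : ∃ k, k = k₁ + k₂ := ⟨_, rfl⟩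
  rw [← hk]
  have key : ∀ {W F : Set Loc} {ν ν' : Mem K}, Disjoint W F → Agree Wᶜ ν ν' → Agree F ν ν' :=
    fun hd ha => ha.mono fun l hl hw => Set.disjoint_left.1 hd hw hl
  have hfin : ∀ {μ₁ : Mem K} {ρ₁ ρ₂ : Frame K} {t₁ t₂ j₁ j₂ j : ℕ},
      Safe procs F₁ W₁ Q₁ j₁ μ₁ (.done ρ₁ t₁) → Safe procs F₂ W₂ Q₂ j₂ μ₁ (.done ρ₂ t₂) →
      Safe procs (F₁ ∪ F₂) (W₁ ∪ W₂) Q j μ₁ (.done ρ (max t₁ t₂ + 1)) := fun h h' =>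
    Safe.done fun μ₃ h₃ => hQ _ _ _ _ _ (h.stable (h₃.mono Set.subset_union_left)).post
      (h'.stable (h₃.mono Set.subset_union_right)).post
  induction k generalizing μ x y k₁ k₂ with
  | zero =>
    refine Safe.of_step (by simp) fun μ₁ h₁ μ₂ x₂ hs => ?_
    have hx' := hx.stable (h₁.mono Set.subset_union_left)
    have hy' := hy.stable (h₁.mono Set.subset_union_right)
    cases hs with
    | parLeft _ _ hs => obtain ⟨j, hj, -⟩ := hx'.step hs; omega
    | parRight _ _ hs => obtain ⟨j, hj, -⟩ := hy'.step hs; omega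
    | join => exact ⟨.refl _ _, hfin hx' hy'⟩
  | succ k ih =>
    refine Safe.of_step (by simp) fun μ₁ h₁ μ₂ x₂ hs => ?_
    have hx' := hx.stable (h₁.mono Set.subset_union_left)
    have hy' := hy.stable (h₁.mono Set.subset_union_right)
    cases hs with
    | parLeft _ _ hs =>
      obtain ⟨j, rfl, ha, hj⟩ := hx'.step hs
      exact ⟨ha.mono (Set.compl_subset_compl.2 Set.subset_union_left),
        ih hj (hy'.stable (key h₁₂ ha)) (by omega)⟩
    | parRight _ _ hs =>
      obtain ⟨j, rfl, ha, hj⟩ := hy'.step hs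
      exact ⟨ha.mono (Set.compl_subset_compl.2 Set.subset_union_right),
        ih (hx'.stable (key h₂₁ ha)) hj (by omega)⟩
    | join => exact ⟨.refl _ _, hfin hx' hy'⟩

theorem Safe.exec_seq {Q' : Post K} {c d : Cmd} {k' t : ℕ} {ρ : Frame K}
    (h : Safe procs F W Q k μ (.exec c ρ (t + 1)))
    (hd : ∀ μ' ρ' t', Q μ' ρ' t' → Safe procs F W Q' k' μ' (.exec d ρ' (t' + 1))) :
    Safe procs F W Q' (k + k' + 2) μ (.exec (.seq c d) ρ t) := by
  rw [show k + k' + 2 = (k + 1 + k') + 1 by omega]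
  refine Safe.of_step (by simp) fun μ₁ h₁ μ₂ x₂ hs => ?_
  cases hs
  exact ⟨.refl _ _, (h.stable h₁).seq hd⟩

theorem Safe.exec_call {p t : ℕ} {ρ : Frame K}
    (h : Safe procs F W Q k μ (.exec (procs.getD p (.instr .skip)) ρ (t + 1))) :
    Safe procs F W (fun μ' ρ' t' => ρ' = ρ ∧ ∃ ρ'' t'', t' = t'' + 1 ∧ Q μ' ρ'' t'') (k + 2) μ
      (.exec (.call p) ρ t) := by
  refine Safe.of_step (by simp) fun μ₁ h₁ μ₂ x₂ hs => ?_
  cases hs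
  exact ⟨.refl _ _, (h.stable h₁).ret⟩

theorem Safe.exec_par {F₁ W₁ F₂ W₂ : Set Loc} {Q₁ Q₂ : Post K} {k₁ k₂ t : ℕ} {c d : Cmd}
    {ρ : Frame K}
    (hx : Safe procs F₁ W₁ Q₁ k₁ μ (.exec c ρ (t + 1)))
    (hy : Safe procs F₂ W₂ Q₂ k₂ μ (.exec d ρ (t + 1)))
    (h₁₂ : Disjoint W₁ F₂) (h₂₁ : Disjoint W₂ F₁)
    (hQ : ∀ μ' ρ₁ t₁ ρ₂ t₂, Q₁ μ' ρ₁ t₁ → Q₂ μ' ρ₂ t₂ → Q μ' ρ (max t₁ t₂ + 1)) :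
    Safe procs (F₁ ∪ F₂) (W₁ ∪ W₂) Q (k₁ + k₂ + 2) μ (.exec (.par c d) ρ t) := by
  refine Safe.of_step (by simp) fun μ₁ h₁ μ₂ x₂ hs => ?_
  cases hs
  exact ⟨.refl _ _, Safe.par (hx.stable (h₁.mono Set.subset_union_left))
    (hy.stable (h₁.mono Set.subset_union_right)) h₁₂ h₂₁ hQ⟩

theorem Safe.exec_ite {b : Test} {c d : Cmd} {ρ : Frame K} {t : ℕ}
    (h : b.Holds ρ → Safe procs F W Q k μ (.exec c ρ (t + 1)))
    (h' : ¬ b.Holds ρ → Safe procs F W Q k μ (.exec d ρ (t + 1))) :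
    Safe procs F W Q (k + 1) μ (.exec (.ite b c d) ρ t) := by
  refine Safe.of_step (by simp) fun μ₁ h₁ μ₂ x₂ hs => ?_
  cases hs with
  | iteTrue _ _ _ _ _ _ hb => exact ⟨.refl _ _, (h hb).stable h₁⟩
  | iteFalse _ _ _ _ _ _ hb => exact ⟨.refl _ _, (h' hb).stable h₁⟩

/-! ### Sequential code -/

/-- An upper bound on the number of steps of sequential code. -/
def Cmd.cost : Cmd → ℕ
  | .instr _ => 1
  | .seq c d => c.cost + d.cost + 2
  | .ite _ c d => max c.cost d.cost + 1
  | .call _ => 0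
  | .par _ _ => 0

/-- The weakest precondition of sequential code with given footprints. -/
def wlp (F W : Set Loc) : Cmd → (Mem K → Frame K → Prop) → Mem K → Frame K → Prop
  | .instr i, Q, μ, ρ => i.Ok F W ρ ∧ Q (i.run μ ρ).1 (i.run μ ρ).2
  | .seq c d, Q, μ, ρ => wlp F W c (fun μ ρ => wlp F W d Q μ ρ) μ ρ
  | .ite b c d, Q, μ, ρ => (b.Holds ρ → wlp F W c Q μ ρ) ∧ (¬ b.Holds ρ → wlp F W d Q μ ρ)
  | .call _, _, _, _ => False
  | .par _ _, _, _, _ => False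

/-- The code is simulated on a memory `ν` that no other thread touches; the real memory follows it
only on `F`. Hence `P` is asserted of `ν` and has to be transferred by the user through stability.
-/
theorem wlp.safe {c : Cmd} {P : Mem K → Frame K → Prop} {ρ : Frame K} {t : ℕ}
    (h : wlp F W c P μ ρ) :
    Safe procs F W (fun μ' ρ' t' => (∃ ν, Agree F ν μ' ∧ P ν ρ') ∧ t' ≤ t + c.cost) c.cost μ
      (.exec c ρ t) := by
  induction c generalizing μ ρ t P with
  | instr i =>
    refine Safe.of_step (by simp) fun μ₁ h₁ μ₂ x₂ hs => ?_
    cases hs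
    obtain ⟨e, ha, hw⟩ := h.1.run h₁
    refine ⟨hw, Safe.done fun μ₃ h₃ => ⟨⟨_, ha.trans h₃, ?_⟩, le_rfl⟩⟩
    rw [e]; exact h.2
  | seq c d ihc ihd =>
    refine Safe.exec_seq (ihc h) fun μ' ρ' t' hq => ?_
    obtain ⟨⟨ν, hν, hP⟩, ht⟩ := hq
    refine ((ihd hP).stable hν).mono le_rfl ?_
    rintro μ'' ρ'' t'' ⟨hq, ht'⟩
    refine ⟨hq, ?_⟩
    simp only [Cmd.cost]; omega
  | ite b c d ihc ihd =>
    refine Safe.exec_ite (fun hb => ?_) (fun hb => ?_)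
    · refine (ihc (h.1 hb)).mono (le_max_left _ _) ?_
      rintro μ'' ρ'' t'' ⟨hq, ht'⟩
      refine ⟨hq, ?_⟩
      have := le_max_left c.cost d.cost
      simp only [Cmd.cost]; omega
    · refine (ihd (h.2 hb)).mono (le_max_right _ _) ?_
      rintro μ'' ρ'' t'' ⟨hq, ht'⟩
      refine ⟨hq, ?_⟩
      have := le_max_right c.cost d.cost
      simp only [Cmd.cost]; omega
  | call p => exact h.elim
  | par c d => exact h.elim

/-- Whole executions. -/
theorem Program.runsWithin_of_safe {P : Program} {w d : ℝ} {Ψ : Mem K → Frame K → Prop}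
    (h : Safe P.procs Set.univ Set.univ Q k μ (.exec P.main (Frame.init K) 0)) (hw : (k : ℝ) ≤ w)
    (hQ : ∀ ν ρ t, Q ν ρ t → (t : ℝ) ≤ d ∧ Ψ ν ρ) : P.RunsWithin μ w d Ψ := by
  intro j ν x hr
  have key : ∃ i, i + j = k ∧ Safe P.procs Set.univ Set.univ Q i ν x := by
    induction hr with
    | start => exact ⟨k, rfl, h⟩
    | step hr hs ih =>
      obtain ⟨i, hi, hsafe⟩ := ih
      obtain ⟨i', rfl, -, hs'⟩ := hsafe.step hs
      exact ⟨i', by omega, hs'⟩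
  obtain ⟨i, hi, hs⟩ := key
  refine ⟨le_trans (by exact_mod_cast (by omega : j ≤ k)) hw, ?_⟩
  obtain ⟨ρ, t, rfl⟩ | hp := Conf.progress P.procs ν x
  · exact .inr ⟨ρ, t, rfl, hQ _ _ _ hs.post⟩
  · exact .inl hp

end Logic

end ParHeap

namespace ParHeap

/-! ### A logic for programs with races

Each thread owns an element of a commutative monoid `G` and some credits.  The shared memory, the
sum of what all threads own and a common stock of credits are related by an invariant.  A step may
change the own element of its thread and costs one credit. -/

section Ghost

variable {K : Type u} {G : Type*} [AddCommMonoid G]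

/-- The instruction does not refer to the memory. -/
def Instr.IsLocal : Instr → Prop
  | .skip | .const _ _ | .add _ _ _ | .sub _ _ _ | .half _ _ => True
  | _ => False

theorem Instr.IsLocal.run {i : Instr} (h : i.IsLocal) (μ ν : Mem K) (ρ : Frame K) :
    i.run μ ρ = (μ, (i.run ν ρ).2) := by
  cases i <;> first | rfl | exact h.elim

/-- Postconditions: what is owned at the end, credits that are left, registers and clock. -/
abbrev GPost (K : Type u) (G : Type*) := G → ℕ → Frame K → ℕ → Prop

variable [LinearOrder K]

/-- The first `n` steps of the thread tree `x` preserve the invariant. -/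
def WPn (procs : List Cmd) (I : ℕ → Mem K → G → Prop) (Q : GPost K G) : ℕ → G → ℕ → Conf K → Prop
  | 0, _, _, _ => True
  | n + 1, g, k, x => (∀ ρ t, x = .done ρ t → Q g k ρ t) ∧
      ∀ μ f p, I p μ (g + f) → ∀ μ' x', Step procs μ x μ' x' →
        ∃ g' p' k', p' + k' + 1 ≤ p + k ∧ I p' μ' (g' + f) ∧ WPn procs I Q n g' k' x'

/-- Owning `g` and `k` credits, the thread tree `x` runs and arrives at the postcondition. -/
def WP (procs : List Cmd) (I : ℕ → Mem K → G → Prop) (Q : GPost K G) (g : G) (k : ℕ) (x : Conf K) :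
    Prop := ∀ n, WPn procs I Q n g k x

variable {procs : List Cmd} {I : ℕ → Mem K → G → Prop} {Q : GPost K G} {g : G} {k : ℕ}
  {x : Conf K} {ρ : Frame K} {t : ℕ}

theorem WP.done (h : Q g k ρ t) : WP procs I Q g k (.done ρ t) := by
  intro n
  cases n with
  | zero => trivial
  | succ n => exact ⟨fun ρ' t' e => by cases e; exact h, fun _ _ _ _ _ _ hs => nomatch hs⟩

theorem WPn.post {n : ℕ} (h : WPn procs I Q (n + 1) g k (.done ρ t)) : Q g k ρ t :=
  h.1 _ _ rfl

theorem WPn.of_step {n : ℕ} (hx : ∀ ρ t, x ≠ .done ρ t)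
    (h : ∀ μ f p, I p μ (g + f) → ∀ μ' x', Step procs μ x μ' x' →
        ∃ g' p' k', p' + k' + 1 ≤ p + k ∧ I p' μ' (g' + f) ∧ WPn procs I Q n g' k' x') :
    WPn procs I Q (n + 1) g k x :=
  ⟨fun ρ t e => absurd e (hx ρ t), h⟩

theorem WP.of_step (hx : ∀ ρ t, x ≠ .done ρ t)
    (h : ∀ μ f p, I p μ (g + f) → ∀ μ' x', Step procs μ x μ' x' →
        ∃ g' p' k', p' + k' + 1 ≤ p + k ∧ I p' μ' (g' + f) ∧ WP procs I Q g' k' x') :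
    WP procs I Q g k x := by
  intro n
  cases n with
  | zero => trivial
  | succ n =>
    refine WPn.of_step hx fun μ f p hI μ' x' hs => ?_
    obtain ⟨g', p', k', h₁, h₂, h₃⟩ := h μ f p hI μ' x' hs
    exact ⟨g', p', k', h₁, h₂, h₃ n⟩

/-- Unused credits are left at the end. -/
theorem WP.mono {Q' : GPost K G} {k' : ℕ} (h : WP procs I Q g k x) (hk : k ≤ k')
    (hQ : ∀ g i ρ t, Q g i ρ t → Q' g (i + (k' - k)) ρ t) : WP procs I Q' g k' x := by
  obtain ⟨e, rfl⟩ := Nat.exists_eq_add_of_le hk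
  rw [Nat.add_sub_cancel_left] at hQ
  clear hk
  intro n
  replace h := h n
  induction n generalizing g k x with
  | zero => trivial
  | succ n ih =>
    refine ⟨fun ρ t e => hQ _ _ _ _ (h.1 ρ t e), fun μ f p hI μ' x' hs => ?_⟩
    obtain ⟨g', p', j, h₁, h₂, h₃⟩ := h.2 μ f p hI μ' x' hs
    exact ⟨g', p', j + e, by omega, h₂, ih h₃⟩

/-- Passing to the continuation is itself a step, which is why one credit must be left over by the
first command. -/
theorem WP.seq {Q' : GPost K G} {d : Cmd} (h : WP procs I Q g k x)
    (hd : ∀ g' k' ρ t, Q g' k' ρ t →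
      ∃ j, k' = j + 1 ∧ WP procs I Q' g' j (.exec d ρ (t + 1))) :
    WP procs I Q' g k (.seq x d) := by
  intro n
  replace h := h n
  induction n generalizing g k x with
  | zero => trivial
  | succ n ih =>
    refine WPn.of_step (by simp) fun μ f p hI μ' x' hs => ?_
    cases hs with
    | seqMove _ hs =>
      obtain ⟨g', p', j, h₁, h₂, h₃⟩ := h.2 μ f p hI _ _ hs
      exact ⟨g', p', j, h₁, h₂, ih h₃⟩
    | seqNext =>
      obtain ⟨j, rfl, hj⟩ := hd _ _ _ _ h.post
      exact ⟨g, p, j, by omega, hI, hj n⟩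

theorem WP.ret (h : WP procs I (fun g k _ t => ∃ j, k = j + 1 ∧ Q g j ρ (t + 1)) g k x) :
    WP procs I Q g k (.ret ρ x) := by
  intro n
  replace h := h n
  induction n generalizing g k x with
  | zero => trivial
  | succ n ih =>
    refine WPn.of_step (by simp) fun μ f p hI μ' x' hs => ?_
    cases hs with
    | callMove _ hs =>
      obtain ⟨g', p', j, h₁, h₂, h₃⟩ := h.2 μ f p hI _ _ hs
      exact ⟨g', p', j, h₁, h₂, ih h₃⟩
    | callReturn =>
      obtain ⟨j, rfl, hj⟩ := h.post
      exact ⟨g, p, j, by omega, hI, WP.done hj n⟩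

/-- For a step of one branch, the sibling's element belongs to the frame `f`. The `k` credits stay
with the parent; together with what the branches leave they pay for the join. -/
theorem WP.par {Q₁ Q₂ : GPost K G} {g₁ g₂ : G} {k₁ k₂ : ℕ} {y : Conf K}
    (hx : WP procs I Q₁ g₁ k₁ x) (hy : WP procs I Q₂ g₂ k₂ y)
    (hQ : ∀ h₁ j₁ ρ₁ t₁ h₂ j₂ ρ₂ t₂, Q₁ h₁ j₁ ρ₁ t₁ → Q₂ h₂ j₂ ρ₂ t₂ →
      ∃ j, j + 1 ≤ k + j₁ + j₂ ∧ Q (h₁ + h₂) j ρ (max t₁ t₂ + 1)) :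
    WP procs I Q (g₁ + g₂) (k + k₁ + k₂) (.par ρ x y) := by
  intro n
  replace hx := hx n
  replace hy := hy n
  induction n generalizing g₁ g₂ k₁ k₂ x y with
  | zero => trivial
  | succ n ih =>
    -- The branch that does not move must follow the step index of the whole tree downwards.
    have down : ∀ {m : ℕ} {Q : GPost K G} {g k x}, WPn procs I Q (m + 1) g k x →
        WPn procs I Q m g k x := by
      intro m
      induction m with
      | zero => intros; trivial
      | succ m ihm =>
        intro Q g k x h
        refine ⟨h.1, fun μ f p hI μ' x' hs => ?_⟩
        obtain ⟨g', p', j, h₁, h₂, h₃⟩ := h.2 μ f p hI _ _ hs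
        exact ⟨g', p', j, h₁, h₂, ihm h₃⟩
    refine WPn.of_step (by simp) fun μ f p hI μ' x' hs => ?_
    cases hs with
    | parLeft _ _ hs =>
      obtain ⟨g', p', j, h₁, h₂, h₃⟩ := hx.2 μ (g₂ + f) p (by rwa [← add_assoc]) _ _ hs
      exact ⟨g' + g₂, p', k + j + k₂, by omega, by rwa [add_assoc], ih h₃ (down hy)⟩
    | parRight _ _ hs =>
      obtain ⟨g', p', j, h₁, h₂, h₃⟩ :=
        hy.2 μ (g₁ + f) p (by rwa [← add_assoc, add_comm g₂]) _ _ hs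
      refine ⟨g₁ + g', p', k + k₁ + j, by omega, ?_, ih (down hx) h₃⟩
      rwa [add_comm g₁, add_assoc]
    | join =>
      obtain ⟨j, hj, hq⟩ := hQ _ _ _ _ _ _ _ _ hx.post hy.post
      exact ⟨g₁ + g₂, p, j, by omega, hI, WP.done hq n⟩

theorem WP.exec_seq {Q' : GPost K G} {c d : Cmd} (h : WP procs I Q g k (.exec c ρ (t + 1)))
    (hd : ∀ g' k' ρ t, Q g' k' ρ t →
      ∃ j, k' = j + 1 ∧ WP procs I Q' g' j (.exec d ρ (t + 1))) :
    WP procs I Q' g (k + 1) (.exec (.seq c d) ρ t) := by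
  refine WP.of_step (by simp) fun μ f p hI μ' x' hs => ?_
  cases hs
  exact ⟨g, p, k, by omega, hI, h.seq hd⟩

theorem WP.exec_call {p : ℕ}
    (h : WP procs I (fun g k _ t => ∃ j, k = j + 1 ∧ Q g j ρ (t + 1)) g k
      (.exec (procs.getD p (.instr .skip)) ρ (t + 1))) :
    WP procs I Q g (k + 1) (.exec (.call p) ρ t) := by
  refine WP.of_step (by simp) fun μ f p hI μ' x' hs => ?_
  cases hs
  exact ⟨g, p, k, by omega, hI, h.ret⟩

theorem WP.exec_par {Q₁ Q₂ : GPost K G} {g₁ g₂ : G} {k₁ k₂ : ℕ} {c d : Cmd}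
    (hx : WP procs I Q₁ g₁ k₁ (.exec c ρ (t + 1))) (hy : WP procs I Q₂ g₂ k₂ (.exec d ρ (t + 1)))
    (hQ : ∀ h₁ j₁ ρ₁ t₁ h₂ j₂ ρ₂ t₂, Q₁ h₁ j₁ ρ₁ t₁ → Q₂ h₂ j₂ ρ₂ t₂ →
      ∃ j, j + 1 ≤ k + j₁ + j₂ ∧ Q (h₁ + h₂) j ρ (max t₁ t₂ + 1)) :
    WP procs I Q (g₁ + g₂) (k + k₁ + k₂ + 1) (.exec (.par c d) ρ t) := by
  refine WP.of_step (by simp) fun μ f p hI μ' x' hs => ?_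
  cases hs
  exact ⟨g₁ + g₂, p, k + k₁ + k₂, by omega, hI, WP.par hx hy hQ⟩

theorem WP.exec_ite {b : Test} {c d : Cmd}
    (h : b.Holds ρ → WP procs I Q g k (.exec c ρ (t + 1)))
    (h' : ¬ b.Holds ρ → WP procs I Q g k (.exec d ρ (t + 1))) :
    WP procs I Q g (k + 1) (.exec (.ite b c d) ρ t) := by
  refine WP.of_step (by simp) fun μ f p hI μ' x' hs => ?_
  cases hs with
  | iteTrue _ _ _ _ _ _ hb => exact ⟨g, p, k, by omega, hI, h hb⟩
  | iteFalse _ _ _ _ _ _ hb => exact ⟨g, p, k, by omega, hI, h' hb⟩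

theorem WP.exec_instr {i : Instr}
    (h : ∀ μ f p, I p μ (g + f) → ∃ g' p' k', p' + k' + 1 ≤ p + k ∧
      I p' (i.run μ ρ).1 (g' + f) ∧ Q g' k' (i.run μ ρ).2 (t + 1)) :
    WP procs I Q g k (.exec (.instr i) ρ t) := by
  refine WP.of_step (by simp) fun μ f p hI μ' x' hs => ?_
  cases hs
  obtain ⟨g', p', k', h₁, h₂, h₃⟩ := h μ f p hI
  exact ⟨g', p', k', h₁, h₂, WP.done h₃⟩

/-- An instruction with a continuation. -/
theorem WP.exec_instr_seq {i : Instr} {d : Cmd}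
    (h : ∀ μ f p, I p μ (g + f) → ∃ g' p' k', p' + k' + 1 ≤ p + k ∧
      I p' (i.run μ ρ).1 (g' + f) ∧
      ∃ j, k' = j + 1 ∧ WP procs I Q g' j (.exec d (i.run μ ρ).2 (t + 3))) :
    WP procs I Q g (k + 1) (.exec (.seq (.instr i) d) ρ t) :=
  WP.exec_seq (Q := fun g' k' ρ' t' => t' = t + 2 ∧
      ∃ j, k' = j + 1 ∧ WP procs I Q g' j (.exec d ρ' (t + 3)))
    (WP.exec_instr fun μ f p hI => by
      obtain ⟨g', p', k', h₁, h₂, h₃⟩ := h μ f p hI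
      exact ⟨g', p', k', h₁, h₂, rfl, h₃⟩)
    fun g' k' ρ' t' hq => by
      obtain ⟨rfl, h⟩ := hq
      exact h

/-- The three credits pay for opening the sequence, for the instruction and for passing to `d`. -/
theorem WP.exec_local_seq {i : Instr} {d : Cmd} (hi : i.IsLocal)
    (h : ∀ μ, WP procs I Q g k (.exec d (i.run μ ρ).2 (t + 3))) :
    WP procs I Q g (k + 3) (.exec (.seq (.instr i) d) ρ t) :=
  WP.exec_instr_seq fun μ f p hI =>
    ⟨g, p, k + 1, by omega, by rw [hi.run μ μ]; exact hI, k, rfl, h μ⟩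

/-- A thread tree with an initial stock of credits, without other threads. -/
theorem WP.safe {p : ℕ} {μ : Mem K} (h : WP procs I Q g k x) (hI : I p μ g) :
    Safe procs Set.univ Set.univ (fun μ' ρ t => ∃ g' p' k', I p' μ' g' ∧ Q g' k' ρ t) (p + k) μ
      x := by
  -- Each step lowers `p + k`, so `p + k` bounds the number of all steps and step index `w + 1` is
  -- enough.
  obtain ⟨w, hw⟩ : ∃ w, p + k ≤ w := ⟨_, le_rfl⟩
  suffices hsuff : Safe procs Set.univ Set.univ
      (fun μ' ρ t => ∃ g' p' k', I p' μ' g' ∧ Q g' k' ρ t) (p + k) μ x from hsuff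
  replace h := h (w + 1)
  induction w generalizing p μ g k x with
  | zero =>
    rw [show p + k = 0 by omega]
    intro μ₁ h₁
    obtain rfl := h₁.eq
    obtain ⟨ρ, t, rfl⟩ | ⟨μ', x', hs⟩ := Conf.progress procs μ x
    · exact ⟨ρ, t, rfl, g, p, k, hI, h.post⟩
    · obtain ⟨g', p', k', h₁, -⟩ := h.2 μ 0 p (by simpa using hI) _ _ hs
      omega
  | succ w ih =>
    obtain ⟨ρ, t, rfl⟩ | ⟨μ', x', hs⟩ := Conf.progress procs μ x
    · refine Safe.done fun μ₁ h₁ => ?_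
      obtain rfl := h₁.eq
      exact ⟨g, p, k, hI, h.post⟩
    obtain ⟨j, hj⟩ : ∃ j, p + k = j + 1 := by
      obtain ⟨g', p', k', h₁, -⟩ := h.2 μ 0 p (by simpa using hI) _ _ hs
      exact ⟨p + k - 1, by omega⟩
    rw [hj]
    intro μ₁ h₁
    obtain rfl := h₁.eq
    refine ⟨fun ρ t e => by subst e; exact (nomatch hs), fun μ₂ x₂ hs => ⟨⟨by simp, by simp⟩, ?_⟩⟩
    obtain ⟨g', p', k', h₁, h₂, h₃⟩ := h.2 μ 0 p (by simpa using hI) _ _ hs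
    exact (ih (by simpa using h₂) (by omega) h₃).mono (by omega) fun _ _ _ h => h

end Ghost

end ParHeap

namespace ParHeap

/-! ### Parallel loops over implicit trees

The nodes `v = 1, 2, …` with `v < M` are internal and have children `2 * v` and `2 * v + 1`; the
nodes `M, …, 2 * M - 1` are the leaves, and leaf `M + j` belongs to the index `j < M`. -/

/-- The indices of the leaves below a node. -/
def leaves (M v : ℕ) : List ℕ :=
  if 0 < v ∧ v < M then leaves M (2 * v) ++ leaves M (2 * v + 1) else [v - M]
termination_by M - v

/-- The number of levels below a node. -/
def levels (M v : ℕ) : ℕ :=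
  if 0 < v ∧ v < M then max (levels M (2 * v)) (levels M (2 * v + 1)) + 1 else 1
termination_by M - v

/-- The number of nodes below a node. -/
def nodes (M v : ℕ) : ℕ := 2 * (leaves M v).length - 1

theorem leaves_of_lt {M v : ℕ} (h₀ : 0 < v) (h : v < M) :
    leaves M v = leaves M (2 * v) ++ leaves M (2 * v + 1) := by
  rw [leaves, if_pos ⟨h₀, h⟩]

theorem leaves_of_le {M v : ℕ} (h : M ≤ v) : leaves M v = [v - M] := by
  rw [leaves, if_neg (by omega)]

theorem levels_of_lt {M v : ℕ} (h₀ : 0 < v) (h : v < M) :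
    levels M v = max (levels M (2 * v)) (levels M (2 * v + 1)) + 1 := by
  rw [levels, if_pos ⟨h₀, h⟩]

theorem levels_of_le {M v : ℕ} (h : M ≤ v) : levels M v = 1 := by
  rw [levels, if_neg (by omega)]

/-- Induction from the leaves to the root. -/
theorem tree_induction {M : ℕ} {P : ℕ → Prop} (leaf : ∀ v, M ≤ v → v < 2 * M → P v)
    (node : ∀ v, 0 < v → v < M → P (2 * v) → P (2 * v + 1) → P v) (v : ℕ) (h₀ : 0 < v)
    (hv : v < 2 * M) : P v := by
  induction hd : 2 * M - v using Nat.strong_induction_on generalizing v with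
  | _ d ih =>
    by_cases h : v < M
    · exact node v h₀ h (ih _ (by omega) _ (by omega) (by omega) rfl)
        (ih _ (by omega) _ (by omega) (by omega) rfl)
    · exact leaf v (by omega) hv

theorem leaves_length_pos {M v : ℕ} (h₀ : 0 < v) (hv : v < 2 * M) : 0 < (leaves M v).length := by
  refine tree_induction (P := fun v => 0 < (leaves M v).length) (fun v h _ => ?_)
    (fun v h₀ h ih _ => ?_) v h₀ hv
  · simp [leaves_of_le h]
  · rw [leaves_of_lt h₀ h, List.length_append]; omega

theorem nodes_of_lt {M v : ℕ} (h₀ : 0 < v) (h : v < M) :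
    nodes M v = nodes M (2 * v) + nodes M (2 * v + 1) + 1 := by
  have h₁ := leaves_length_pos (M := M) (v := 2 * v) (by omega) (by omega)
  have h₂ := leaves_length_pos (M := M) (v := 2 * v + 1) (by omega) (by omega)
  simp only [nodes, leaves_of_lt h₀ h, List.length_append]
  omega

theorem nodes_of_le {M v : ℕ} (h : M ≤ v) : nodes M v = 1 := by
  simp [nodes, leaves_of_le h]

/-- A child has one binary digit more than its parent, which offsets the level that is lost. -/
theorem levels_add_log_le {M v : ℕ} (h₀ : 0 < v) (hv : v < 2 * M) :
    levels M v + Nat.log 2 v ≤ Nat.log 2 (2 * M) + 1 := by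
  refine tree_induction (P := fun v => levels M v + Nat.log 2 v ≤ Nat.log 2 (2 * M) + 1)
    (fun v h h' => ?_) (fun v h₀ h ih₁ ih₂ => ?_) v h₀ hv
  · rw [levels_of_le h]
    have := Nat.log_mono_right (b := 2) h'.le
    omega
  · rw [levels_of_lt h₀ h]
    have e₁ : Nat.log 2 (2 * v) = Nat.log 2 v + 1 := by
      rw [mul_comm, Nat.log_mul_base (by norm_num) (by omega)]
    have e₂ : Nat.log 2 (2 * v + 1) = Nat.log 2 v + 1 := by
      rw [Nat.log_of_one_lt_of_le (by norm_num) (by omega)]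
      congr 2; omega
    omega

theorem levels_root_le {M : ℕ} (hM : 0 < M) : levels M 1 ≤ Nat.log 2 M + 2 := by
  have := levels_add_log_le (M := M) (v := 1) one_pos (by omega)
  rw [mul_comm, Nat.log_mul_base (by norm_num) (by omega)] at this
  simpa using this

/-- The nodes `k, …, 2 * k - 1` form a cut of the tree. Replacing `k` by its children `2 * k` and `2
* k + 1` gives the cut for `k + 1`, and the cut for `M` consists of the leaves. The cut for `1` is
the root. -/
theorem leaves_root_perm {M : ℕ} (hM : 0 < M) : (leaves M 1).Perm (List.range M) := by
  have key : ∀ k, 0 < k → k ≤ M →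
      ((List.range' k k).flatMap (leaves M)).Perm (List.range M) := by
    intro k hk hkM
    induction hd : M - k generalizing k with
    | zero =>
      obtain rfl : k = M := by omega
      refine List.Perm.of_eq ?_
      rw [List.flatMap_congr (g := fun v => [v - k]) (fun v hv => by
        rw [List.mem_range'_1] at hv
        exact leaves_of_le (by omega))]
      rw [← List.map_eq_flatMap, List.range_eq_range']
      apply List.ext_getElem <;> simp
    | succ d ih =>
      refine List.Perm.trans ?_ (ih (k + 1) (by omega) (by omega) (by omega))
      have e : List.range' (k + 1) (k + 1) = List.range' (k + 1) (k - 1) ++ [2 * k, 2 * k + 1] := by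
        rw [show k + 1 = (k - 1) + 2 by omega, ← List.range'_append_1]
        simp [List.range'_succ]
        omega
      rw [e, List.flatMap_append]
      have e' : List.range' k k = k :: List.range' (k + 1) (k - 1) := by
        rw [← List.range'_succ]; congr 1; omega
      rw [e', List.flatMap_cons, leaves_of_lt hk (by omega)]
      simp only [List.flatMap_cons, List.flatMap_nil, List.append_nil]
      exact List.perm_append_comm
  simpa using key 1 one_pos hM

theorem mem_leaves_root {M j : ℕ} (hM : 0 < M) : j ∈ leaves M 1 ↔ j < M := by
  rw [(leaves_root_perm hM).mem_iff, List.mem_range]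

theorem nodup_leaves_root {M : ℕ} (hM : 0 < M) : (leaves M 1).Nodup :=
  (leaves_root_perm hM).nodup_iff.2 List.nodup_range

theorem nodes_root {M : ℕ} (hM : 0 < M) : nodes M 1 ≤ 2 * M := by
  rw [nodes, (leaves_root_perm hM).length_eq, List.length_range]; omega

theorem lt_of_mem_leaves {M v : ℕ} (h₀ : 0 < v) (hv : v < 2 * M) : ∀ j ∈ leaves M v, j < M := by
  refine tree_induction (P := fun v => ∀ j ∈ leaves M v, j < M) (fun v h h' j hj => ?_)
    (fun v h₀ h ih₁ ih₂ j hj => ?_) v h₀ hv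
  · simp [leaves_of_le h] at hj; omega
  · rw [leaves_of_lt h₀ h, List.mem_append] at hj
    exact hj.elim (ih₁ j) (ih₂ j)

/-- The list of a node is a prefix or a suffix of the list of its parent, so the property descends
from the root. -/
theorem nodup_leaves {M v : ℕ} (h₀ : 0 < v) (hv : v < 2 * M) : (leaves M v).Nodup := by
  have hM : 0 < M := by omega
  induction v using Nat.strong_induction_on with
  | _ v ih =>
    by_cases h1 : v = 1
    · subst h1; exact nodup_leaves_root hM
    have := ih (v / 2) (by omega) (by omega) (by omega)
    rw [leaves_of_lt (by omega) (by omega)] at this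
    obtain h | h : v = 2 * (v / 2) ∨ v = 2 * (v / 2) + 1 := by omega
    · rw [h]; exact this.of_append_left
    · rw [h]; exact this.of_append_right

theorem disjoint_leaves {M v : ℕ} (h₀ : 0 < v) (hv : v < M) :
    List.Disjoint (leaves M (2 * v)) (leaves M (2 * v + 1)) := by
  have := nodup_leaves h₀ (show v < 2 * M by omega)
  rw [leaves_of_lt h₀ hv] at this
  exact List.disjoint_of_nodup_append this

-- Tree-recursive procedures in both logics

infixr:67 " ;; " => Cmd.seq

instance : Coe Instr Cmd := ⟨Cmd.instr⟩

open Instr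

/-- A procedure that traverses a tree in parallel.  Register `0` is the node and register `1` the
number of leaves; `right` has to move to the right child. -/
def treeCmd (p : ℕ) (right after leaf : Cmd) : Cmd :=
  .ite (.lt 0 1) (.par (add 0 0 0 ;; .call p) (right ;; .call p) ;; after) leaf

/-- Register `10` contains `1`. -/
def loopRight : Cmd := add 0 0 0 ;; add 0 0 10

/-- A parallel loop. -/
def loopCmd (p : ℕ) (leaf : Cmd) : Cmd := treeCmd p loopRight skip leaf

theorem Frame.setNum_setNum {K : Type u} (ρ : Frame K) (r x y : ℕ) :
    (ρ.setNum r x).setNum r y = ρ.setNum r y := by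
  simp [Frame.setNum]

theorem Frame.setNum_self {K : Type u} (ρ : Frame K) (r x : ℕ) : (ρ.setNum r x).num r = x := by
  simp [Frame.setNum]

theorem Frame.setNum_of_ne {K : Type u} (ρ : Frame K) {r s : ℕ} (h : s ≠ r) (x : ℕ) :
    (ρ.setNum r x).num s = ρ.num s := by
  simp [Frame.setNum, h]

theorem Frame.setNum_eq {K : Type u} (ρ : Frame K) {r x : ℕ} (h : ρ.num r = x) : ρ.setNum r x = ρ := by
  subst h; simp [Frame.setNum]

section

variable {K : Type u} [LinearOrder K] {procs : List Cmd}

/-- Each tree node costs at most `c` steps and each level at most `c` time, by induction from the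
leaves. The registers `ρR` of the right child are supplied explicitly because moving right may read
the memory. The precondition on the right must survive changes outside `F ρR`: the left branch is
already running when the right one gets there. -/
theorem Safe.tree {p : ℕ} {right after leaf : Cmd} {M c : ℕ} {F W : Frame K → Set Loc}
    {Pre Post : Frame K → Mem K → Prop}
    (hp : procs.getD p (.instr .skip) = treeCmd p right after leaf)
    (hreg : ∀ ρ μ, Pre ρ μ → ρ.num 1 = M ∧ 0 < ρ.num 0 ∧ ρ.num 0 < 2 * M)
    (hpost : ∀ ρ μ ν, Post ρ μ → Agree (F ρ) μ ν → Post ρ ν)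
    (hcl : leaf.cost + 1 ≤ c) (hcn : right.cost + after.cost + 20 ≤ c)
    (hleaf : ∀ ρ μ, Pre ρ μ → M ≤ ρ.num 0 →
      wlp (F ρ) (W ρ) leaf (fun μ' _ => Post ρ μ') μ ρ)
    (hnode : ∀ ρ μ, Pre ρ μ → ρ.num 0 < M → ∃ ρR : Frame K,
      let ρL := ρ.setNum 0 (ρ.num 0 + ρ.num 0)
      wlp (F ρR) ∅ right (fun μ' ρ' => μ' = μ ∧ ρ' = ρR) μ ρ ∧ ρR.num 0 = 2 * ρ.num 0 + 1 ∧
      Pre ρL μ ∧ (∀ ν, Agree (F ρR) μ ν → Pre ρR ν) ∧ F ρL ∪ F ρR ⊆ F ρ ∧ W ρL ∪ W ρR ⊆ W ρ ∧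
      Disjoint (W ρL) (F ρR) ∧ Disjoint (W ρR) (F ρL) ∧
      ∀ μ', Agree (F ρ \ (W ρL ∪ W ρR)) μ μ' → Post ρL μ' → Post ρR μ' →
        wlp (F ρ) (W ρ) after (fun μ'' _ => Post ρ μ'') μ' ρ)
    (ρ : Frame K) (μ : Mem K) (t : ℕ) (h : Pre ρ μ) :
    Safe procs (F ρ) (W ρ) (fun μ' _ t' => Post ρ μ' ∧ t' ≤ t + c * levels M (ρ.num 0))
      (c * nodes M (ρ.num 0)) μ (.exec (treeCmd p right after leaf) ρ t) := by
  have key : ∀ v, 0 < v → v < 2 * M → ∀ (ρ : Frame K) μ t, ρ.num 0 = v → Pre ρ μ →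
      Safe procs (F ρ) (W ρ) (fun μ' _ t' => Post ρ μ' ∧ t' ≤ t + c * levels M (ρ.num 0))
        (c * nodes M (ρ.num 0)) μ (.exec (treeCmd p right after leaf) ρ t) := by
    intro v h₀ hv
    refine tree_induction (P := fun v => ∀ (ρ : Frame K) μ t, ρ.num 0 = v → Pre ρ μ →
      Safe procs (F ρ) (W ρ) (fun μ' _ t' => Post ρ μ' ∧ t' ≤ t + c * levels M (ρ.num 0))
        (c * nodes M (ρ.num 0)) μ (.exec (treeCmd p right after leaf) ρ t)) ?_ ?_ v h₀ hv
    · intro v h₁ h₂ ρ μ t hρ h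
      have hr := hreg ρ μ h
      rw [hρ, nodes_of_le h₁, levels_of_le h₁]
      refine (Safe.exec_ite (k := leaf.cost) (fun hb => ?_) fun _ => ?_).mono (by omega)
        fun _ _ _ h => h
      · simp only [Test.Holds] at hb; omega
      · refine (hleaf ρ μ h (by omega)).safe.mono le_rfl ?_
        rintro μ' ρ' t' ⟨⟨ν, hν, hP⟩, ht⟩
        exact ⟨hpost _ _ _ hP hν, by omega⟩
    · intro v h₀ h₁ ihL ihR ρ μ t hρ h
      have hr := hreg ρ μ h
      obtain ⟨ρR, hw, hR0, hPL, hPR, hF, hW, hd₁, hd₂, hafter⟩ := hnode ρ μ h (by omega)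
      set ρL := ρ.setNum 0 (ρ.num 0 + ρ.num 0) with hρL
      have hL0 : ρL.num 0 = 2 * v := by simp [hρL, Frame.setNum, hρ]; omega
      rw [hρ] at hR0
      rw [hρ, nodes_of_lt h₀ h₁, levels_of_lt h₀ h₁]
      refine (Safe.exec_ite (k := c * nodes M (2 * v) + c * nodes M (2 * v + 1) + right.cost + 11 +
        after.cost + 2) (fun _ => ?_) fun hb => ?_).mono (by
          simp only [mul_add]; omega) fun _ _ _ h => h
      swap
      · simp only [Test.Holds] at hb; omega
      set e := max (levels M (2 * v)) (levels M (2 * v + 1)) with he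
      have hLe : c * levels M (2 * v) ≤ c * e := Nat.mul_le_mul_left _ (le_max_left _ _)
      have hRe : c * levels M (2 * v + 1) ≤ c * e := Nat.mul_le_mul_left _ (le_max_right _ _)
      rw [mul_add, mul_one]
      refine Safe.exec_seq (Q := fun μ' ρ' t' => Agree (F ρ \ (W ρL ∪ W ρR)) μ μ' ∧ ρ' = ρ ∧
        Post ρL μ' ∧ Post ρR μ' ∧ t' ≤ t + c * e + right.cost + 12) ?_ ?_
      · have hL : Safe procs (F ρL) (W ρL) (fun μ' _ t' => Post ρL μ' ∧
            t' ≤ t + c * e + right.cost + 11) (c * nodes M (2 * v) + 5) μ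
            (.exec (add 0 0 0 ;; .call p) ρ (t + 1 + 1 + 1)) := by
          refine (Safe.exec_seq (k := 1) (k' := c * nodes M (2 * v) + 2)
            (Q := fun μ' ρ' t' => Agree (F ρL) μ μ' ∧ ρ' = ρL ∧ t' ≤ t + 5) ?_ ?_).mono (by omega)
            fun _ _ _ h => h
          · refine (wlp.safe (c := (add 0 0 0 : Instr)) (P := fun ν ρ' => ν = μ ∧ ρ' = ρL)
              ⟨trivial, rfl, rfl⟩).mono le_rfl ?_
            rintro μ' ρ' t' ⟨⟨ν, hν, rfl, rfl⟩, ht⟩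
            simp only [Cmd.cost] at ht
            exact ⟨hν, rfl, by omega⟩
          · rintro μ' ρ' t' ⟨hμ', rfl, ht⟩
            have := ihL ρL μ (t' + 1 + 1) hL0 hPL
            rw [← hp, hL0] at this
            refine (this.stable hμ').exec_call.mono le_rfl ?_
            rintro μ'' ρ'' t'' ⟨rfl, ρ₃, t₃, rfl, hP, ht₃⟩
            exact ⟨hP, by omega⟩
        have hR : Safe procs (F ρR) (W ρR) (fun μ' _ t' => Post ρR μ' ∧
            t' ≤ t + c * e + right.cost + 11) (c * nodes M (2 * v + 1) + right.cost + 4) μ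
            (.exec (right ;; .call p) ρ (t + 1 + 1 + 1)) := by
          refine (Safe.exec_seq (k := right.cost) (k' := c * nodes M (2 * v + 1) + 2)
            (Q := fun μ' ρ' t' => Agree (F ρR) μ μ' ∧ ρ' = ρR ∧ t' ≤ t + 4 + right.cost)
            ?_ ?_).mono (by omega) fun _ _ _ h => h
          · refine hw.safe.frame subset_rfl (Set.empty_subset _) le_rfl ?_
            rintro μ' ρ' t' ⟨⟨ν, hν, rfl, rfl⟩, ht⟩ -
            exact ⟨hν, rfl, by omega⟩
          · rintro μ' ρ' t' ⟨hμ', rfl, ht⟩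
            have := ihR ρ' μ' (t' + 1 + 1) hR0 (hPR _ hμ')
            rw [← hp, hR0] at this
            refine this.exec_call.mono le_rfl ?_
            rintro μ'' ρ'' t'' ⟨rfl, ρ₃, t₃, rfl, hP, ht₃⟩
            exact ⟨hP, by omega⟩
        refine (Safe.exec_par (Q := fun μ' ρ' t' => ρ' = ρ ∧ Post ρL μ' ∧ Post ρR μ' ∧
          t' ≤ t + c * e + right.cost + 12) hL hR hd₁ hd₂ ?_).frame hF hW (by omega) ?_
        · rintro μ' ρ₁ t₁ ρ₂ t₂ ⟨hP₁, ht₁⟩ ⟨hP₂, ht₂⟩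
          exact ⟨rfl, hP₁, hP₂, by omega⟩
        · rintro μ' ρ' t' ⟨rfl, hP₁, hP₂, ht⟩ ha
          exact ⟨ha, rfl, hP₁, hP₂, ht⟩
      · rintro μ' ρ' t' ⟨ha, rfl, hP₁, hP₂, ht⟩
        refine (hafter μ' ha hP₁ hP₂).safe.mono le_rfl ?_
        rintro μ'' ρ'' t'' ⟨⟨ν, hν, hP⟩, ht'⟩
        exact ⟨hpost _ _ _ hP hν, by omega⟩
  obtain ⟨-, h₀, h₁⟩ := hreg ρ μ h
  exact key _ h₀ h₁ ρ μ t rfl h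

theorem Safe.root_call {p M c : ℕ} {F W : Set Loc} {P : Mem K → Prop} {ρ : Frame K} {μ : Mem K}
    {t : ℕ} (hM : 0 < M)
    (h : ∀ t, Safe procs F W (fun μ' _ t' => P μ' ∧ t' ≤ t + c * levels M 1) (c * nodes M 1) μ
      (.exec (procs.getD p (.instr .skip)) ρ t)) :
    Safe procs Set.univ Set.univ (fun μ' ρ' t' => ρ' = ρ ∧ P μ' ∧ Agree Wᶜ μ μ' ∧
      t' ≤ t + c * (Nat.log 2 M + 2) + 2) (c * (2 * M) + 2) μ (.exec (.call p) ρ t) := by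
  refine (h (t + 1)).exec_call.frame (Set.subset_univ _) (Set.subset_univ _) ?_ ?_
  · have := Nat.mul_le_mul_left c (nodes_root hM)
    omega
  · rintro μ' ρ' t' ⟨rfl, ρ₃, t₃, rfl, hP, ht⟩ ha
    refine ⟨rfl, hP, ha.mono fun l hl => ⟨trivial, hl⟩, ?_⟩
    have := Nat.mul_le_mul_left c (levels_root_le hM)
    omega

/-- A race-free parallel loop. -/
theorem Safe.loop {p M c : ℕ} {leaf : Cmd} {ρ : Frame K} {F W : ℕ → Set Loc}
    {P Post : ℕ → Mem K → Prop} {μ : Mem K} {t : ℕ}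
    (hp : procs.getD p (.instr .skip) = loopCmd p leaf)
    (hρ₁ : ρ.num 1 = M) (hρ₀ : ρ.num 0 = 1) (hρ : ρ.num 10 = 1) (hM : 0 < M)
    (hd : ∀ i j, i < M → j < M → i ≠ j → Disjoint (W i) (F j))
    (hP : ∀ j μ ν, P j μ → Agree (F j) μ ν → P j ν)
    (hpost : ∀ j μ ν, Post j μ → Agree (F j) μ ν → Post j ν)
    (hc : leaf.cost + 30 ≤ c)
    (hleaf : ∀ j μ, j < M → P j μ →
      wlp (F j) (W j) leaf (fun μ' _ => Post j μ') μ (ρ.setNum 0 (M + j)))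
    (hμ : ∀ j < M, P j μ) :
    Safe procs Set.univ Set.univ (fun μ' ρ' t' => ρ' = ρ ∧ (∀ j < M, Post j μ') ∧
      (Agree {l | ∀ j < M, l ∉ W j} μ μ') ∧
      t' ≤ t + c * (Nat.log 2 M + 2) + 2) (c * (2 * M) + 2) μ (.exec (.call p) ρ t) := by
  have main := Safe.tree (procs := procs) (p := p) (right := loopRight) (after := skip)
    (leaf := leaf) (M := M) (c := c)
    (F := fun σ => {l | ∃ j ∈ leaves M (σ.num 0), l ∈ F j})
    (W := fun σ => {l | ∃ j ∈ leaves M (σ.num 0), l ∈ W j})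
    (Pre := fun σ μ => σ = ρ.setNum 0 (σ.num 0) ∧ 0 < σ.num 0 ∧ σ.num 0 < 2 * M ∧
      ∀ j ∈ leaves M (σ.num 0), P j μ)
    (Post := fun σ μ => ∀ j ∈ leaves M (σ.num 0), Post j μ) hp
    (fun σ μ h => ⟨by rw [h.1, ρ.setNum_of_ne (by norm_num), hρ₁], h.2.1, h.2.2.1⟩)
    (fun σ μ ν h ha j hj => hpost j μ ν (h j hj) (ha.mono fun l hl => ⟨j, hj, hl⟩))
    (by omega) (by simp only [loopRight, Cmd.cost]; omega) ?_ ?_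
  · refine (Safe.root_call (P := fun μ' => ∀ j < M, Post j μ') (p := p) (ρ := ρ) (μ := μ)
      (c := c) (F := {l | ∃ j ∈ leaves M (ρ.num 0), l ∈ F j})
      (W := {l | ∃ j ∈ leaves M (ρ.num 0), l ∈ W j}) hM (fun t => ?_)).mono le_rfl ?_
    · rw [hp]
      have main' := main ρ μ t ⟨by rw [ρ.setNum_eq rfl], by omega, by omega, fun j hj => by
        rw [hρ₀, mem_leaves_root hM] at hj
        exact hμ j hj⟩
      rw [hρ₀] at main' ⊢
      refine main'.mono le_rfl ?_
      rintro μ' ρ' t' ⟨hq, ht⟩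
      exact ⟨fun j hj => hq j ((mem_leaves_root hM).2 hj), ht⟩
    · rintro μ' ρ' t' ⟨rfl, hq, ha, ht⟩
      refine ⟨rfl, hq, ha.mono ?_, ht⟩
      rintro l hl ⟨j, hj, hlj⟩
      rw [hρ₀, mem_leaves_root hM] at hj
      exact hl j hj hlj
  · rintro σ μ ⟨hσ, h₀, h₁, hσP⟩ hle
    obtain ⟨j, hj⟩ : ∃ j, σ.num 0 = M + j := ⟨σ.num 0 - M, by omega⟩
    have hl : leaves M (σ.num 0) = [j] := by rw [leaves_of_le hle, hj]; simp
    rw [hl] at hσP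
    simp only [hl, List.mem_singleton, exists_eq_left, forall_eq, Set.ofPred_mem_eq]
    rw [hσ, hj]
    exact hleaf j μ (by omega) (hσP j (by simp))
  · rintro σ μ ⟨hσ, h₀, h₁, hσP⟩ hlt
    have hd' := disjoint_leaves h₀ hlt
    have hlv := leaves_of_lt h₀ hlt
    have hm₁ := lt_of_mem_leaves (M := M) (v := 2 * σ.num 0) (by omega) (by omega)
    have hm₂ := lt_of_mem_leaves (M := M) (v := 2 * σ.num 0 + 1) (by omega) (by omega)
    have hσ10 : σ.num 10 = 1 := by rw [hσ, ρ.setNum_of_ne (by norm_num), hρ]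
    obtain ⟨v, hv⟩ : ∃ v, σ.num 0 = v := ⟨_, rfl⟩
    rw [hv] at hσ h₀ h₁ hσP hlt hd' hlv hm₁ hm₂
    simp only [hv]
    have ev : v + v = 2 * v := by omega
    refine ⟨σ.setNum 0 (2 * v + 1), ⟨trivial, trivial, rfl, ?_⟩, Frame.setNum_self _ _ _,
      ?_, ?_, ?_, ?_, ?_, ?_, fun μ' _ h₁ h₂ => ⟨trivial, ?_⟩⟩
    · simp only [Instr.run]
      rw [Frame.setNum_self, Frame.setNum_of_ne _ (by norm_num), Frame.setNum_setNum, hσ10, hv, ev]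
    · rw [Frame.setNum_self, ev]
      refine ⟨by rw [hσ, Frame.setNum_setNum], by omega, by omega, fun j hj => hσP j ?_⟩
      rw [hlv]; exact List.mem_append_left _ hj
    · intro ν ha
      rw [Frame.setNum_self] at ha ⊢
      refine ⟨by rw [hσ, Frame.setNum_setNum], by omega, by omega, fun j hj => ?_⟩
      refine hP j μ ν (hσP j ?_) (ha.mono fun l hl => ⟨j, hj, hl⟩)
      rw [hlv]; exact List.mem_append_right _ hj
    · simp only [Frame.setNum_self, ev, hlv, List.mem_append]
      rintro l (⟨j, hj, hl⟩ | ⟨j, hj, hl⟩)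
      exacts [⟨j, .inl hj, hl⟩, ⟨j, .inr hj, hl⟩]
    · simp only [Frame.setNum_self, ev, hlv, List.mem_append]
      rintro l (⟨j, hj, hl⟩ | ⟨j, hj, hl⟩)
      exacts [⟨j, .inl hj, hl⟩, ⟨j, .inr hj, hl⟩]
    · simp only [Frame.setNum_self, ev]
      rw [Set.disjoint_left]
      rintro l ⟨i, hi, hl⟩ ⟨j, hj, hl'⟩
      refine Set.disjoint_left.1 (hd i j (hm₁ i hi) (hm₂ j hj) ?_) hl hl'
      rintro rfl; exact hd' hi hj
    · simp only [Frame.setNum_self, ev]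
      rw [Set.disjoint_left]
      rintro l ⟨i, hi, hl⟩ ⟨j, hj, hl'⟩
      refine Set.disjoint_left.1 (hd i j (hm₂ i hi) (hm₁ j hj) ?_) hl hl'
      rintro rfl; exact hd' hj hi
    · simp only [Frame.setNum_self, ev] at h₁ h₂
      rw [hlv]
      intro j hj
      exact (List.mem_append.1 hj).elim (h₁ j) (h₂ j)

/-- A parallel loop whose iterations may interfere. -/
theorem WP.loop {G : Type*} [AddCommMonoid G] {I : ℕ → Mem K → G → Prop} {p M c tB tE : ℕ}
    {leaf : Cmd} {ρ : Frame K} {γ : ℕ → G} {t : ℕ}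
    (hp : procs.getD p (.instr .skip) = loopCmd p leaf)
    (hρ₁ : ρ.num 1 = M) (hρ₀ : ρ.num 0 = 1) (hρ : ρ.num 10 = 1) (hM : 0 < M) (hc : 25 ≤ c)
    (hleaf : ∀ j t, j < M → t ≤ tB →
      WP procs I (fun g _ _ t' => g = 0 ∧ t' ≤ tE) (γ j) (c - 1)
        (.exec leaf (ρ.setNum 0 (M + j)) t))
    (ht : t + 1 + c * (Nat.log 2 M + 2) ≤ tB) :
    WP procs I (fun g _ ρ' t' => ρ' = ρ ∧ g = 0 ∧ t' ≤ tE + c * (Nat.log 2 M + 2))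
      ((leaves M 1).map γ).sum (c * (2 * M) + 2) (.exec (.call p) ρ t) := by
  -- `tE` is already a bound for the end of a leaf, so the level of the leaf is not charged again;
  -- hence the `c` on the left.
  have key : ∀ v, 0 < v → v < 2 * M → ∀ t, t + c * levels M v ≤ tB →
      WP procs I (fun g _ _ t' => g = 0 ∧ t' + c ≤ tE + c * levels M v)
        ((leaves M v).map γ).sum (c * nodes M v)
        (.exec (loopCmd p leaf) (ρ.setNum 0 v) t) := by
    intro v h₀ hv
    refine tree_induction (P := fun v => ∀ t, t + c * levels M v ≤ tB →
      WP procs I (fun g _ _ t' => g = 0 ∧ t' + c ≤ tE + c * levels M v)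
        ((leaves M v).map γ).sum (c * nodes M v)
        (.exec (loopCmd p leaf) (ρ.setNum 0 v) t)) ?_ ?_ v h₀ hv
    · intro v h₁ h₂ t ht
      obtain ⟨j, rfl⟩ : ∃ j, v = M + j := ⟨v - M, by omega⟩
      rw [levels_of_le h₁] at ht ⊢
      rw [leaves_of_le h₁, nodes_of_le h₁, show c * 1 = c - 1 + 1 by omega, loopCmd, treeCmd]
      refine WP.exec_ite (fun hb => ?_) fun _ => ?_
      · simp only [Test.Holds, Frame.setNum_self, Frame.setNum_of_ne _ one_ne_zero] at hb; omega
      · have := hleaf j (t + 1) (by omega) (by omega)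
        simp only [Nat.add_sub_cancel_left, List.map_cons, List.map_nil, List.sum_cons,
          List.sum_nil, add_zero]
        refine this.mono le_rfl ?_
        rintro g i ρ' t' ⟨hg, ht'⟩
        exact ⟨hg, by omega⟩
    · intro v h₀ h₁ ihL ihR t ht
      rw [levels_of_lt h₀ h₁] at ht ⊢
      rw [leaves_of_lt h₀ h₁, nodes_of_lt h₀ h₁, List.map_append, List.sum_append, loopCmd, treeCmd]
      set e := max (levels M (2 * v)) (levels M (2 * v + 1)) with he
      have hLe : c * levels M (2 * v) ≤ c * e := Nat.mul_le_mul_left _ (le_max_left _ _)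
      have hRe : c * levels M (2 * v + 1) ≤ c * e := Nat.mul_le_mul_left _ (le_max_right _ _)
      simp only [mul_add, mul_one] at ht ⊢
      set kL := c * nodes M (2 * v)
      set kR := c * nodes M (2 * v + 1)
      refine (WP.exec_ite (k := 3 + (kL + 5) + (kR + 8) + 1 + 1) (fun _ => ?_) fun hb => ?_).mono
        (by omega) fun _ _ _ _ h => h
      swap
      · simp only [Test.Holds, Frame.setNum_self, Frame.setNum_of_ne _ one_ne_zero] at hb; omega
      refine WP.exec_seq (Q := fun g k _ t' => g = 0 ∧ 2 ≤ k ∧ t' + 5 ≤ tE + c * e)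
        (WP.exec_par
          (Q₁ := fun g k _ t' => g = 0 ∧ t' + 6 ≤ tE + c * e)
          (Q₂ := fun g k _ t' => g = 0 ∧ t' + 6 ≤ tE + c * e) ?_ ?_ ?_) ?_
      · refine (WP.exec_local_seq (i := add 0 0 0) (k := kL + 2) trivial fun μ => WP.exec_call ?_).mono (by omega)
          fun _ _ _ _ h => h
        rw [hp]
        simp only [Instr.run, Frame.setNum_self, Frame.setNum_setNum]
        rw [← two_mul]
        refine (ihL _ (by omega)).mono (k' := kL + 1) (by omega) ?_
        rintro g i ρ' t' ⟨rfl, ht'⟩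
        exact ⟨i, by omega, rfl, by omega⟩
      · refine (WP.exec_seq (Q := fun g k ρ' t' => g = ((leaves M (2 * v + 1)).map γ).sum ∧
          k = kR + 3 ∧ ρ' = ρ.setNum 0 (2 * v + 1) ∧ t' = t + 8) (k := kR + 7)
          (WP.exec_local_seq (i := add 0 0 0) (k := kR + 4) trivial fun μ =>
            WP.exec_instr fun μ' f p hI => ⟨_, p, kR + 3, by omega, hI, rfl, rfl, ?_, rfl⟩)
            ?_).mono (by omega) fun _ _ _ _ h => h
        · simp only [Instr.run, Frame.setNum_self, Frame.setNum_setNum]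
          rw [Frame.setNum_of_ne _ (by norm_num), hρ, ← two_mul]
        · rintro g' k' ρ' t' ⟨rfl, rfl, rfl, rfl⟩
          refine ⟨kR + 2, rfl, WP.exec_call ?_⟩
          rw [hp]
          refine (ihR _ (by omega)).mono (k' := kR + 1) (by omega) ?_
          rintro g i ρ' t' ⟨rfl, ht'⟩
          exact ⟨i, by omega, rfl, by omega⟩
      · rintro h₁ j₁ ρ₁ t₁ h₂ j₂ ρ₂ t₂ ⟨rfl, hh₁⟩ ⟨rfl, hh₂⟩
        exact ⟨2, by omega, by simp, le_rfl, by omega⟩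
      · rintro g' k' ρ' t' ⟨rfl, hk', ht'⟩
        obtain ⟨j, rfl⟩ : ∃ j, k' = j + 2 := ⟨k' - 2, by omega⟩
        refine ⟨j + 1, rfl, WP.exec_instr fun μ f p hI =>
          ⟨0, p, j, by omega, hI, rfl, by omega⟩⟩
  have h₁ := Nat.mul_le_mul_left c (levels_root_le hM)
  have h₂ := Nat.mul_le_mul_left c (nodes_root hM)
  refine (WP.exec_call (k := c * (2 * M) + 1) ?_).mono le_rfl fun _ _ _ _ h => h
  rw [hp]
  have h := key 1 one_pos (by omega) (t + 1) (by omega)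
  rw [ρ.setNum_eq hρ₀] at h
  refine h.mono (by omega) ?_
  rintro g i ρ' t' ⟨rfl, ht'⟩
  exact ⟨i + (c * (2 * M) - c * nodes M 1), by omega, rfl, rfl, by omega⟩

end

end ParHeap

namespace ParHeap

open Instr

/-! ### The programs

Numeric arrays: array `0` contains the size of the heap in cell `0` and a tree of partial sums in the
other cells, array `2` the nodes that are affected by the batch, array `3` marks the nodes without
key (holes), array `4` marks the nodes whose key may be out of order, and array `1` is used for
lists of nodes.

Registers: `0` node of the loop tree, `1` number of leaves, `2` old size, `3` new size, `4` size of
the batch, `6` offset, `8` old size plus size of the batch, `9` number of keys to be moved,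
`10` the number one, `11` the number zero. -/

/-- Enter update number `j`: new keys are put at their nodes, every update gets a new node at the
end of the heap, and deleted nodes and superfluous new nodes become holes. -/
def enterLeaf : Cmd :=
  sub 20 0 1 ;; add 21 2 10 ;; add 21 21 20 ;; add 22 4 20 ;; store 2 22 21 ;; load 23 1 20 ;;
  .ite (.lt 11 23)
    (load 24 2 20 ;; store 3 21 10 ;;
      .ite (.lt 10 23) (keyLoad 1 1 20 ;; keyStore 0 24 1) (store 3 24 10))
    (keyLoad 1 1 20 ;; keyStore 0 21 1 ;; add 24 8 10 ;; add 24 24 20 ;; store 2 20 24)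

/-- Is the affected node number `j` a hole, and not beyond the end? -/
def holeLeaf : Cmd :=
  sub 20 0 1 ;; load 21 2 20 ;; .ite (.lt 3 21) (const 22 0) (load 22 3 21) ;; store 0 0 22

/-- Is node number `j` from the end beyond the new end, but not a hole? -/
def tailLeaf : Cmd :=
  sub 20 0 1 ;; sub 21 8 20 ;; .ite (.lt 3 21) (load 22 3 21 ;; sub 22 10 22) (const 22 0) ;;
    store 0 0 22

/-- Partial sums. -/
def sumAfter : Cmd :=
  add 21 0 0 ;; load 22 0 21 ;; add 21 21 10 ;; load 23 0 21 ;; add 22 22 23 ;; store 0 0 22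

/-- Move to the right child, and increase the offset by the partial sum of the left child. -/
def rankRight : Cmd := add 0 0 0 ;; load 21 0 0 ;; add 6 6 21 ;; add 0 0 10

/-- Register `6` holds the number of selected leaves to the left, plus the initial offset. It is the
private output position of this leaf. -/
def listHoleLeaf : Cmd :=
  load 22 0 0 ;; .ite (.lt 11 22) (sub 20 0 1 ;; load 21 2 20 ;; store 1 6 21) skip

def listTailLeaf : Cmd :=
  load 22 0 0 ;; .ite (.lt 11 22) (sub 20 0 1 ;; sub 21 8 20 ;; store 1 6 21) skip

/-- Move a key from the tail to a hole. -/
def moveLeaf : Cmd :=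
  sub 20 0 1 ;; .ite (.lt 20 9)
    (load 21 1 20 ;; load 22 1 0 ;; keyLoad 1 0 22 ;; keyStore 0 21 1) skip

def cleanLeaf : Cmd := sub 20 0 1 ;; load 21 2 20 ;; store 3 21 11

/-- Call procedure `p` for the affected node number `j`. -/
def nodeLeaf (p : ℕ) : Cmd :=
  sub 20 0 1 ;; load 12 2 20 ;; .ite (.lt 3 12) skip (.call p)

/-- Mark node `x` (register `12`) and its ancestors. -/
def markProc : Cmd :=
  .ite (.lt 11 12)
    (cas 13 4 12 11 12 ;; .ite (.lt 11 13) (half 12 12 ;; .call 9) skip) skip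

/-- The key of node `x` is not larger than the keys of its children. -/
def settleCmd : Cmd := store 4 12 11 ;; half 12 12 ;; .call 10

/-- Exchange the keys of `x` and its child in register `c`, which is in key register `k`. -/
def swapCmd (c k : ℕ) : Cmd :=
  keyStore 0 12 k ;; keyStore 0 c 1 ;; store 4 c 13 ;; store 4 12 11 ;;
    .par (half 12 12 ;; .call 10) (add 12 c 11 ;; .call 10)

/-- One step at the marked node `x`, both children of which are unmarked. -/
def siftCmd : Cmd :=
  .ite (.lt 3 14) settleCmd
    (keyLoad 1 0 12 ;; keyLoad 2 0 14 ;; keyLoad 3 0 16 ;;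
      .ite (.keyLt 3 2)
        (.ite (.keyLt 3 1) (swapCmd 16 3) settleCmd)
        (.ite (.keyLt 2 1) (swapCmd 14 2) settleCmd))

/-- If node `x` (register `12`) is marked with a number in `1, …, x` and both of its children are
unmarked, then try to claim it by changing its mark to `2 * x`. -/
def checkProc : Cmd :=
  load 13 4 12 ;; .ite (.lt 11 13)
    (.ite (.lt 12 13) skip
      (add 14 12 12 ;; load 15 4 14 ;; .ite (.lt 11 15) skip
        (add 16 14 10 ;; load 15 4 16 ;; .ite (.lt 11 15) skip
          (cas 15 4 12 13 14 ;; .ite (.lt 11 15) siftCmd skip))))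
    skip

/-- The position in the list is the procedure number used by `call`; thus `9` is `markProc` and `10`
is `checkProc`. -/
def updateProcs : List Cmd :=
  [loopCmd 0 enterLeaf, treeCmd 1 loopRight sumAfter holeLeaf, treeCmd 2 loopRight sumAfter tailLeaf,
    treeCmd 3 rankRight skip listHoleLeaf, treeCmd 4 rankRight skip listTailLeaf,
    loopCmd 5 moveLeaf, loopCmd 6 cleanLeaf, loopCmd 7 (nodeLeaf 9), loopCmd 8 (nodeLeaf 10),
    markProc, checkProc]

/-- Procedure `1` runs twice with different bounds in register `3`. With bound `n + m` it counts all
holes, which yields the new size; with the new size it counts the holes to be filled and prepares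
their numbering. The two output lists start at offsets `0` and `2 * m`. -/
def updateMain : Cmd :=
  (const 10 1 ;; load 2 0 11 ;; load 4 0 10 ;; add 8 2 4 ;; add 1 4 11 ;; add 0 10 11) ;;
  .call 0 ;;
  (add 1 4 4 ;; add 3 8 11) ;;
  .call 1 ;;
  (load 3 0 10 ;; sub 3 8 3) ;;
  .call 1 ;;
  load 9 0 10 ;;
  .call 3 ;;
  .call 2 ;;
  add 6 4 4 ;;
  .call 4 ;;
  .call 5 ;;
  .call 6 ;;
  (store 0 11 3 ;; add 20 3 10 ;; keyStore 0 20 0) ;;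
  .call 7 ;;
  .call 8

/-- Perform a batch of updates. -/
def updateProgram : Program := ⟨updateMain, updateProcs⟩

/-- Read the key of the root. -/
def findMinProgram : Program := ⟨const 0 1 ;; keyLoad 0 0 0, []⟩

end ParHeap

namespace ParHeap

/-! ### Ancestors in a complete binary tree -/

/-- Node `y` is an ancestor of node `w`, or equal to `w`. -/
def Anc (y w : ℕ) : Prop := ∃ i, w / 2 ^ i = y

theorem Anc.refl (y : ℕ) : Anc y y := ⟨0, by simp⟩

theorem Anc.le {y w : ℕ} (h : Anc y w) : y ≤ w := by
  obtain ⟨i, rfl⟩ := h; exact Nat.div_le_self _ _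

theorem Anc.trans {x y z : ℕ} (h : Anc x y) (h' : Anc y z) : Anc x z := by
  obtain ⟨i, rfl⟩ := h
  obtain ⟨j, rfl⟩ := h'
  exact ⟨j + i, by rw [pow_add, Nat.div_div_eq_div_mul]⟩

theorem anc_half (w : ℕ) : Anc (w / 2) w := ⟨1, by simp⟩

theorem anc_of_half {c x : ℕ} (h : c / 2 = x) : Anc x c := h ▸ anc_half c

theorem Anc.half {y w : ℕ} (h : Anc y w) (hne : y ≠ w) : Anc y (w / 2) := by
  obtain ⟨i, hi⟩ := h
  cases i with
  | zero => simp at hi; exact absurd hi.symm hne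
  | succ i => exact ⟨i, by rw [← hi, Nat.div_div_eq_div_mul, pow_succ, mul_comm]⟩

theorem Anc.total {y z w : ℕ} (h : Anc y w) (h' : Anc z w) : Anc y z ∨ Anc z y := by
  obtain ⟨i, rfl⟩ := h
  obtain ⟨j, rfl⟩ := h'
  obtain h | h := le_total i j
  · obtain ⟨k, rfl⟩ := Nat.exists_eq_add_of_le h
    exact .inr ⟨k, by rw [pow_add, Nat.div_div_eq_div_mul]⟩
  · obtain ⟨k, rfl⟩ := Nat.exists_eq_add_of_le h
    exact .inl ⟨k, by rw [pow_add, Nat.div_div_eq_div_mul]⟩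

/-- A proper descendant is a descendant of a child. -/
theorem Anc.child {x w : ℕ} (h : Anc x w) (hne : x ≠ w) :
    Anc (2 * x) w ∨ Anc (2 * x + 1) w := by
  obtain ⟨i, hi⟩ := h
  cases i with
  | zero => simp at hi; exact absurd hi.symm hne
  | succ i =>
    have : w / 2 ^ i / 2 = x := by rw [← hi, Nat.div_div_eq_div_mul, pow_succ]
    obtain h | h : w / 2 ^ i = 2 * x ∨ w / 2 ^ i = 2 * x + 1 := by omega
    · exact .inl ⟨i, h⟩
    · exact .inr ⟨i, h⟩

theorem log_child {c x : ℕ} (hx : 0 < x) (h : c / 2 = x) : Nat.log 2 c = Nat.log 2 x + 1 := by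
  rw [Nat.log_of_one_lt_of_le (by norm_num) (by omega), h]

/-! ### The potential -/

/-- Exchanging a node with its child preserves every subtree except the one rooted at the child
itself. -/
theorem anc_swap {x c y w : ℕ} (hc : c / 2 = x) (hy : y ≠ c) (h : Anc y w) :
    Anc y (Equiv.swap x c w) := by
  by_cases h₁ : w = x
  · subst h₁; rw [Equiv.swap_apply_left]; exact h.trans (anc_of_half hc)
  by_cases h₂ : w = c
  · subst h₂; rw [Equiv.swap_apply_right]; exact hc ▸ h.half hy
  rwa [Equiv.swap_apply_of_ne_of_ne h₁ h₂]

theorem mem_Icc_swap {N x c w : ℕ} (hx : x ∈ Finset.Icc 1 N) (hc : c ∈ Finset.Icc 1 N)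
    (hw : w ∈ Finset.Icc 1 N) : Equiv.swap x c w ∈ Finset.Icc 1 N := by
  by_cases h₁ : w = x
  · rw [h₁, Equiv.swap_apply_left]; exact hc
  by_cases h₂ : w = c
  · rw [h₂, Equiv.swap_apply_right]; exact hx
  rwa [Equiv.swap_apply_of_ne_of_ne h₁ h₂]

theorem map_swap_keys {K : Type u} {N : ℕ} (κ : ℕ → WithTop K) {x c : ℕ} (hx : x ∈ Finset.Icc 1 N)
    (hc : c ∈ Finset.Icc 1 N) :
    (Finset.Icc 1 N).val.map (κ ∘ Equiv.swap x c) = (Finset.Icc 1 N).val.map κ := by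
  rw [← Multiset.map_map]
  congr 1
  have : (Finset.Icc 1 N).map (Equiv.swap x c).toEmbedding = Finset.Icc 1 N := by
    refine Finset.eq_of_subset_of_card_le (fun w hw => ?_) (by simp)
    obtain ⟨v, hv, rfl⟩ := Finset.mem_map.1 hw
    exact mem_Icc_swap hx hc hv
  conv_rhs => rw [← this]
  rfl

section Potential

variable {K : Type u} [LinearOrder K]

open scoped Classical in
/-- The number of nodes below `x` with a smaller key. -/
noncomputable def smaller (N : ℕ) (κ : ℕ → WithTop K) (x : ℕ) : ℕ :=
  ((Finset.Icc 1 N).filter fun w => Anc x w ∧ κ w < κ x).card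

/-- A bound on the number of steps of the wave that is at node `x`. -/
noncomputable def waveBound (N : ℕ) (κ : ℕ → WithTop K) (x : ℕ) : ℕ :=
  1 + min (Nat.log 2 N - Nat.log 2 x) (smaller N κ x)

/-- A bound on the number of steps of all waves; `lab x ≠ 0` means that there is a wave at `x`. -/
noncomputable def potential (N : ℕ) (κ : ℕ → WithTop K) (lab : ℕ → ℕ) : ℕ :=
  ∑ x ∈ Finset.Icc 1 N, if lab x = 0 then 0 else waveBound N κ x

/-- The summand `1` in `waveBound` is there to pay for the end of a wave. -/
theorem potential_settle {N : ℕ} {κ : ℕ → WithTop K} {lab : ℕ → ℕ} {x : ℕ} (hx : x ∈ Finset.Icc 1 N)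
    (hl : lab x ≠ 0) : potential N κ (Function.update lab x 0) + 1 ≤ potential N κ lab := by
  unfold potential
  rw [← Finset.add_sum_erase _ _ hx, ← Finset.add_sum_erase (Finset.Icc 1 N) _ hx]
  rw [Finset.sum_congr rfl (g := fun x => if lab x = 0 then 0 else waveBound N κ x)]
  · simp [hl, waveBound]
  · intro y hy
    rw [Function.update_of_ne (Finset.ne_of_mem_erase hy)]

/-- The keys of `x` and its child `c` are exchanged. -/
theorem smaller_swap_child {N : ℕ} {κ : ℕ → WithTop K} {x c : ℕ} (hx : 0 < x) (hc : c / 2 = x)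
    (hcN : c ≤ N) (hlt : κ c < κ x) : smaller N (κ ∘ Equiv.swap x c) c + 1 ≤ smaller N κ x := by
  classical
  unfold smaller
  have hcx : c ≠ x := by omega
  -- The smaller key at `c` was counted for `x`; after the exchange it lies above `c` and is no
  -- longer counted.
  rw [← Finset.card_insert_of_notMem (a := c)]
  · refine Finset.card_le_card fun w hw => ?_
    simp only [Finset.mem_insert, Finset.mem_filter, Finset.mem_Icc, Function.comp,
      Equiv.swap_apply_right] at hw ⊢
    obtain rfl | ⟨hw, ha, hk⟩ := hw
    · exact ⟨by omega, anc_of_half hc, hlt⟩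
    · refine ⟨hw, (anc_of_half hc).trans ha, ?_⟩
      have h₁ : w ≠ x := by have := ha.le; omega
      have h₂ : w ≠ c := by rintro rfl; simp at hk
      rwa [Equiv.swap_apply_of_ne_of_ne h₁ h₂] at hk
  · simp

/-- The exchange permutes the subtree of `y` and keeps the key of `y`, so it is a bijection between
the counted nodes. -/
theorem smaller_swap_of_ne {N : ℕ} {κ : ℕ → WithTop K} {x c y : ℕ} (hx : 0 < x) (hc : c / 2 = x)
    (hcN : c ≤ N) (hyx : y ≠ x) (hyc : y ≠ c) :
    smaller N (κ ∘ Equiv.swap x c) y = smaller N κ y := by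
  classical
  unfold smaller
  have hx' : x ∈ Finset.Icc 1 N := by simp; omega
  have hc' : c ∈ Finset.Icc 1 N := by simp; omega
  refine Finset.card_bij (fun w _ => Equiv.swap x c w) ?_ ?_ ?_
  · intro w hw
    rw [Finset.mem_filter] at hw ⊢
    refine ⟨mem_Icc_swap hx' hc' hw.1, anc_swap hc hyc hw.2.1, ?_⟩
    simpa [Equiv.swap_apply_of_ne_of_ne hyx hyc] using hw.2.2
  · intro a _ b _ h; exact (Equiv.swap x c).injective h
  · intro w hw
    rw [Finset.mem_filter] at hw
    refine ⟨Equiv.swap x c w, ?_, by simp⟩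
    rw [Finset.mem_filter]
    refine ⟨mem_Icc_swap hx' hc' hw.1, anc_swap hc hyc hw.2.1, ?_⟩
    simpa [Equiv.swap_apply_of_ne_of_ne hyx hyc] using hw.2.2

/-- Both terms of the minimum drop by at least one: the height because `c` is one level lower, the
count by `smaller_swap_child`. No other wave is affected. -/
theorem potential_swap {N : ℕ} {κ : ℕ → WithTop K} {lab : ℕ → ℕ} {x c a : ℕ} (hx : 0 < x)
    (hc : c / 2 = x) (hcN : c ≤ N) (hlt : κ c < κ x) (hlx : lab x ≠ 0) (hlc : lab c = 0) :
    potential N (κ ∘ Equiv.swap x c) (Function.update (Function.update lab x 0) c a) + 1 ≤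
      potential N κ lab := by
  unfold potential
  have hcx : c ≠ x := by omega
  have hx' : x ∈ Finset.Icc 1 N := by simp; omega
  have hc' : c ∈ (Finset.Icc 1 N).erase x := by simp; omega
  rw [← Finset.add_sum_erase _ _ hx', ← Finset.add_sum_erase _ _ hc',
    ← Finset.add_sum_erase (Finset.Icc 1 N) _ hx',
    ← Finset.add_sum_erase ((Finset.Icc 1 N).erase x) _ hc']
  rw [Finset.sum_congr rfl (g := fun x => if lab x = 0 then 0 else waveBound N κ x)]
  · rw [Function.update_self, Function.update_of_ne hcx.symm, Function.update_self, if_pos rfl,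
      if_neg hlx, if_pos hlc]
    have h₁ := smaller_swap_child hx hc hcN hlt
    have h₂ := log_child hx hc
    have h₃ : Nat.log 2 c ≤ Nat.log 2 N := Nat.log_mono_right hcN
    simp only [waveBound]
    split <;> omega
  · intro y hy
    have hyc := Finset.ne_of_mem_erase hy
    have hyx := Finset.ne_of_mem_erase (Finset.mem_of_mem_erase hy)
    rw [Function.update_of_ne hyc, Function.update_of_ne hyx, waveBound, waveBound,
      smaller_swap_of_ne hx hc hcN hyx hyc]

end Potential

end ParHeap

namespace ParHeap

/-! ### The invariant of the parallel sift-down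

A mark `D x ≠ 0` (array `4`) means that a wave is at node `x`: a key that may be larger than the keys
of the children.  Every wave is labelled by the node where it started.  A wave can make a step when
it is claimed by a thread while both children of its node are unmarked. -/

section Sift

variable {K : Type u}

/-- What a thread owns. -/
inductive Tok (K : Type u) : Type u where
  /-- it is about to check `x`; all labels above are at levels less than `e` -/
  | chk (x e : ℕ)
  /-- it has read the label `d` of `x` and has seen `b` unmarked children -/
  | rd (x d b : ℕ)
  /-- it has claimed the wave with label `a` at `x`; keys before and after the writes of the owner -/
  | own (x a : ℕ) (lo ph : ℕ → WithTop K)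
  /-- the wave has left `x`, but `x` is still marked -/
  | rel (x e : ℕ)

/-- The node that is claimed by the owner of a token. -/
def Tok.owner : Tok K → Option ℕ
  | .own x _ _ _ => some x
  | .rel x _ => some x
  | _ => none

/-- `w` is `x` or a child of `x`. -/
def Near (x w : ℕ) : Prop := w = x ∨ w = 2 * x ∨ w = 2 * x + 1

/-- What a token says about the memory. -/
def Tok.Ok (κ : ℕ → WithTop K) (lab : ℕ → ℕ) (μ : Mem K) : Tok K → Prop
  | .chk x e => ∀ y, Anc y x → lab y ≠ 0 → Nat.log 2 (lab y) < e
  | .rd x d b => ∀ y, Anc y x → lab y ≠ 0 → Nat.log 2 (lab y) < Nat.log 2 d ∨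
      y = x ∧ (1 ≤ b → μ.num 4 (2 * x) = 0) ∧ (2 ≤ b → μ.num 4 (2 * x + 1) = 0)
  | .own x a lo ph => 0 < a ∧ a ≤ x ∧ x ≠ 0 ∧ lab x = a ∧ μ.num 4 x = 2 * x ∧
      μ.num 4 (2 * x) = 0 ∧ μ.num 4 (2 * x + 1) = 0 ∧
      ∀ w, Near x w → κ w = lo w ∧ μ.key 0 w = ph w
  | .rel x e => x ≠ 0 ∧ lab x = 0 ∧ μ.num 4 x = 2 * x ∧
      ∀ y, Anc y x → lab y ≠ 0 → Nat.log 2 (lab y) < e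

/-- The owner of the token will find out that the wave at `x` can move. -/
def Tok.Resp (μ : Mem K) (x : ℕ) (τ : Tok K) : Prop :=
  (∃ e, τ = .chk x e) ∨ ∃ b, τ = .rd x (μ.num 4 x) b

/-- The wave at `x` can be claimed. -/
def Enabled (μ : Mem K) (x : ℕ) : Prop :=
  0 < μ.num 4 x ∧ μ.num 4 x ≤ x ∧ μ.num 4 (2 * x) = 0 ∧ μ.num 4 (2 * x + 1) = 0

variable {μ : Mem K}

theorem owners_cons_none {τ : Tok K} {f : Multiset (Tok K)} (h : τ.owner = none) :
    (τ ::ₘ f).filterMap Tok.owner = f.filterMap Tok.owner :=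
  Multiset.filterMap_cons_none _ _ h

theorem owners_cons_own {f : Multiset (Tok K)} {x a : ℕ} {lo ph : ℕ → WithTop K} :
    (Tok.own x a lo ph ::ₘ f).filterMap Tok.owner = x ::ₘ f.filterMap Tok.owner :=
  Multiset.filterMap_cons_some Tok.owner _ _ rfl

theorem owners_cons_rel {f : Multiset (Tok K)} {x e : ℕ} :
    (Tok.rel x e ::ₘ f).filterMap Tok.owner = x ::ₘ f.filterMap Tok.owner :=
  Multiset.filterMap_cons_some Tok.owner _ _ rfl

theorem Tok.Resp.eq_of_chk {x y e : ℕ} (h : (Tok.chk x e : Tok K).Resp μ y) : y = x := by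
  obtain ⟨e', h⟩ | ⟨b, h⟩ := h <;> cases h; rfl

theorem Tok.Resp.of_rd {x y d b : ℕ} (h : (Tok.rd x d b : Tok K).Resp μ y) :
    y = x ∧ d = μ.num 4 x := by
  obtain ⟨e', h⟩ | ⟨b, h⟩ := h <;> cases h; exact ⟨rfl, rfl⟩

/-- Different owners are responsible for different keys. -/
theorem near_disjoint {x x' w : ℕ} (hx : μ.num 4 x ≠ 0) (hx' : μ.num 4 x' ≠ 0) (hne : x ≠ x')
    (h₁ : μ.num 4 (2 * x) = 0) (h₂ : μ.num 4 (2 * x + 1) = 0) (h₁' : μ.num 4 (2 * x') = 0)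
    (h₂' : μ.num 4 (2 * x' + 1) = 0) (h : Near x w) (h' : Near x' w) : False := by
  -- A claimed node is marked and its children are not, so neither node is a child of the other; and
  -- two nodes have no common child.
  obtain rfl | rfl | rfl := h <;> obtain h' | h' | h' := h'
  · exact hne h'
  · exact hx (h' ▸ h₁')
  · exact hx (h' ▸ h₂')
  · exact hx' (h' ▸ h₁)
  · omega
  · omega
  · exact hx' (h' ▸ h₂)
  · omega
  · omega

theorem Mem.setNum_same (μ : Mem K) (b i v : ℕ) : (μ.setNum b i v).num b i = v := by
  simp [Mem.setNum]

theorem Mem.setNum_ne (μ : Mem K) {b i j : ℕ} (h : j ≠ i) (v : ℕ) :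
    (μ.setNum b i v).num b j = μ.num b j := by
  simp [Mem.setNum, h]

theorem Mem.setNum_array_ne (μ : Mem K) {b b' : ℕ} (h : b' ≠ b) (i v : ℕ) :
    (μ.setNum b i v).num b' = μ.num b' := by
  simp [Mem.setNum, h]

theorem Mem.setNum_key (μ : Mem K) (b i v : ℕ) : (μ.setNum b i v).key = μ.key := rfl

theorem Mem.setKey_num (μ : Mem K) (b i : ℕ) (v : WithTop K) : (μ.setKey b i v).num = μ.num := rfl

variable [LinearOrder K]

/-- The invariant, with logical keys `κ` and labels `lab`. -/
structure SiftInv (N c : ℕ) (μ₀ : Mem K) (κ : ℕ → WithTop K) (lab : ℕ → ℕ) (p : ℕ) (μ : Mem K)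
    (g : Multiset (Tok K)) : Prop where
  num_eq : ∀ b, b ≠ 4 → μ.num b = μ₀.num b
  blank : κ (N + 1) = ⊤
  keys : (Finset.Icc 1 N).val.map κ = (Finset.Icc 1 N).val.map (μ₀.key 0)
  order : ∀ y w, lab y = 0 → 1 ≤ y → Anc y w → w ≤ N → κ y ≤ κ w
  lab_le : ∀ x, lab x ≠ 0 → x ≤ N ∧ lab x ≤ x
  lab_lt : ∀ y x, Anc y x → y ≠ x → lab y ≠ 0 → lab x ≠ 0 →
    Nat.log 2 (lab y) < Nat.log 2 (lab x)
  mark : ∀ x, μ.num 4 x = lab x ∨ 0 < x ∧ μ.num 4 x = 2 * x ∧ ∃ τ ∈ g, τ.owner = some x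
  uniq : (g.filterMap Tok.owner).Nodup
  phys : ∀ w, μ.key 0 w = κ w ∨ ∃ x a lo ph, Tok.own x a lo ph ∈ g ∧ Near x w
  ok : ∀ τ ∈ g, τ.Ok κ lab μ
  resp : ∀ x, Enabled μ x → ∃ τ ∈ g, τ.Resp μ x
  pot : c * potential N κ lab ≤ p

variable {N c : ℕ} {μ₀ : Mem K} {κ : ℕ → WithTop K} {lab : ℕ → ℕ} {p : ℕ}
  {f : Multiset (Tok K)}

/-- A claim changes the mark to `2 * x`, which exceeds `x` at the positive node `x`. A mark of at
most `x` is therefore a label. -/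
theorem SiftInv.lab_eq {g : Multiset (Tok K)} (h : SiftInv N c μ₀ κ lab p μ g) {x : ℕ}
    (hx : μ.num 4 x ≤ x) : μ.num 4 x = lab x := by
  obtain h | ⟨h₁, h₂, -⟩ := h.mark x
  · exact h
  · omega

/-- Forget or change a token that does not claim a node. -/
theorem SiftInv.change {τ : Tok K} {g' : Multiset (Tok K)} (h : SiftInv N c μ₀ κ lab p μ (τ ::ₘ f))
    (hτ : τ.owner = none) (hg : ∀ σ ∈ g', σ.owner = none ∧ σ.Ok κ lab μ)
    (hr : ∀ x, Enabled μ x → τ.Resp μ x → ∃ σ ∈ g', σ.Resp μ x) :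
    SiftInv N c μ₀ κ lab p μ (g' + f) := by
  have hfm : (g' + f).filterMap Tok.owner = f.filterMap Tok.owner := by
    have h0 : g'.filterMap Tok.owner = 0 := by
      rw [Multiset.eq_zero_iff_forall_notMem]
      intro a ha
      obtain ⟨σ, hσ, e⟩ := (Multiset.mem_filterMap _ _).1 ha
      rw [(hg σ hσ).1] at e; cases e
    rw [Multiset.filterMap_add, h0, zero_add]
  refine { h with
    mark := fun x => ?_, uniq := ?_, phys := fun w => ?_, ok := fun σ hσ => ?_,
    resp := fun x hx => ?_ }
  · obtain h | ⟨h₁, h₂, σ, hσ, e⟩ := h.mark x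
    · exact .inl h
    · obtain rfl | hσ := Multiset.mem_cons.1 hσ
      · rw [hτ] at e; cases e
      · exact .inr ⟨h₁, h₂, σ, Multiset.mem_add.2 (.inr hσ), e⟩
  · rw [hfm]
    have := h.uniq
    rwa [owners_cons_none hτ] at this
  · obtain h | ⟨x, a, lo, ph, hσ, e⟩ := h.phys w
    · exact .inl h
    · obtain rfl | hσ := Multiset.mem_cons.1 hσ
      · cases hτ
      · exact .inr ⟨x, a, lo, ph, Multiset.mem_add.2 (.inr hσ), e⟩
  · obtain hσ | hσ := Multiset.mem_add.1 hσ
    · exact (hg σ hσ).2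
    · exact h.ok σ (Multiset.mem_cons_of_mem hσ)
  · obtain ⟨σ, hσ, e⟩ := h.resp x hx
    obtain rfl | hσ := Multiset.mem_cons.1 hσ
    · obtain ⟨σ, hσ, e⟩ := hr x hx e
      exact ⟨σ, Multiset.mem_add.2 (.inl hσ), e⟩
    · exact ⟨σ, Multiset.mem_add.2 (.inr hσ), e⟩

/-- The thread gives up. -/
theorem SiftInv.drop_chk {x e : ℕ} (h : SiftInv N c μ₀ κ lab p μ (.chk x e ::ₘ f))
    (hx : μ.num 4 x = 0 ∨ x < μ.num 4 x) : SiftInv N c μ₀ κ lab p μ f := by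
  have := h.change (g' := 0) rfl (by simp) fun y hy hr => by
    obtain rfl := hr.eq_of_chk
    obtain ⟨h₁, h₂, -⟩ := hy
    omega
  simpa using this

/-- In each of these cases the token is responsible for nothing: either the mark has changed since
it was read, or a child is marked and `x` is not claimable. In the latter case the thread that
unmarks the child will check `x`. -/
theorem SiftInv.drop_rd {x d b : ℕ} (h : SiftInv N c μ₀ κ lab p μ (.rd x d b ::ₘ f))
    (hx : d ≠ μ.num 4 x ∨ μ.num 4 (2 * x) ≠ 0 ∨ μ.num 4 (2 * x + 1) ≠ 0) :
    SiftInv N c μ₀ κ lab p μ f := by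
  have := h.change (g' := 0) rfl (by simp) fun y hy hr => by
    obtain ⟨rfl, h'⟩ := hr.of_rd
    obtain ⟨h₁, h₂, h₃, h₄⟩ := hy
    omega
  simpa using this

/-- The label of a wave has been read. -/
theorem SiftInv.read {x e : ℕ} (h : SiftInv N c μ₀ κ lab p μ (.chk x e ::ₘ f))
    (h₀ : 0 < μ.num 4 x) (hx : μ.num 4 x ≤ x) :
    Nat.log 2 (μ.num 4 x) < e ∧ x ≤ N ∧
      SiftInv N c μ₀ κ lab p μ (.rd x (μ.num 4 x) 0 ::ₘ f) := by
  have hl := h.lab_eq hx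
  have hok := h.ok _ (Multiset.mem_cons_self _ _)
  refine ⟨hl ▸ hok x (.refl x) (by omega), (h.lab_le x (by omega)).1, ?_⟩
  refine h.change (g' := {.rd x (μ.num 4 x) 0}) rfl (fun σ hσ => ?_) fun y hy hr => ?_
  · rw [Multiset.mem_singleton] at hσ
    subst hσ
    refine ⟨rfl, fun y hy hly => ?_⟩
    by_cases hyx : y = x
    · exact .inr ⟨hyx, by omega, by omega⟩
    · exact .inl (hl ▸ h.lab_lt y x hy hyx hly (by omega))
  · obtain rfl := hr.eq_of_chk
    exact ⟨_, Multiset.mem_singleton_self _, .inr ⟨0, rfl⟩⟩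

/-- An unmarked child has been seen. -/
theorem SiftInv.see {x d b b' : ℕ} (h : SiftInv N c μ₀ κ lab p μ (.rd x d b ::ₘ f))
    (hx : 1 ≤ b' → 1 ≤ b ∨ μ.num 4 (2 * x) = 0) (hx' : 2 ≤ b' → 2 ≤ b ∨ μ.num 4 (2 * x + 1) = 0) :
    SiftInv N c μ₀ κ lab p μ (.rd x d b' ::ₘ f) := by
  have hok := h.ok _ (Multiset.mem_cons_self _ _)
  refine h.change (g' := {.rd x d b'}) rfl (fun σ hσ => ?_) fun y hy hr => ?_
  · rw [Multiset.mem_singleton] at hσ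
    subst hσ
    refine ⟨rfl, fun y hy hly => (hok y hy hly).imp_right ?_⟩
    rintro ⟨h₁, h₂, h₃⟩
    exact ⟨h₁, fun hb => (hx hb).elim h₂ id, fun hb => (hx' hb).elim h₃ id⟩
  · obtain ⟨rfl, h'⟩ := hr.of_rd
    exact ⟨_, Multiset.mem_singleton_self _, .inr ⟨b', by rw [h']⟩⟩

/-- The wave at `x` is claimed. -/
theorem SiftInv.claim {x d : ℕ} (h : SiftInv N c μ₀ κ lab p μ (.rd x d 2 ::ₘ f))
    (hd : 0 < d) (hdx : d ≤ x) (hx : μ.num 4 x = d) :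
    κ x = μ.key 0 x ∧
    SiftInv N c μ₀ κ lab p (μ.setNum 4 x (2 * x)) (.own x d κ κ ::ₘ f) := by
  have hl := h.lab_eq (x := x) (by omega)
  -- This excludes the ABA problem. Had the wave that was read left `x`, any newer wave there would
  -- carry a label of level below `log d`. As the mark is still `d`, it is the same wave, and a
  -- child of its node can be marked only by its own advance.
  obtain ⟨h₁, h₂⟩ : μ.num 4 (2 * x) = 0 ∧ μ.num 4 (2 * x + 1) = 0 := by
    obtain h' | ⟨-, h₁, h₂⟩ := h.ok _ (Multiset.mem_cons_self _ _) x (.refl x) (by omega)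
    · rw [← hl, hx] at h'; omega
    · exact ⟨h₁ (by norm_num), h₂ le_rfl⟩
  -- No other claimed node is in charge of these cells, so no exchange is in progress there.
  have hphys : ∀ w, Near x w → μ.key 0 w = κ w := by
    intro w hw
    obtain h' | ⟨x', a, lo, ph, hm, hw'⟩ := h.phys w
    · exact h'
    · have hok := h.ok _ hm
      obtain ⟨ha, ha', hx0, hlx, hmx, hm₁, hm₂, -⟩ := hok
      refine (near_disjoint (μ := μ) (x := x) (x' := x') (by omega) (by omega) ?_ h₁ h₂ hm₁ hm₂ hw
        hw').elim
      rintro rfl; omega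
  refine ⟨(hphys x (.inl rfl)).symm, ?_⟩
  have hother : ∀ σ ∈ f, σ.owner ≠ some x := by
    intro σ hσ e
    have hok := h.ok σ (Multiset.mem_cons_of_mem hσ)
    cases σ with
    | own x' a lo ph =>
      cases e
      obtain ⟨-, -, -, -, hmx, -⟩ := hok
      omega
    | rel x' e' =>
      cases e
      obtain ⟨-, -, hmx, -⟩ := hok
      omega
    | chk _ _ => cases e
    | rd _ _ _ => cases e
  have hD : ∀ y, y ≠ x → (μ.setNum 4 x (2 * x)).num 4 y = μ.num 4 y := fun y hy =>
    μ.setNum_ne hy _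
  have hDx := μ.setNum_same 4 x (2 * x)
  refine { h with
    num_eq := fun b hb => ?_, mark := fun y => ?_, uniq := ?_, phys := fun w => ?_,
    ok := fun σ hσ => ?_, resp := fun y hy => ?_ }
  · rw [Mem.setNum_array_ne _ hb, h.num_eq b hb]
  · by_cases hy : y = x
    · subst hy
      exact .inr ⟨by omega, hDx, _, Multiset.mem_cons_self _ _, rfl⟩
    · rw [hD y hy]
      obtain h | ⟨h₁, h₂, σ, hσ, e⟩ := h.mark y
      · exact .inl h
      · obtain rfl | hσ := Multiset.mem_cons.1 hσ
        · cases e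
        · exact .inr ⟨h₁, h₂, σ, Multiset.mem_cons_of_mem hσ, e⟩
  · have := h.uniq
    rw [owners_cons_none rfl] at this
    rw [owners_cons_own, Multiset.nodup_cons]
    refine ⟨fun hm => ?_, this⟩
    obtain ⟨σ, hσ, e⟩ := (Multiset.mem_filterMap _ _).1 hm
    exact hother σ hσ e
  · obtain h | ⟨x', a, lo, ph, hσ, e⟩ := h.phys w
    · exact .inl h
    · obtain hσ | hσ := Multiset.mem_cons.1 hσ
      · cases hσ
      · exact .inr ⟨x', a, lo, ph, Multiset.mem_cons_of_mem hσ, e⟩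
  · obtain rfl | hσ := Multiset.mem_cons.1 hσ
    · refine ⟨hd, hdx, by omega, by omega, hDx, ?_, ?_, fun w hw => ⟨rfl, hphys w hw⟩⟩
      · rw [hD _ (by omega), h₁]
      · rw [hD _ (by omega), h₂]
    · have hok := h.ok σ (Multiset.mem_cons_of_mem hσ)
      have hne := hother σ hσ
      cases σ with
      | own x' a lo ph =>
        obtain ⟨g₁, g₂, g₃, g₄, g₅, g₆, g₇, g₈⟩ := hok
        have hx' : x' ≠ x := by rintro rfl; exact hne rfl
        refine ⟨g₁, g₂, g₃, g₄, ?_, ?_, ?_, g₈⟩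
        · rwa [hD _ hx']
        · rw [hD _ (by rintro e; rw [e] at g₆; omega), g₆]
        · rw [hD _ (by rintro e; rw [e] at g₇; omega), g₇]
      | rel x' e' =>
        obtain ⟨g₁, g₂, g₃, g₄⟩ := hok
        have hx' : x' ≠ x := by rintro rfl; exact hne rfl
        exact ⟨g₁, g₂, by rwa [hD _ hx'], g₄⟩
      | chk _ _ => exact hok
      | rd x' d' b =>
        refine fun y hy hly => (hok y hy hly).imp_right ?_
        rintro ⟨g₁, g₂, g₃⟩
        refine ⟨g₁, fun hb => ?_, fun hb => ?_⟩
        · rw [hD _ (by rintro e; have := g₂ hb; rw [e] at this; omega), g₂ hb]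
        · rw [hD _ (by rintro e; have := g₃ hb; rw [e] at this; omega), g₃ hb]
  · obtain ⟨g₁, g₂, g₃, g₄⟩ := hy
    -- A claim creates no claimable node: the mark `2 * x` is too large for `x`, and for the parent
    -- of `x` it is still nonzero.
    have hyx : y ≠ x := by rintro rfl; omega
    have hyx₁ : 2 * y ≠ x := by rintro e; rw [e, hDx] at g₃; omega
    have hyx₂ : 2 * y + 1 ≠ x := by rintro e; rw [e, hDx] at g₄; omega
    rw [hD _ hyx] at g₁ g₂
    rw [hD _ hyx₁] at g₃
    rw [hD _ hyx₂] at g₄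
    obtain ⟨σ, hσ, hr⟩ := h.resp y ⟨g₁, g₂, g₃, g₄⟩
    obtain rfl | hσ := Multiset.mem_cons.1 hσ
    · exact absurd hr.of_rd.1 hyx
    · refine ⟨σ, Multiset.mem_cons_of_mem hσ, ?_⟩
      unfold Tok.Resp at hr ⊢
      rwa [hD _ hyx]

/-- The owner of `x` writes a key. -/
theorem SiftInv.write {x a w : ℕ} {lo ph : ℕ → WithTop K}
    (h : SiftInv N c μ₀ κ lab p μ (.own x a lo ph ::ₘ f)) (hw : Near x w) (v : WithTop K) :
    SiftInv N c μ₀ κ lab p (μ.setKey 0 w v) (.own x a lo (Function.update ph w v) ::ₘ f) := by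
  have hu := h.uniq
  rw [owners_cons_own] at hu
  obtain ⟨g₁, g₂, g₃, g₄, g₅, g₆, g₇, g₈⟩ := h.ok _ (Multiset.mem_cons_self _ _)
  have hkey : ∀ u, u ≠ w → (μ.setKey 0 w v).key 0 u = μ.key 0 u := fun u hu => by
    simp [Mem.setKey, hu]
  have hkeyw : (μ.setKey 0 w v).key 0 w = v := by simp [Mem.setKey]
  refine { h with
    num_eq := h.num_eq, mark := fun y => ?_, uniq := ?_, phys := fun u => ?_,
    ok := fun σ hσ => ?_, resp := fun y hy => ?_ }
  · obtain h | ⟨h₁, h₂, σ, hσ, e⟩ := h.mark y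
    · exact .inl h
    · obtain rfl | hσ := Multiset.mem_cons.1 hσ
      · exact .inr ⟨h₁, h₂, _, Multiset.mem_cons_self _ _, e⟩
      · exact .inr ⟨h₁, h₂, σ, Multiset.mem_cons_of_mem hσ, e⟩
  · rw [owners_cons_own]; exact hu
  · by_cases hu : u = w
    · subst hu; exact .inr ⟨x, a, _, _, Multiset.mem_cons_self _ _, hw⟩
    rw [hkey u hu]
    obtain h | ⟨x', a', lo', ph', hσ, e⟩ := h.phys u
    · exact .inl h
    · obtain hσ | hσ := Multiset.mem_cons.1 hσ
      · cases hσ; exact .inr ⟨x, a, _, _, Multiset.mem_cons_self _ _, e⟩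
      · exact .inr ⟨x', a', _, _, Multiset.mem_cons_of_mem hσ, e⟩
  · obtain rfl | hσf := Multiset.mem_cons.1 hσ
    · refine ⟨g₁, g₂, g₃, g₄, g₅, g₆, g₇, fun u hu => ⟨(g₈ u hu).1, ?_⟩⟩
      by_cases huw : u = w
      · subst huw; rw [hkeyw, Function.update_self]
      · rw [hkey u huw, Function.update_of_ne huw, (g₈ u hu).2]
    · have hok := h.ok σ (Multiset.mem_cons_of_mem hσf)
      cases σ with
      | own x' a' lo' ph' =>
        obtain ⟨g₁', g₂', g₃', g₄', g₅', g₆', g₇', g₈'⟩ := hok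
        refine ⟨g₁', g₂', g₃', g₄', g₅', g₆', g₇', fun u hu' => ⟨(g₈' u hu').1, ?_⟩⟩
        rw [hkey, (g₈' u hu').2]
        rintro rfl
        refine near_disjoint (μ := μ) (x := x) (x' := x') (by omega) (by omega) ?_ g₆ g₇ g₆' g₇' hw
          hu'
        rintro rfl
        exact (Multiset.nodup_cons.1 hu).1
          ((Multiset.mem_filterMap _ _).2 ⟨Tok.own x a' lo' ph', hσf, rfl⟩)
      | _ => exact hok
  · obtain ⟨σ, hσ, hr⟩ := h.resp y hy
    obtain rfl | hσ := Multiset.mem_cons.1 hσ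
    · obtain ⟨e', h⟩ | ⟨b, h⟩ := hr <;> cases h
    · exact ⟨σ, Multiset.mem_cons_of_mem hσ, hr⟩

end Sift

end ParHeap

namespace ParHeap

/-! ### Transitions of a claimed wave -/

section Sift

variable {K : Type u} [LinearOrder K] {N c : ℕ} {μ₀ : Mem K} {κ : ℕ → WithTop K} {lab : ℕ → ℕ}
  {p : ℕ} {μ : Mem K} {f : Multiset (Tok K)}

theorem SiftInv.owner_ne {x : ℕ} {τ : Tok K} (h : SiftInv N c μ₀ κ lab p μ (τ ::ₘ f))
    (hτ : τ.owner = some x) : ∀ σ ∈ f, σ.owner ≠ some x := by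
  intro σ hσ e
  have := h.uniq
  rw [Multiset.filterMap_cons_some Tok.owner _ _ hτ, Multiset.nodup_cons] at this
  exact this.1 ((Multiset.mem_filterMap _ _).2 ⟨σ, hσ, e⟩)

/-- The key at `x` is not larger than the keys of the children, so the wave at `x` ends. -/
theorem SiftInv.settle {x a : ℕ} {lo : ℕ → WithTop K}
    (h : SiftInv N c μ₀ κ lab p μ (.own x a lo lo ::ₘ f))
    (h₁ : 2 * x ≤ N → lo x ≤ lo (2 * x)) (h₂ : 2 * x + 1 ≤ N → lo x ≤ lo (2 * x + 1)) :
    c ≤ p ∧ SiftInv N c μ₀ κ (Function.update lab x 0) (p - c) μ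
      (.rel x (Nat.log 2 a) ::ₘ f) := by
  obtain ⟨ha, hax, hx0, hlx, hmx, hm₁, hm₂, hw⟩ := h.ok _ (Multiset.mem_cons_self _ _)
  have hne := h.owner_ne rfl
  have hxN := (h.lab_le x (by omega)).1
  have hlz : ∀ y, y ≠ x → Function.update lab x 0 y = lab y := fun y hy =>
    Function.update_of_ne hy _ _
  have hlx' : Function.update lab x 0 x = 0 := Function.update_self _ _ _
  have hlz' : ∀ y, Function.update lab x 0 y ≠ 0 → y ≠ x ∧ lab y ≠ 0 := by
    intro y hy
    have : y ≠ x := by rintro rfl; exact hy hlx'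
    exact ⟨this, by rwa [hlz y this] at hy⟩
  have hpot := potential_settle (N := N) (κ := κ) (lab := lab) (x := x) (by simp; omega) (by omega)
  have hpot' := Nat.mul_le_mul_left c hpot
  rw [mul_add, mul_one] at hpot'
  have hp := h.pot
  refine ⟨by omega, { h with
    order := fun y w hy hy1 hyw hwN => ?_, lab_le := fun y hy => ?_,
    lab_lt := fun y z hyz hne hy hz => ?_, mark := fun y => ?_, uniq := ?_, phys := fun u => ?_,
    ok := fun σ hσ => ?_, resp := fun y hy => ?_, pot := by omega }⟩
  · by_cases hyx : y = x
    · subst hyx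
      by_cases hyw' : y = w
      · rw [hyw']
      -- Both children are unmarked, so they are minimal in their subtrees; comparing with the
      -- children suffices.
      have hl₁ := h.lab_eq (x := 2 * y) (by omega)
      have hl₂ := h.lab_eq (x := 2 * y + 1) (by omega)
      rw [(hw y (.inl rfl)).1]
      obtain h' | h' := hyw.child hyw'
      · refine (h₁ (h'.le.trans hwN)).trans ?_
        rw [← (hw (2 * y) (.inr (.inl rfl))).1]
        exact h.order _ _ (by omega) (by omega) h' hwN
      · refine (h₂ (h'.le.trans hwN)).trans ?_
        rw [← (hw (2 * y + 1) (.inr (.inr rfl))).1]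
        exact h.order _ _ (by omega) (by omega) h' hwN
    · exact h.order y w (by rwa [hlz y hyx] at hy) hy1 hyw hwN
  · obtain ⟨hyx, hy'⟩ := hlz' y hy
    rw [hlz y hyx]; exact h.lab_le y hy'
  · obtain ⟨hyx, hy'⟩ := hlz' y hy
    obtain ⟨hzx, hz'⟩ := hlz' z hz
    rw [hlz y hyx, hlz z hzx]; exact h.lab_lt y z hyz hne hy' hz'
  · by_cases hyx : y = x
    · subst hyx; exact .inr ⟨by omega, hmx, _, Multiset.mem_cons_self _ _, rfl⟩
    rw [hlz y hyx]
    obtain h | ⟨h₁, h₂, σ, hσ, e⟩ := h.mark y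
    · exact .inl h
    · obtain rfl | hσ := Multiset.mem_cons.1 hσ
      · cases e; exact absurd rfl hyx
      · exact .inr ⟨h₁, h₂, σ, Multiset.mem_cons_of_mem hσ, e⟩
  · have := h.uniq
    rw [owners_cons_own] at this
    rwa [owners_cons_rel]
  · obtain h' | ⟨x', a', lo', ph', hσ, e⟩ := h.phys u
    · exact .inl h'
    · obtain hσ | hσ := Multiset.mem_cons.1 hσ
      · cases hσ; exact .inl ((hw u e).2.trans (hw u e).1.symm)
      · exact .inr ⟨x', a', lo', ph', Multiset.mem_cons_of_mem hσ, e⟩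
  · obtain rfl | hσ := Multiset.mem_cons.1 hσ
    · refine ⟨hx0, hlx', hmx, fun y hyx hy => ?_⟩
      obtain ⟨hne, hy'⟩ := hlz' y hy
      rw [hlz y hne, ← hlx]
      exact h.lab_lt y x hyx hne hy' (by omega)
    · have hok := h.ok σ (Multiset.mem_cons_of_mem hσ)
      have hσx := hne σ hσ
      cases σ with
      | own x' a' lo' ph' =>
        have hx' : x' ≠ x := by rintro rfl; exact hσx rfl
        obtain ⟨g₁, g₂, g₃, g₄, g₅⟩ := hok
        exact ⟨g₁, g₂, g₃, by rwa [hlz _ hx'], g₅⟩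
      | rel x' e' =>
        have hx' : x' ≠ x := by rintro rfl; exact hσx rfl
        obtain ⟨g₁, g₂, g₃, g₄⟩ := hok
        refine ⟨g₁, by rwa [hlz _ hx'], g₃, fun y hyx hy => ?_⟩
        obtain ⟨hne, hy'⟩ := hlz' y hy
        rw [hlz y hne]; exact g₄ y hyx hy'
      | chk x' e' =>
        intro y hyx hy
        obtain ⟨hne, hy'⟩ := hlz' y hy
        rw [hlz y hne]; exact hok y hyx hy'
      | rd x' d b =>
        intro y hyx hy
        obtain ⟨hne, hy'⟩ := hlz' y hy
        rw [hlz y hne]; exact hok y hyx hy'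
  · obtain ⟨σ, hσ, hr⟩ := h.resp y hy
    obtain rfl | hσ := Multiset.mem_cons.1 hσ
    · obtain ⟨e', h⟩ | ⟨b, h⟩ := hr <;> cases h
    · exact ⟨σ, Multiset.mem_cons_of_mem hσ, hr⟩

/-- The mark is removed from `x`. -/
theorem SiftInv.release {x e : ℕ} (h : SiftInv N c μ₀ κ lab p μ (.rel x e ::ₘ f)) :
    SiftInv N c μ₀ κ lab p (μ.setNum 4 x 0) (.chk (x / 2) e ::ₘ f) := by
  obtain ⟨hx0, hlx, hmx, he⟩ := h.ok _ (Multiset.mem_cons_self _ _)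
  have hne := h.owner_ne rfl
  have hD : ∀ y, y ≠ x → (μ.setNum 4 x 0).num 4 y = μ.num 4 y := fun y hy =>
    μ.setNum_ne hy _
  have hDx := μ.setNum_same 4 x 0
  have hz : ∀ y, μ.num 4 y = 0 → (μ.setNum 4 x 0).num 4 y = 0 := fun y hy => by
    by_cases hyx : y = x
    · rw [hyx, hDx]
    · rw [hD y hyx, hy]
  refine { h with
    num_eq := fun b hb => ?_, mark := fun y => ?_, uniq := ?_, phys := fun u => ?_,
    ok := fun σ hσ => ?_, resp := fun y hy => ?_ }
  · rw [Mem.setNum_array_ne _ hb, h.num_eq b hb]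
  · by_cases hyx : y = x
    · subst hyx; exact .inl (by rw [hDx, hlx])
    rw [hD y hyx]
    obtain h | ⟨h₁, h₂, σ, hσ, e⟩ := h.mark y
    · exact .inl h
    · obtain rfl | hσ := Multiset.mem_cons.1 hσ
      · cases e; exact absurd rfl hyx
      · exact .inr ⟨h₁, h₂, σ, Multiset.mem_cons_of_mem hσ, e⟩
  · have := h.uniq
    rw [owners_cons_rel, Multiset.nodup_cons] at this
    rw [owners_cons_none rfl]; exact this.2
  · obtain h' | ⟨x', a', lo', ph', hσ, e⟩ := h.phys u
    · exact .inl h'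
    · obtain hσ | hσ := Multiset.mem_cons.1 hσ
      · cases hσ
      · exact .inr ⟨x', a', lo', ph', Multiset.mem_cons_of_mem hσ, e⟩
  · obtain rfl | hσ := Multiset.mem_cons.1 hσ
    · exact fun y hy hly => he y (hy.trans (anc_half x)) hly
    · have hok := h.ok σ (Multiset.mem_cons_of_mem hσ)
      have hσx := hne σ hσ
      cases σ with
      | own x' a' lo' ph' =>
        have hx' : x' ≠ x := by rintro rfl; exact hσx rfl
        obtain ⟨g₁, g₂, g₃, g₄, g₅, g₆, g₇, g₈⟩ := hok
        exact ⟨g₁, g₂, g₃, g₄, by rwa [hD _ hx'], hz _ g₆, hz _ g₇, g₈⟩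
      | rel x' e' =>
        have hx' : x' ≠ x := by rintro rfl; exact hσx rfl
        obtain ⟨g₁, g₂, g₃, g₄⟩ := hok
        exact ⟨g₁, g₂, by rwa [hD _ hx'], g₄⟩
      | chk x' e' => exact hok
      | rd x' d b =>
        exact fun y hy hly => (hok y hy hly).imp_right fun g =>
          ⟨g.1, fun hb => hz _ (g.2.1 hb), fun hb => hz _ (g.2.2 hb)⟩
  -- Removing the mark can make only the parent claimable, and the new token is responsible for it.
  · by_cases hyx : y = x / 2
    · exact ⟨_, Multiset.mem_cons_self _ _, .inl ⟨e, by rw [hyx]⟩⟩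
    obtain ⟨g₁, g₂, g₃, g₄⟩ := hy
    have hyx' : y ≠ x := by rintro rfl; rw [hDx] at g₁; omega
    rw [hD _ hyx'] at g₁ g₂
    rw [hD _ (by omega)] at g₃ g₄
    obtain ⟨σ, hσ, hr⟩ := h.resp y ⟨g₁, g₂, g₃, g₄⟩
    obtain rfl | hσ := Multiset.mem_cons.1 hσ
    · obtain ⟨e', h⟩ | ⟨b, h⟩ := hr <;> cases h
    · refine ⟨σ, Multiset.mem_cons_of_mem hσ, ?_⟩
      unfold Tok.Resp at hr ⊢
      rwa [hD _ hyx']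

/-- The keys of `x` and its child `v` have been exchanged, and the wave moves to `v`. -/
theorem SiftInv.advance {x a v : ℕ} {lo ph : ℕ → WithTop K}
    (h : SiftInv N c μ₀ κ lab p μ (.own x a lo ph ::ₘ f))
    (hv : v / 2 = x) (hvN : v ≤ N) (hlt : lo v < lo x)
    (h₁ : 2 * x ≤ N → lo v ≤ lo (2 * x)) (h₂ : 2 * x + 1 ≤ N → lo v ≤ lo (2 * x + 1))
    (hph : ∀ w, Near x w → ph w = lo (Equiv.swap x v w)) :
    c ≤ p ∧ SiftInv N c μ₀ (κ ∘ Equiv.swap x v)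
      (Function.update (Function.update lab x 0) v a) (p - c) (μ.setNum 4 v a)
      (.rel x (Nat.log 2 a) ::ₘ .chk v (Nat.log 2 a + 1) ::ₘ f) := by
  obtain ⟨ha, hax, hx0, hlx, hmx, hm₁, hm₂, hw⟩ := h.ok _ (Multiset.mem_cons_self _ _)
  have hne := h.owner_ne rfl
  have hxN := (h.lab_le x (by omega)).1
  have hvx : v ≠ x := by omega
  have hv0 : 0 < v := by omega
  have hnv : Near x v := by unfold Near; omega
  have hxv : Anc x v := anc_of_half hv
  have hmv : μ.num 4 v = 0 := by
    obtain rfl | rfl : v = 2 * x ∨ v = 2 * x + 1 := by omega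
    exacts [hm₁, hm₂]
  have hlv : lab v = 0 := by rw [← h.lab_eq (by omega), hmv]
  set lab' := Function.update (Function.update lab x 0) v a with hlab'
  have hlz : ∀ y, y ≠ x → y ≠ v → lab' y = lab y := fun y hy hy' => by
    rw [hlab', Function.update_of_ne hy', Function.update_of_ne hy]
  have hlx' : lab' x = 0 := by rw [hlab', Function.update_of_ne hvx.symm, Function.update_self]
  have hlv' : lab' v = a := by rw [hlab', Function.update_self]
  have hlz' : ∀ y, lab' y ≠ 0 → y ≠ v → y ≠ x ∧ lab y ≠ 0 := by
    intro y hy hyv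
    have : y ≠ x := by rintro rfl; exact hy hlx'
    exact ⟨this, by rwa [hlz y this hyv] at hy⟩
  have hlo : κ v < κ x := by rwa [(hw v hnv).1, (hw x (.inl rfl)).1]
  have hpot := potential_swap (N := N) (κ := κ) (lab := lab) (a := a) (by omega) hv hvN hlo
    (by omega) hlv
  rw [← hlab'] at hpot
  have hpot' := Nat.mul_le_mul_left c hpot
  rw [mul_add, mul_one] at hpot'
  have hp := h.pot
  have hD : ∀ y, y ≠ v → (μ.setNum 4 v a).num 4 y = μ.num 4 y := fun y hy => μ.setNum_ne hy _
  have hDv := μ.setNum_same 4 v a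
  have hκ : ∀ y, y ≠ x → y ≠ v → (κ ∘ Equiv.swap x v) y = κ y := fun y hy hy' => by
    rw [Function.comp, Equiv.swap_apply_of_ne_of_ne hy hy']
  have hxI : x ∈ Finset.Icc 1 N := by simp; omega
  have hvI : v ∈ Finset.Icc 1 N := by simp; omega
  -- The labels above a node in terms of the old ones.
  have hup : ∀ y z, Anc y z → lab' y ≠ 0 → ∃ y', Anc y' z ∧ lab y' = lab' y ∧ lab y' ≠ 0 ∧
      (y' = y ∧ y ≠ x ∧ y ≠ v ∨ y = v ∧ y' = x) := by
    intro y z hyz hy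
    by_cases hyv : y = v
    · subst hyv; exact ⟨x, hxv.trans hyz, by rw [hlx, hlv'], by omega, .inr ⟨rfl, rfl⟩⟩
    · obtain ⟨hyx, hy'⟩ := hlz' y hy hyv
      exact ⟨y, hyz, (hlz y hyx hyv).symm, hy', .inl ⟨rfl, hyx, hyv⟩⟩
  refine ⟨by omega, { h with
    num_eq := fun b hb => ?_, blank := ?_, keys := ?_,
    order := fun y w hy hy1 hyw hwN => ?_, lab_le := fun y hy => ?_,
    lab_lt := fun y z hyz hyz' hy hz => ?_, mark := fun y => ?_, uniq := ?_, phys := fun u => ?_,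
    ok := fun σ hσ => ?_, resp := fun y hy => ?_, pot := by omega }⟩
  · rw [Mem.setNum_array_ne _ hb, h.num_eq b hb]
  · rw [hκ _ (by omega) (by omega), h.blank]
  · rw [map_swap_keys κ hxI hvI, h.keys]
  -- The child now carries the wave, so nothing need be shown about its order; the key that moved to
  -- `x` is the minimum of the subtree of `x`.
  · have hyv : y ≠ v := by rintro rfl; omega
    by_cases hyx : y = x
    · subst hyx
      have hl₁ := h.lab_eq (x := 2 * y) (by omega)
      have hl₂ := h.lab_eq (x := 2 * y + 1) (by omega)
      rw [Function.comp, Equiv.swap_apply_left, (hw v hnv).1]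
      have hsub : ∀ w, Anc y w → w ≤ N → lo v ≤ κ w := by
        intro w hyw hwN
        by_cases hyw' : y = w
        · rw [← hyw', (hw y (.inl rfl)).1]; exact hlt.le
        obtain h' | h' := hyw.child hyw'
        · refine (h₁ (h'.le.trans hwN)).trans ?_
          rw [← (hw (2 * y) (.inr (.inl rfl))).1]
          exact h.order _ _ (by omega) (by omega) h' hwN
        · refine (h₂ (h'.le.trans hwN)).trans ?_
          rw [← (hw (2 * y + 1) (.inr (.inr rfl))).1]
          exact h.order _ _ (by omega) (by omega) h' hwN
      refine hsub _ (anc_swap hv hyv hyw) ?_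
      have := mem_Icc_swap hxI hvI (w := w) (Finset.mem_Icc.2 ⟨hy1.trans hyw.le, hwN⟩)
      exact (Finset.mem_Icc.1 this).2
    · rw [hκ y hyx hyv]
      refine h.order y _ (by rwa [hlz y hyx hyv] at hy) hy1 (anc_swap hv hyv hyw) ?_
      have := mem_Icc_swap hxI hvI (w := w) (Finset.mem_Icc.2 ⟨hy1.trans hyw.le, hwN⟩)
      exact (Finset.mem_Icc.1 this).2
  · by_cases hyv : y = v
    · subst hyv; rw [hlv']; omega
    · obtain ⟨hyx, hy'⟩ := hlz' y hy hyv
      rw [hlz y hyx hyv]; exact h.lab_le y hy'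
  · obtain ⟨y', hy'z, e, hl, hy'⟩ := hup y z hyz hy
    rw [← e]
    by_cases hzv : z = v
    · subst hzv
      obtain ⟨rfl, hyx, hyv⟩ | ⟨rfl, -⟩ := hy'
      · rw [hlv', ← hlx]
        exact h.lab_lt y' x (hv ▸ hyz.half hyz') hyx hl (by omega)
      · exact absurd rfl hyz'
    · obtain ⟨hzx, hz'⟩ := hlz' z hz hzv
      rw [hlz z hzx hzv]
      refine h.lab_lt y' z hy'z ?_ hl hz'
      obtain ⟨rfl, -⟩ | ⟨-, rfl⟩ := hy'
      · exact hyz'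
      · exact hzx.symm
  · by_cases hyv : y = v
    · subst hyv; exact .inl (by rw [hDv, hlv'])
    by_cases hyx : y = x
    · subst hyx
      exact .inr ⟨by omega, by rw [hD _ hyv, hmx], _, Multiset.mem_cons_self _ _, rfl⟩
    rw [hlz y hyx hyv, hD y hyv]
    obtain h | ⟨h₁, h₂, σ, hσ, e⟩ := h.mark y
    · exact .inl h
    · obtain rfl | hσ := Multiset.mem_cons.1 hσ
      · cases e; exact absurd rfl hyx
      · exact .inr ⟨h₁, h₂, σ, Multiset.mem_cons_of_mem (Multiset.mem_cons_of_mem hσ), e⟩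
  · have := h.uniq
    rw [owners_cons_own] at this
    rwa [owners_cons_rel, owners_cons_none rfl]
  · rw [Mem.setNum_key]
    by_cases hu : Near x u
    · left
      rw [(hw u hu).2, hph u hu, Function.comp]
      refine ((hw _ ?_).1).symm
      by_cases h₁ : u = x
      · rw [h₁, Equiv.swap_apply_left]; exact hnv
      by_cases h₂ : u = v
      · rw [h₂, Equiv.swap_apply_right]; exact .inl rfl
      rwa [Equiv.swap_apply_of_ne_of_ne h₁ h₂]
    · rw [hκ u (by rintro rfl; exact hu (.inl rfl)) (by rintro rfl; exact hu hnv)]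
      obtain h' | ⟨x', a', lo', ph', hσ, e⟩ := h.phys u
      · exact .inl h'
      · obtain hσ | hσ := Multiset.mem_cons.1 hσ
        · cases hσ; exact absurd e hu
        · exact .inr ⟨x', a', lo', ph',
            Multiset.mem_cons_of_mem (Multiset.mem_cons_of_mem hσ), e⟩
  -- The wave has left `x`, so all labels above the child are those above `x`, of level below `log
  -- a`. This is what bounds the next checks of the parent and of the child.
  · have hvlab : ∀ y, Anc y x → lab' y ≠ 0 → Nat.log 2 (lab' y) < Nat.log 2 a := by
      intro y hyx hy
      have hyv : y ≠ v := by rintro rfl; have := hyx.le; omega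
      obtain ⟨hne, hy'⟩ := hlz' y hy hyv
      rw [hlz y hne hyv, ← hlx]
      exact h.lab_lt y x hyx hne hy' (by omega)
    obtain rfl | hσ := Multiset.mem_cons.1 hσ
    · exact ⟨hx0, hlx', by rw [hD _ hvx.symm, hmx], hvlab⟩
    obtain rfl | hσ := Multiset.mem_cons.1 hσ
    · intro y hyv hy
      by_cases hyv' : y = v
      · subst hyv'; rw [hlv']; omega
      · have := hvlab y (hv ▸ hyv.half hyv') hy
        omega
    have hok := h.ok σ (Multiset.mem_cons_of_mem hσ)
    have hσx := hne σ hσ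
    cases σ with
    | own x' a' lo' ph' =>
      obtain ⟨g₁, g₂, g₃, g₄, g₅, g₆, g₇, g₈⟩ := hok
      have hx' : x' ≠ x := by rintro rfl; exact hσx rfl
      have hx'v : x' ≠ v := by rintro rfl; omega
      refine ⟨g₁, g₂, g₃, by rwa [hlz _ hx' hx'v], by rwa [hD _ hx'v], by rwa [hD _ (by omega)],
        by rwa [hD _ (by omega)], fun w hw' => ?_⟩
      have hwx : ¬ Near x w := fun hxw => near_disjoint (μ := μ) (x := x) (x' := x') (by omega)
        (by omega) hx'.symm hm₁ hm₂ g₆ g₇ hxw hw'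
      rw [hκ w (by rintro rfl; exact hwx (.inl rfl)) (by rintro rfl; exact hwx hnv)]
      exact g₈ w hw'
    | rel x' e' =>
      obtain ⟨g₁, g₂, g₃, g₄⟩ := hok
      have hx' : x' ≠ x := by rintro rfl; exact hσx rfl
      have hx'v : x' ≠ v := by rintro rfl; omega
      refine ⟨g₁, by rwa [hlz _ hx' hx'v], by rwa [hD _ hx'v], fun y hyx hy => ?_⟩
      obtain ⟨y', hy', e, hl, -⟩ := hup y x' hyx hy
      rw [← e]; exact g₄ y' hy' hl
    | chk x' e' =>
      intro y hyx hy
      obtain ⟨y', hy', e, hl, -⟩ := hup y x' hyx hy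
      rw [← e]; exact hok y' hy' hl
    | rd x' d b =>
      intro y hyx hy
      obtain ⟨y', hy', e, hl, hcase⟩ := hup y x' hyx hy
      rw [← e]
      refine (hok y' hy' hl).imp_right ?_
      rintro ⟨rfl, g₂, g₃⟩
      obtain ⟨rfl, hyx', hyv⟩ | ⟨rfl, rfl⟩ := hcase
      · exact ⟨rfl, fun hb => by rw [hD _ (by omega), g₂ hb],
          fun hb => by rw [hD _ (by omega), g₃ hb]⟩
      -- The wave that went from `x` to `v` is not above `x` any more, so a thread that has read `x`
      -- need not account for it.
      · have := hyx.le; omega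
  · by_cases hyv : y = v
    · subst hyv
      exact ⟨_, Multiset.mem_cons_of_mem (Multiset.mem_cons_self _ _), .inl ⟨_, rfl⟩⟩
    obtain ⟨g₁, g₂, g₃, g₄⟩ := hy
    rw [hD _ hyv] at g₁ g₂
    have hyx : y ≠ x := by rintro rfl; omega
    rw [hD _ (by omega)] at g₃ g₄
    obtain ⟨σ, hσ, hr⟩ := h.resp y ⟨g₁, g₂, g₃, g₄⟩
    obtain rfl | hσ := Multiset.mem_cons.1 hσ
    · obtain ⟨e', h⟩ | ⟨b, h⟩ := hr <;> cases h
    · refine ⟨σ, Multiset.mem_cons_of_mem (Multiset.mem_cons_of_mem hσ), ?_⟩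
      unfold Tok.Resp at hr ⊢
      rwa [hD _ hyv]

end Sift

end ParHeap

namespace ParHeap

open Instr

/-! ### Running time of the checks -/

section Sift

variable {K : Type u}

/-- The registers of the threads that work on node `x`. -/
structure NodeRegs (N x : ℕ) (ρ : Frame K) : Prop where
  size : ρ.num 3 = N
  one : ρ.num 10 = 1
  zero : ρ.num 11 = 0
  node : ρ.num 12 = x

variable {N s tB T : ℕ} {μ₀ : Mem K} {ρ : Frame K} {t : ℕ}

theorem NodeRegs.setNum {x : ℕ} (h : NodeRegs N x ρ) {r : ℕ} (hr : r ≠ 3 ∧ r ≠ 10 ∧ r ≠ 11 ∧ r ≠ 12)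
    (v : ℕ) : NodeRegs N x (ρ.setNum r v) :=
  ⟨by rw [ρ.setNum_of_ne (by omega), h.size], by rw [ρ.setNum_of_ne (by omega), h.one],
    by rw [ρ.setNum_of_ne (by omega), h.zero], by rw [ρ.setNum_of_ne (by omega), h.node]⟩

theorem NodeRegs.setKey {x : ℕ} (h : NodeRegs N x ρ) (r : ℕ) (v : WithTop K) :
    NodeRegs N x (ρ.setKey r v) := ⟨h.size, h.one, h.zero, h.node⟩

theorem NodeRegs.move {x : ℕ} (h : NodeRegs N x ρ) (v : ℕ) : NodeRegs N v (ρ.setNum 12 v) :=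
  ⟨by rw [ρ.setNum_of_ne (by omega), h.size], by rw [ρ.setNum_of_ne (by omega), h.one],
    by rw [ρ.setNum_of_ne (by omega), h.zero], by rw [ρ.setNum_self]⟩

variable [LinearOrder K]

/-- The invariant with hidden logical keys and labels. -/
def SiftI (N : ℕ) (μ₀ : Mem K) (p : ℕ) (μ : Mem K) (g : Multiset (Tok K)) : Prop :=
  ∃ κ lab, SiftInv N 300 μ₀ κ lab p μ g

/-- Specification of a call of `checkProc` that starts no later than `tB + 100 * s` and ends no
later than `T`. -/
def CheckSpec (N : ℕ) (μ₀ : Mem K) (tB s T : ℕ) : Prop :=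
  ∀ x e (ρ : Frame K) t, NodeRegs N x ρ → s + 2 * e ≤ 2 * (Nat.log 2 N + 1) + Nat.log 2 x →
    t ≤ tB + 100 * s → WP updateProcs (SiftI N μ₀) (fun g _ _ t' => g = 0 ∧ t' ≤ T) {.chk x e} 105
      (.exec (.call 10) ρ t)

theorem log_half (x : ℕ) : Nat.log 2 x ≤ Nat.log 2 (x / 2) + 1 := by
  rw [Nat.log_div_base]; omega

/-- Check the parent of `x`. -/
theorem checkParent_wp (hS : CheckSpec N μ₀ tB (s + 1) T) {x l : ℕ} (hρ : NodeRegs N x ρ)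
    (hs : s + 2 * l + 2 ≤ 2 * (Nat.log 2 N + 1) + Nat.log 2 x) (ht : t + 3 ≤ tB + 100 * (s + 1)) :
    WP updateProcs (SiftI N μ₀) (fun g _ _ t' => g = 0 ∧ t' ≤ T) {.chk (x / 2) l} 108
      (.exec (half 12 12 ;; .call 10) ρ t) := by
  refine WP.exec_local_seq (i := half 12 12) trivial fun μ => ?_
  simp only [Instr.run]
  rw [hρ.node]
  have := log_half x
  exact hS _ _ _ _ (hρ.move _) (by omega) ht

/-- The potential drops by one when the wave ends, which frees 300 credits for checking the parent.
Logically the wave ends at the same instruction that removes the mark. -/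
theorem settleCmd_wp (hS : CheckSpec N μ₀ tB (s + 1) T) {x a : ℕ} {lo : ℕ → WithTop K}
    (hρ : NodeRegs N x ρ) (hs : s + 2 * Nat.log 2 a + 2 ≤ 2 * (Nat.log 2 N + 1) + Nat.log 2 x)
    (h₁ : 2 * x ≤ N → lo x ≤ lo (2 * x)) (h₂ : 2 * x + 1 ≤ N → lo x ≤ lo (2 * x + 1))
    (ht : t + 6 ≤ tB + 100 * (s + 1)) :
    WP updateProcs (SiftI N μ₀) (fun g _ _ t' => g = 0 ∧ t' ≤ T) {.own x a lo lo} 10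
      (.exec settleCmd ρ t) := by
  refine WP.exec_instr_seq (i := store 4 12 11) (k := 9) fun μ f p hI => ?_
  obtain ⟨κ, lab, hI⟩ := hI
  rw [Multiset.singleton_add] at hI
  obtain ⟨hp, hI'⟩ := hI.settle h₁ h₂
  refine ⟨{.chk (x / 2) (Nat.log 2 a)}, p - 300, 109, by omega, ⟨κ, Function.update lab x 0, ?_⟩, 108, rfl,
    checkParent_wp hS hρ hs (by omega)⟩
  rw [Multiset.singleton_add]
  simp only [Instr.run]
  rw [hρ.node, hρ.zero]
  exact hI'.release

/-- The order of the writes matters. The keys change while `x` is claimed, so nobody else uses them.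
The child is marked before `x` is released, so a wave that arrives at `x` later finds the child
occupied. Logically the whole exchange happens when the child is marked. -/
theorem swapCmd_wp (hS : CheckSpec N μ₀ tB (s + 1) T) {x a v cr kr : ℕ} {lo : ℕ → WithTop K}
    (hρ : NodeRegs N x ρ) (hs : s + 2 * Nat.log 2 a + 2 ≤ 2 * (Nat.log 2 N + 1) + Nat.log 2 x)
    (hv : v / 2 = x) (hx0 : x ≠ 0) (hvN : v ≤ N) (hlt : lo v < lo x)
    (h₁ : 2 * x ≤ N → lo v ≤ lo (2 * x)) (h₂ : 2 * x + 1 ≤ N → lo v ≤ lo (2 * x + 1))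
    (hcr : ρ.num cr = v) (hkr : ρ.key kr = lo v) (hk1 : ρ.key 1 = lo x) (ha : ρ.num 13 = a)
    (ht : t + 20 ≤ tB + 100 * (s + 1)) :
    WP updateProcs (SiftI N μ₀) (fun g _ _ t' => g = 0 ∧ t' ≤ T + 1) {.own x a lo lo} 20
      (.exec (swapCmd cr kr) ρ t) := by
  have hnv : Near x v := by unfold Near; omega
  refine WP.exec_instr_seq (i := keyStore 0 12 kr) (k := 19) fun μ f p hI => ?_
  obtain ⟨κ, lab, hI⟩ := hI
  rw [Multiset.singleton_add] at hI
  refine ⟨{.own x a lo (Function.update lo x (lo v))}, p, 18, by omega, ⟨κ, lab, ?_⟩, 17, rfl, ?_⟩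
  · rw [Multiset.singleton_add]
    simp only [Instr.run]
    rw [hρ.node, hkr]
    exact hI.write (.inl rfl) _
  clear hI
  refine WP.exec_instr_seq (i := keyStore 0 cr 1) (k := 16) fun μ f p hI => ?_
  obtain ⟨κ, lab, hI⟩ := hI
  rw [Multiset.singleton_add] at hI
  refine ⟨{.own x a lo (Function.update (Function.update lo x (lo v)) v (lo x))}, p, 15, by omega,
    ⟨κ, lab, ?_⟩, 14, rfl, ?_⟩
  · rw [Multiset.singleton_add]
    simp only [Instr.run]
    rw [hcr, hk1]
    exact hI.write hnv _
  clear hI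
  refine WP.exec_instr_seq (i := store 4 cr 13) (k := 13) fun μ f p hI => ?_
  obtain ⟨κ, lab, hI⟩ := hI
  rw [Multiset.singleton_add] at hI
  obtain ⟨hp, hI'⟩ := hI.advance hv hvN hlt h₁ h₂ fun w hw => by
    by_cases hwv : w = v
    · subst hwv; rw [Function.update_self, Equiv.swap_apply_right]
    by_cases hwx : w = x
    · subst hwx; rw [Function.update_of_ne hwv, Function.update_self, Equiv.swap_apply_left]
    rw [Function.update_of_ne hwv, Function.update_of_ne hwx,
      Equiv.swap_apply_of_ne_of_ne hwx hwv]
  -- The drop of the potential frees 300 credits, enough for the release, the fork and both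
  -- follow-up checks.
  refine ⟨{.rel x (Nat.log 2 a)} + {.chk v (Nat.log 2 a + 1)}, p - 300, 312, by omega,
    ⟨κ ∘ Equiv.swap x v, Function.update (Function.update lab x 0) v a, ?_⟩, 311, rfl, ?_⟩
  · rw [add_assoc, Multiset.singleton_add, Multiset.singleton_add]
    simp only [Instr.run]
    rw [hcr, ha]
    exact hI'
  clear hI hI'
  refine WP.exec_instr_seq (i := store 4 12 11) (k := 310) fun μ f p hI => ?_
  obtain ⟨κ, lab, hI⟩ := hI
  rw [add_assoc, Multiset.singleton_add] at hI
  refine ⟨{.chk (x / 2) (Nat.log 2 a)} + {.chk v (Nat.log 2 a + 1)}, p, 308, by omega,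
    ⟨κ, lab, ?_⟩, 307, rfl, ?_⟩
  · rw [add_assoc, Multiset.singleton_add]
    simp only [Instr.run]
    rw [hρ.node, hρ.zero]
    exact hI.release
  simp only [Instr.run]
  refine (WP.exec_par (k := 10) (k₁ := 108) (k₂ := 108)
    (Q₁ := fun g _ _ t' => g = 0 ∧ t' ≤ T) (Q₂ := fun g _ _ t' => g = 0 ∧ t' ≤ T) ?_ ?_ ?_).mono
    (by omega) fun _ _ _ _ h => h
  · exact checkParent_wp hS hρ hs (by omega)
  · refine WP.exec_local_seq (i := add 12 cr 11) trivial fun μ => ?_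
    simp only [Instr.run]
    rw [hρ.zero, hcr, add_zero]
    have := log_child (by omega) hv
    exact hS _ _ _ _ (hρ.move _) (by omega) (by omega)
  · rintro g₁ j₁ ρ₁ t₁ g₂ j₂ ρ₂ t₂ ⟨rfl, hh₁⟩ ⟨rfl, hh₂⟩
    exact ⟨0, by omega, by simp, by omega⟩

/-- The owner reads a key. -/
theorem keyLoad_wp {x a w r sr k : ℕ} {lo : ℕ → WithTop K} {d : Cmd} {Q : GPost K (Multiset (Tok K))}
    (hw : Near x w) (hsr : ρ.num sr = w)
    (h : (w = N + 1 → lo w = ⊤) → WP updateProcs (SiftI N μ₀) Q {.own x a lo lo} k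
      (.exec d (ρ.setKey r (lo w)) (t + 3))) :
    WP updateProcs (SiftI N μ₀) Q {.own x a lo lo} (k + 3)
      (.exec (keyLoad r 0 sr ;; d) ρ t) := by
  refine WP.exec_instr_seq (i := keyLoad r 0 sr) (k := k + 2) fun μ f p hI => ?_
  refine ⟨{.own x a lo lo}, p, k + 1, by omega, hI, k, rfl, ?_⟩
  obtain ⟨κ, lab, hI⟩ := hI
  rw [Multiset.singleton_add] at hI
  obtain ⟨-, -, -, -, -, -, -, hk⟩ := hI.ok _ (Multiset.mem_cons_self _ _)
  simp only [Instr.run]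
  rw [hsr, (hk w hw).2]
  refine h ?_
  rintro rfl
  rw [← (hk _ hw).1, hI.blank]

theorem siftCmd_wp (hS : CheckSpec N μ₀ tB (s + 1) T) {x a : ℕ} {lo : ℕ → WithTop K}
    (hρ : NodeRegs N x ρ) (hs : s + 2 * Nat.log 2 a + 2 ≤ 2 * (Nat.log 2 N + 1) + Nat.log 2 x)
    (hx0 : x ≠ 0) (h14 : ρ.num 14 = 2 * x) (h16 : ρ.num 16 = 2 * x + 1) (ha : ρ.num 13 = a)
    (ht : t + 40 ≤ tB + 100 * (s + 1)) :
    WP updateProcs (SiftI N μ₀) (fun g _ _ t' => g = 0 ∧ t' ≤ T + 1) {.own x a lo lo} 40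
      (.exec siftCmd ρ t) := by
  refine WP.exec_ite (fun hb => ?_) fun hb => ?_
  · simp only [Test.Holds, hρ.size, h14] at hb
    exact (settleCmd_wp hS hρ hs (by omega) (by omega) (by omega)).mono (by omega)
      fun _ _ _ _ h => ⟨h.1, by omega⟩
  simp only [Test.Holds, hρ.size, h14, not_lt] at hb
  refine keyLoad_wp (w := x) (k := 36) (.inl rfl) hρ.node fun _ => ?_
  refine keyLoad_wp (w := 2 * x) (k := 33) (.inr (.inl rfl)) h14 fun _ => ?_
  refine keyLoad_wp (w := 2 * x + 1) (k := 30) (.inr (.inr rfl)) h16 fun hblank => ?_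
  set ρ' := ((ρ.setKey 1 (lo x)).setKey 2 (lo (2 * x))).setKey 3 (lo (2 * x + 1)) with hρ'
  have k1 : ρ'.key 1 = lo x := by simp [hρ', Frame.setKey]
  have k2 : ρ'.key 2 = lo (2 * x) := by simp [hρ', Frame.setKey]
  have k3 : ρ'.key 3 = lo (2 * x + 1) := by simp [hρ', Frame.setKey]
  have hr : NodeRegs N x ρ' := ((hρ.setKey _ _).setKey _ _).setKey _ _
  refine WP.exec_ite (k := 29) (fun hb₁ => ?_) fun hb₁ => ?_
  · simp only [Test.Holds, k2, k3] at hb₁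
    refine WP.exec_ite (k := 28) (fun hb₂ => ?_) fun hb₂ => ?_
    · simp only [Test.Holds, k1, k3] at hb₂
      refine (swapCmd_wp (v := 2 * x + 1) hS hr hs (by omega) hx0 ?_ hb₂ (fun _ => hb₁.le)
        (fun _ => le_rfl) h16 k3 k1 ha (by omega)).mono (by omega) fun _ _ _ _ h => h
      -- A right child beyond the last node can only be node `N + 1`, whose blank key is not smaller
      -- than anything.
      by_contra hN
      rw [hblank (by omega)] at hb₂
      exact absurd hb₂ not_top_lt
    · simp only [Test.Holds, k1, k3, not_lt] at hb₂
      exact (settleCmd_wp hS hr hs (fun _ => hb₂.trans hb₁.le) (fun _ => hb₂) (by omega)).mono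
        (by omega) fun _ _ _ _ h => ⟨h.1, by omega⟩
  · simp only [Test.Holds, k2, k3, not_lt] at hb₁
    refine WP.exec_ite (k := 28) (fun hb₂ => ?_) fun hb₂ => ?_
    · simp only [Test.Holds, k1, k2] at hb₂
      exact (swapCmd_wp (v := 2 * x) hS hr hs (by omega) hx0 hb hb₂ (fun _ => le_rfl)
        (fun _ => hb₁) h14 k2 k1 ha (by omega)).mono (by omega) fun _ _ _ _ h => h
    · simp only [Test.Holds, k1, k2, not_lt] at hb₂
      exact (settleCmd_wp hS hr hs (fun _ => hb₂) (fun _ => hb₂.trans hb₁) (by omega)).mono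
        (by omega) fun _ _ _ _ h => ⟨h.1, by omega⟩

/-- A thread that owns nothing stops. -/
theorem skip_wp {G : Type*} [AddCommMonoid G] {I : ℕ → Mem K → G → Prop} {procs : List Cmd}
    (ht : t + 1 ≤ T) (k : ℕ) :
    WP procs I (fun g _ _ t' => g = 0 ∧ t' ≤ T) 0 (k + 1) (.exec skip ρ t) :=
  WP.exec_instr fun μ f p hI => ⟨0, p, k, by omega, hI, rfl, by simpa using ht⟩

/-- The specification of follow-up checks is needed only if a wave is claimed, and this forces `s ≤
3 * Nat.log 2 N`. Hence the recursion over `s` ends. The 60 units of time cover every path on which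
the thread gives up. -/
theorem checkProc_wp (hS : s ≤ 3 * Nat.log 2 N → CheckSpec N μ₀ tB (s + 1) T) {x e : ℕ}
    (hρ : NodeRegs N x ρ) (hs : s + 2 * e ≤ 2 * (Nat.log 2 N + 1) + Nat.log 2 x)
    (ht : t ≤ tB + 100 * s + 1) (hT : tB + 100 * s + 60 ≤ T) :
    WP updateProcs (SiftI N μ₀) (fun g _ _ t' => g = 0 ∧ t' ≤ T + 1) {.chk x e} 103
      (.exec checkProc ρ t) := by
  refine WP.exec_instr_seq (i := load 13 4 12) (k := 102) fun μ f p hI => ?_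
  obtain ⟨κ, lab, hI⟩ := hI
  rw [Multiset.singleton_add] at hI
  simp only [Instr.run]
  rw [hρ.node]
  set d := μ.num 4 x with hd
  set ρ₁ := ρ.setNum 13 d with hρ₁
  have hr₁ : NodeRegs N x ρ₁ := hρ.setNum (by omega) _
  have h13 : ρ₁.num 13 = d := ρ.setNum_self _ _
  by_cases hd0 : 0 < d
  swap
  · refine ⟨0, p, 100, by omega, ⟨κ, lab, by simpa using hI.drop_chk (.inl (by omega))⟩, 99, rfl, ?_⟩
    refine WP.exec_ite (k := 98) (fun hb => ?_) fun _ => skip_wp (by omega) _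
    simp only [Test.Holds, hr₁.zero, h13] at hb; omega
  by_cases hdx : d ≤ x
  swap
  · refine ⟨0, p, 100, by omega, ⟨κ, lab, by simpa using hI.drop_chk (.inr (by omega))⟩, 99, rfl, ?_⟩
    refine WP.exec_ite (k := 98) (fun _ => ?_) fun _ => skip_wp (by omega) _
    refine WP.exec_ite (k := 97) (fun hb => skip_wp (by omega) _) fun hb => ?_
    simp only [Test.Holds, hr₁.node, h13] at hb; omega
  obtain ⟨hde, hxN, hI'⟩ := hI.read hd0 hdx
  rw [← hd] at hde
  have hxl : Nat.log 2 x ≤ Nat.log 2 N := Nat.log_mono_right hxN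
  -- A label `d` has been seen with `log d < e`, so `e` is positive; with `x ≤ N` the inequality
  -- `hs` bounds `s`.
  replace hS := hS (by omega)
  refine ⟨{.rd x d 0}, p, 100, by omega, ⟨κ, lab, by simpa using hI'⟩, 99, rfl, ?_⟩
  clear hI hI'
  clear_value d
  refine WP.exec_ite (k := 98) (fun _ => ?_) fun hb => ?_
  swap
  · simp only [Test.Holds, hr₁.zero, h13] at hb; omega
  refine WP.exec_ite (k := 97) (fun hb => ?_) fun _ => ?_
  · simp only [Test.Holds, hr₁.node, h13] at hb; omega
  refine WP.exec_local_seq (i := add 14 12 12) (k := 94) trivial fun _ => ?_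
  simp only [Instr.run]
  rw [hr₁.node, ← two_mul]
  set ρ₂ := ρ₁.setNum 14 (2 * x) with hρ₂
  have hr₂ : NodeRegs N x ρ₂ := hr₁.setNum (by omega) _
  have h14 : ρ₂.num 14 = 2 * x := ρ₁.setNum_self _ _
  refine WP.exec_instr_seq (i := load 15 4 14) (k := 93) fun μ f p hI => ?_
  obtain ⟨κ, lab, hI⟩ := hI
  rw [Multiset.singleton_add] at hI
  simp only [Instr.run]
  rw [h14]
  have hr₃ : NodeRegs N x (ρ₂.setNum 15 (μ.num 4 (2 * x))) := hr₂.setNum (by omega) _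
  have h15 : (ρ₂.setNum 15 (μ.num 4 (2 * x))).num 15 = μ.num 4 (2 * x) := ρ₂.setNum_self _ _
  by_cases h1 : 0 < μ.num 4 (2 * x)
  · refine ⟨0, p, 91, by omega, ⟨κ, lab, by simpa using hI.drop_rd (.inr (.inl h1.ne'))⟩, 90, rfl,
      ?_⟩
    refine WP.exec_ite (k := 89) (fun _ => skip_wp (by omega) _) fun hb => ?_
    simp only [Test.Holds, hr₃.zero, h15] at hb; omega
  refine ⟨{.rd x d 1}, p, 91, by omega, ⟨κ, lab, by
    simpa using hI.see (b' := 1) (fun _ => .inr (by omega)) (by omega)⟩, 90, rfl, ?_⟩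
  refine WP.exec_ite (k := 89) (fun hb => ?_) fun _ => ?_
  · simp only [Test.Holds, hr₃.zero, h15] at hb; omega
  refine WP.exec_local_seq (i := add 16 14 10) (k := 86) trivial fun _ => ?_
  simp only [Instr.run]
  rw [hr₃.one, Frame.setNum_of_ne _ (by norm_num), h14]
  clear hI
  set ρ₃ := ρ₂.setNum 15 (μ.num 4 (2 * x)) with hρ₃
  set ρ₄ := ρ₃.setNum 16 (2 * x + 1) with hρ₄
  have hr₄ : NodeRegs N x ρ₄ := hr₃.setNum (by omega) _
  have h16 : ρ₄.num 16 = 2 * x + 1 := ρ₃.setNum_self _ _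
  clear h15 h1
  refine WP.exec_instr_seq (i := load 15 4 16) (k := 85) fun μ' f p hI => ?_
  obtain ⟨κ, lab, hI⟩ := hI
  rw [Multiset.singleton_add] at hI
  simp only [Instr.run]
  rw [h16]
  set ρ₅ := ρ₄.setNum 15 (μ'.num 4 (2 * x + 1)) with hρ₅
  have hr₅ : NodeRegs N x ρ₅ := hr₄.setNum (by omega) _
  have h15 : ρ₅.num 15 = μ'.num 4 (2 * x + 1) := ρ₄.setNum_self _ _
  by_cases h1 : 0 < μ'.num 4 (2 * x + 1)
  · refine ⟨0, p, 83, by omega, ⟨κ, lab, by simpa using hI.drop_rd (.inr (.inr h1.ne'))⟩, 82, rfl,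
      ?_⟩
    refine WP.exec_ite (k := 81) (fun _ => skip_wp (by omega) _) fun hb => ?_
    simp only [Test.Holds, hr₅.zero, h15] at hb; omega
  refine ⟨{.rd x d 2}, p, 83, by omega, ⟨κ, lab, by
    simpa using hI.see (b' := 2) (fun _ => .inl le_rfl) (fun _ => .inr (by omega))⟩, 82, rfl, ?_⟩
  refine WP.exec_ite (k := 81) (fun hb => ?_) fun _ => ?_
  · simp only [Test.Holds, hr₅.zero, h15] at hb; omega
  clear hI
  have g13 : ρ₅.num 13 = d := by
    rw [hρ₅, Frame.setNum_of_ne _ (by norm_num), hρ₄, Frame.setNum_of_ne _ (by norm_num), hρ₃,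
      Frame.setNum_of_ne _ (by norm_num), hρ₂, Frame.setNum_of_ne _ (by norm_num), h13]
  have g14 : ρ₅.num 14 = 2 * x := by
    rw [hρ₅, Frame.setNum_of_ne _ (by norm_num), hρ₄, Frame.setNum_of_ne _ (by norm_num), hρ₃,
      Frame.setNum_of_ne _ (by norm_num), h14]
  have g16 : ρ₅.num 16 = 2 * x + 1 := by
    rw [hρ₅, Frame.setNum_of_ne _ (by norm_num), h16]
  clear_value ρ₅
  refine WP.exec_instr_seq (i := cas 15 4 12 13 14) (k := 80) fun μ' f p hI => ?_
  obtain ⟨κ, lab, hI⟩ := hI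
  rw [Multiset.singleton_add] at hI
  simp only [Instr.run]
  rw [hr₅.node, g13, g14]
  by_cases hc : μ'.num 4 x = d
  · rw [if_pos hc]
    refine ⟨{.own x d κ κ}, p, 78, by omega, ⟨κ, lab, by
      simpa using (hI.claim hd0 hdx hc).2⟩, 77, rfl, ?_⟩
    refine WP.exec_ite (k := 76) (fun _ => ?_) fun hb => ?_
    · refine (siftCmd_wp hS (hr₅.setNum (by omega) _) (by omega) (by omega) ?_ ?_ ?_
        (by omega)).mono (by omega) fun _ _ _ _ h => h
      · rw [Frame.setNum_of_ne _ (by norm_num), g14]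
      · rw [Frame.setNum_of_ne _ (by norm_num), g16]
      · rw [Frame.setNum_of_ne _ (by norm_num), g13]
    · simp only [Test.Holds, Frame.setNum_self] at hb
      rw [Frame.setNum_of_ne _ (by norm_num), hr₅.zero] at hb; omega
  · rw [if_neg hc]
    refine ⟨0, p, 78, by omega, ⟨κ, lab, by simpa using hI.drop_rd (.inl (Ne.symm hc))⟩, 77, rfl,
      ?_⟩
    refine WP.exec_ite (k := 76) (fun hb => ?_) fun _ => skip_wp (by omega) _
    simp only [Test.Holds, Frame.setNum_self] at hb
    rw [Frame.setNum_of_ne _ (by norm_num), hr₅.zero] at hb; omega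

/-- Downward induction on `s`. Each round may start 100 units later than the preceding one; on the
way back a call and possibly a join add 2 to the end, which accounts for `2 * j`. -/
theorem checkSpec_of_le (N : ℕ) (μ₀ : Mem K) (tB j s : ℕ) (hj : s + j = 3 * Nat.log 2 N + 1) :
    CheckSpec N μ₀ tB s (tB + 100 * (3 * Nat.log 2 N + 1) + 2 * j + 62) := by
  have key : ∀ s T, (s ≤ 3 * Nat.log 2 N → CheckSpec N μ₀ tB (s + 1) T) →
      tB + 100 * s + 60 ≤ T → CheckSpec N μ₀ tB s (T + 2) := by
    intro s T hS hT x e ρ t hρ hs ht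
    refine WP.exec_call (k := 104) ((checkProc_wp hS hρ hs (by omega) hT).mono (by norm_num) ?_)
    exact fun g i ρ' t' h => ⟨i, rfl, h.1, by omega⟩
  induction j generalizing s with
  -- Here `s` exceeds `3 * Nat.log 2 N`, so no wave can be claimed and nothing is required of later
  -- checks.
  | zero => exact key _ _ (fun h => by omega) (by omega)
  | succ j ih => exact key _ _ (fun _ => ih (s + 1) (by omega)) (by omega)

/-- Every check ends in time. -/
theorem checkSpec (N : ℕ) (μ₀ : Mem K) (tB : ℕ) :
    CheckSpec N μ₀ tB 0 (tB + 306 * Nat.log 2 N + 164) := by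
  convert checkSpec_of_le N μ₀ tB (3 * Nat.log 2 N + 1) 0 (by omega) using 1
  omega

end Sift

end ParHeap

namespace ParHeap

open Instr

/-! ### Marking the nodes above the affected nodes -/

theorem Anc.log_lt {y x : ℕ} (h : Anc y x) (hne : y ≠ x) (hy : 0 < y) :
    Nat.log 2 y < Nat.log 2 x := by
  have h' := (h.half hne).le
  have := log_child (c := x) (x := x / 2) (by omega) rfl
  have := Nat.log_mono_right (b := 2) h'
  omega

open scoped Classical in
/-- The nodes above (or in) the set `S`. -/
noncomputable def upset (N : ℕ) (S : Finset ℕ) : Finset ℕ :=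
  (Finset.Icc 1 N).filter fun v => ∃ s ∈ S, Anc v s

theorem mem_upset {N : ℕ} {S : Finset ℕ} {v : ℕ} :
    v ∈ upset N S ↔ (1 ≤ v ∧ v ≤ N) ∧ ∃ s ∈ S, Anc v s := by
  simp [upset]

theorem subset_upset {N : ℕ} {S : Finset ℕ} (hS : S ⊆ Finset.Icc 1 N) : S ⊆ upset N S :=
  fun s hs => mem_upset.2 ⟨Finset.mem_Icc.1 (hS hs), s, hs, .refl s⟩

theorem half_mem_upset {N : ℕ} {S : Finset ℕ} {v : ℕ} (h : v ∈ upset N S) (hv : v / 2 ≠ 0) :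
    v / 2 ∈ upset N S := by
  obtain ⟨h₁, s, hs, ha⟩ := mem_upset.1 h
  exact mem_upset.2 ⟨by omega, s, hs, (anc_half v).trans ha⟩

section Mark

variable {K : Type u}

open scoped Classical in
/-- The invariant of the mark phase; `g` are the nodes that threads are about to mark. -/
structure MarkInv (N : ℕ) (S : Finset ℕ) (μ₀ : Mem K) (p : ℕ) (μ : Mem K) (g : Multiset ℕ) :
    Prop where
  num_eq : ∀ b, b ≠ 4 → μ.num b = μ₀.num b
  key_eq : μ.key = μ₀.key
  mark : ∀ v, μ.num 4 v = 0 ∨ μ.num 4 v = v ∧ v ∈ upset N S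
  up : ∀ v, μ.num 4 v ≠ 0 → v / 2 = 0 ∨ μ.num 4 (v / 2) ≠ 0 ∨ v / 2 ∈ g
  start : ∀ s ∈ S, s ≠ 0 → μ.num 4 s ≠ 0 ∨ s ∈ g
  tok : ∀ v ∈ g, v = 0 ∨ v ∈ upset N S
  pot : 20 * ((upset N S).filter fun v => μ.num 4 v = 0).card ≤ p

variable {N : ℕ} {S : Finset ℕ} {μ₀ μ : Mem K} {p : ℕ} {f : Multiset ℕ}

/-- A thread is owed only to an unmarked positive node, so a thread at `0` or at a marked node may
stop. -/
theorem MarkInv.drop {x : ℕ} (h : MarkInv N S μ₀ p μ (x ::ₘ f)) (hx : x = 0 ∨ μ.num 4 x ≠ 0) :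
    MarkInv N S μ₀ p μ f := by
  refine { h with
    up := fun v hv => ?_, start := fun s hs hs₀ => ?_,
    tok := fun v hv => h.tok v (Multiset.mem_cons_of_mem hv) }
  · obtain h' | h' | h' := h.up v hv
    · exact .inl h'
    · exact .inr (.inl h')
    · obtain h' | h' := Multiset.mem_cons.1 h'
      · rw [h']
        exact hx.imp_right .inl
      · exact .inr (.inr h')
  · obtain h' | h' := h.start s hs hs₀
    · exact .inl h'
    · obtain h' | h' := Multiset.mem_cons.1 h'
      · rw [h'] at hs₀ ⊢
        exact .inl (hx.resolve_left hs₀)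
      · exact .inr h'

/-- The duty to continue upwards passes to the parent, and one unmarked node fewer in the potential
pays 20 credits for the rest of this round and the next call. -/
theorem MarkInv.mark_node {x : ℕ} (h : MarkInv N S μ₀ p μ (x ::ₘ f)) (hx₀ : x ≠ 0)
    (hx : μ.num 4 x = 0) :
    20 ≤ p ∧ MarkInv N S μ₀ (p - 20) (μ.setNum 4 x x) (x / 2 ::ₘ f) := by
  classical
  have hxT : x ∈ upset N S := (h.tok x (Multiset.mem_cons_self _ _)).resolve_left hx₀
  have hne : ∀ v, v ≠ x → (μ.setNum 4 x x).num 4 v = μ.num 4 v := fun v hv => μ.setNum_ne hv _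
  have hself := μ.setNum_same 4 x x
  have hmono : ∀ v, μ.num 4 v ≠ 0 → (μ.setNum 4 x x).num 4 v ≠ 0 := fun v hv => by
    rw [hne v (by rintro rfl; exact hv hx)]; exact hv
  have hpot := h.pot
  have hcard : ((upset N S).filter fun v => (μ.setNum 4 x x).num 4 v = 0).card + 1 ≤
      ((upset N S).filter fun v => μ.num 4 v = 0).card := by
    rw [← Finset.card_insert_of_notMem (a := x) (by simp [hself, hx₀])]
    refine Finset.card_le_card fun v hv => ?_
    rw [Finset.mem_insert, Finset.mem_filter] at hv
    rw [Finset.mem_filter]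
    obtain rfl | ⟨h₁, h₂⟩ := hv
    · exact ⟨hxT, hx⟩
    · refine ⟨h₁, ?_⟩
      by_contra h₃
      exact hmono v h₃ h₂
  refine ⟨by omega, fun b hb => ?_, h.key_eq, fun v => ?_, fun v hv => ?_, fun s hs hs₀ => ?_,
    fun v hv => ?_, by omega⟩
  · rw [Mem.setNum_array_ne _ hb, h.num_eq b hb]
  · by_cases hv : v = x
    · subst hv; exact .inr ⟨hself, hxT⟩
    · rw [hne v hv]; exact h.mark v
  · by_cases hvx : v = x
    · subst hvx; exact .inr (.inr (Multiset.mem_cons_self _ _))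
    · rw [hne v hvx] at hv
      obtain h' | h' | h' := h.up v hv
      · exact .inl h'
      · exact .inr (.inl (hmono _ h'))
      · obtain h' | h' := Multiset.mem_cons.1 h'
        · rw [h', hself]; exact .inr (.inl hx₀)
        · exact .inr (.inr (Multiset.mem_cons_of_mem h'))
  · obtain h' | h' := h.start s hs hs₀
    · exact .inl (hmono _ h')
    · obtain h' | h' := Multiset.mem_cons.1 h'
      · rw [h', hself]; exact .inl hx₀
      · exact .inr (Multiset.mem_cons_of_mem h')
  · obtain rfl | hv := Multiset.mem_cons.1 hv
    · by_cases h0 : x / 2 = 0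
      · exact .inl h0
      · exact .inr (half_mem_upset hxT h0)
    · exact h.tok v (Multiset.mem_cons_of_mem hv)

/-- Without threads the marked set contains all affected nodes and is closed under taking parents,
so it is the whole upset. -/
theorem MarkInv.done (h : MarkInv N S μ₀ p μ 0) :
    (∀ b, b ≠ 4 → μ.num b = μ₀.num b) ∧ μ.key = μ₀.key ∧ (∀ v ∈ upset N S, μ.num 4 v = v) ∧
      ∀ v, v ∉ upset N S → μ.num 4 v = 0 := by
  refine ⟨h.num_eq, h.key_eq, fun v hv => ?_, fun v hv => (h.mark v).resolve_right fun h' => hv h'.2⟩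
  suffices hne : μ.num 4 v ≠ 0 from ((h.mark v).resolve_left hne).1
  obtain ⟨hv, s, hs, i, rfl⟩ := mem_upset.1 hv
  have key : ∀ i, s / 2 ^ i ≠ 0 → μ.num 4 (s / 2 ^ i) ≠ 0 := by
    intro i
    induction i with
    | zero =>
      intro h0
      simpa using h.start s hs (by simpa using h0)
    | succ i ih =>
      rw [pow_succ, ← Nat.div_div_eq_div_mul]
      intro h0
      obtain h' | h' | h' := h.up _ (ih (by omega))
      · exact absurd h' h0
      · exact h'
      · simp at h'
  exact key i (by omega)

variable [LinearOrder K] {ρ : Frame K}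

/-- The time uses `Nat.log 2 (2 * x)` rather than `Nat.log 2 x` so that the last move, from node `1`
to `0`, also lowers the logarithm. -/
theorem markProc_wp (x : ℕ) : ∀ (ρ : Frame K) t, ρ.num 11 = 0 → ρ.num 12 = x →
    WP updateProcs (MarkInv N S μ₀) (fun g _ _ t' => g = 0 ∧ t' ≤ t + 20 * Nat.log 2 (2 * x) + 10)
      {x} 20 (.exec (.call 9) ρ t) := by
  induction x using Nat.strong_induction_on with
  | _ x ih =>
  intro ρ t h11 h12
  refine WP.exec_call (k := 19) ?_
  change WP _ _ _ _ _ (.exec markProc _ _)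
  refine WP.exec_ite (k := 18) (fun hb => ?_) fun hb => ?_
  swap
  · simp only [Test.Holds, h11, h12] at hb
    refine WP.exec_instr fun μ f p hI => ⟨0, p, 17, by omega, ?_, 16, rfl, rfl, by omega⟩
    rw [zero_add]
    exact hI.drop (.inl (by omega))
  simp only [Test.Holds, h11, h12] at hb
  refine WP.exec_instr_seq (i := cas 13 4 12 11 12) (k := 17) fun μ f p hI => ?_
  rw [Multiset.singleton_add] at hI
  simp only [Instr.run, h11, h12]
  by_cases hx : μ.num 4 x = 0
  · rw [if_pos hx]
    obtain ⟨hp, hI'⟩ := hI.mark_node hb.ne' hx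
    refine ⟨{x / 2}, p - 20, 36, by omega, hI', 35, rfl, ?_⟩
    refine WP.exec_ite (k := 34) (fun _ => ?_) fun hb => ?_
    · refine (WP.exec_local_seq (i := half 12 12) (k := 20) trivial fun μ => ih (x / 2) (by omega)
        _ _ ?_ ?_).mono (by norm_num) ?_
      · simp only [Instr.run]
        rw [Frame.setNum_of_ne _ (by norm_num), Frame.setNum_of_ne _ (by norm_num), h11]
      · simp only [Instr.run]
        rw [Frame.setNum_self, Frame.setNum_of_ne _ (by norm_num), h12]
      · rintro g i ρ t ⟨rfl, ht⟩
        refine ⟨i + 10, by omega, rfl, ?_⟩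
        have h₁ : Nat.log 2 (2 * (x / 2)) + 1 ≤ Nat.log 2 (2 * x) := by
          rw [mul_comm 2 x, Nat.log_mul_base (by norm_num) (by omega)]
          exact Nat.succ_le_succ (Nat.log_mono_right (by omega))
        omega
    · simp only [Test.Holds, Frame.setNum_self] at hb
      rw [Frame.setNum_of_ne _ (by norm_num), h11] at hb; omega
  · rw [if_neg hx]
    refine ⟨0, p, 15, by omega, by rw [zero_add]; exact hI.drop (.inr hx), 14, rfl, ?_⟩
    refine WP.exec_ite (k := 13) (fun hb => ?_) fun hb => ?_
    · simp only [Test.Holds, Frame.setNum_self] at hb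
      rw [Frame.setNum_of_ne _ (by norm_num), h11] at hb; omega
    · exact WP.exec_instr fun μ f p hI => ⟨0, p, 12, by omega, hI, 11, rfl, rfl, by omega⟩

end Mark

/-! ### The mark phase and the repair phase as loops over the affected nodes -/

section Leaf

variable {K : Type u} [LinearOrder K] {G : Type*} [AddCommMonoid G]

/-- A loop that calls a procedure for the affected nodes that are not beyond the end. -/
theorem nodeLoop_safe {I : ℕ → Mem K → G → Prop} {μ₀ : Mem K} {q q' M N k tB tE p : ℕ} {γ : ℕ → G}
    {ρ : Frame K} {t : ℕ} (hI : ∀ p μ g, I p μ g → μ.num 2 = μ₀.num 2)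
    (hp : updateProcs.getD q (.instr .skip) = loopCmd q (nodeLeaf q'))
    (hρ₀ : ρ.num 0 = 1) (hρ₁ : ρ.num 1 = M) (hρ₃ : ρ.num 3 = N) (hρ₁₀ : ρ.num 10 = 1)
    (hM : 0 < M) (hk : 11 ≤ k)
    (hcall : ∀ j t, j < M → μ₀.num 2 j ≤ N → t ≤ tB + 10 →
      WP updateProcs I (fun g _ _ t' => g = 0 ∧ t' ≤ tE) (γ (μ₀.num 2 j)) k
        (.exec (.call q') (((ρ.setNum 0 (M + j)).setNum 20 j).setNum 12 (μ₀.num 2 j)) t))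
    (htB : t + 1 + (k + 14) * (Nat.log 2 M + 2) ≤ tB) (htE : tB + 10 ≤ tE)
    (h₀ : I p μ₀ (((leaves M 1).map fun j => if μ₀.num 2 j ≤ N then γ (μ₀.num 2 j) else 0).sum)) :
    Safe updateProcs Set.univ Set.univ (fun μ' ρ' t' => ρ' = ρ ∧ (∃ p', I p' μ' 0) ∧
      t' ≤ tE + (k + 14) * (Nat.log 2 M + 2)) (p + ((k + 14) * (2 * M) + 2)) μ₀
      (.exec (.call q) ρ t) := by
  have key := WP.loop (procs := updateProcs) (I := I) (tB := tB) (tE := tE) (c := k + 14)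
    (γ := fun j => if μ₀.num 2 j ≤ N then γ (μ₀.num 2 j) else 0) hp hρ₁ hρ₀ hρ₁₀ hM (by omega)
    (fun j t hj ht => ?_) htB
  · refine (key.safe h₀).mono le_rfl ?_
    rintro μ' ρ' t' ⟨g', p', k', hI', rfl, rfl, ht'⟩
    exact ⟨rfl, ⟨p', hI'⟩, ht'⟩
  refine WP.exec_local_seq (i := sub 20 0 1) (k := k + 10) trivial fun μ => ?_
  simp only [Instr.run]
  rw [Frame.setNum_self, Frame.setNum_of_ne _ (by norm_num), hρ₁, Nat.add_sub_cancel_left]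
  refine WP.exec_instr_seq (i := load 12 2 20) (k := k + 9) fun μ f p hIμ => ?_
  have hμ := hI _ _ _ hIμ
  refine ⟨_, p, k + 8, by omega, hIμ, k + 7, rfl, ?_⟩
  simp only [Instr.run]
  rw [Frame.setNum_self, hμ]
  have e₃ : (((ρ.setNum 0 (M + j)).setNum 20 j).setNum 12 (μ₀.num 2 j)).num 3 = N := by
    rw [Frame.setNum_of_ne _ (by norm_num), Frame.setNum_of_ne _ (by norm_num),
      Frame.setNum_of_ne _ (by norm_num), hρ₃]
  refine WP.exec_ite (k := k + 6) (fun hb => ?_) fun hb => ?_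
  · simp only [Test.Holds, e₃, Frame.setNum_self] at hb
    rw [if_neg (by omega)]
    exact skip_wp (by omega) _
  · simp only [Test.Holds, e₃, Frame.setNum_self, not_lt] at hb
    rw [if_pos hb]
    exact (hcall j _ hj hb (by omega)).mono (by omega) fun _ _ _ _ h => h

end Leaf

section Phases

variable {K : Type u}

/-- The affected nodes that are not beyond the end. -/
def affected (μ : Mem K) (M N : ℕ) : Finset ℕ :=
  ((Finset.range M).image (μ.num 2)).filter fun v => v ≤ N

theorem mem_affected {μ : Mem K} {M N v : ℕ} :
    v ∈ affected μ M N ↔ (∃ j < M, μ.num 2 j = v) ∧ v ≤ N := by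
  simp [affected]

/-- The initial tokens of a loop. -/
theorem mem_tokens {α : Type*} {M N : ℕ} (hM : 0 < M) {a : ℕ → ℕ} {γ : ℕ → α} {τ : α} :
    τ ∈ ((leaves M 1).map fun j => if a j ≤ N then ({γ (a j)} : Multiset α) else 0).sum ↔
      ∃ j < M, a j ≤ N ∧ γ (a j) = τ := by
  simp_rw [← mem_leaves_root hM]
  induction leaves M 1 with
  | nil => simp
  | cons j l ih =>
    rw [List.map_cons, List.sum_cons, Multiset.mem_add, ih]
    split <;> rename_i h <;> simp [h, eq_comm]

variable [LinearOrder K]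

/-- The mark phase. -/
theorem markLoop_safe {M N : ℕ} {ρ : Frame K} {μ : Mem K} {t : ℕ} (hM : 0 < M)
    (hρ₀ : ρ.num 0 = 1) (hρ₁ : ρ.num 1 = M) (hρ₃ : ρ.num 3 = N) (hρ₁₀ : ρ.num 10 = 1)
    (hρ₁₁ : ρ.num 11 = 0) (hμ₄ : ∀ i, μ.num 4 i = 0) (hμ₂ : ∀ j < M, 1 ≤ μ.num 2 j) :
    Safe updateProcs Set.univ Set.univ (fun μ' ρ' t' => ρ' = ρ ∧
      ((∀ b, b ≠ 4 → μ'.num b = μ.num b) ∧ μ'.key = μ.key ∧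
        (∀ v ∈ upset N (affected μ M N), μ'.num 4 v = v) ∧
        ∀ v, v ∉ upset N (affected μ M N) → μ'.num 4 v = 0) ∧
      t' ≤ t + 68 * (Nat.log 2 M + 2) + 20 * Nat.log 2 (2 * N) + 50)
      (20 * (upset N (affected μ M N)).card + (34 * (2 * M) + 2)) μ (.exec (.call 7) ρ t) := by
  refine (nodeLoop_safe (I := MarkInv N (affected μ M N) μ) (q' := 9) (k := 20)
    (tB := t + 1 + 34 * (Nat.log 2 M + 2))
    (tE := t + 1 + 34 * (Nat.log 2 M + 2) + 20 * Nat.log 2 (2 * N) + 20)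
    (p := 20 * (upset N (affected μ M N)).card) (γ := fun v => {v}) (t := t)
    (fun p ν g h => h.num_eq 2 (by norm_num)) rfl hρ₀ hρ₁ hρ₃ hρ₁₀ hM (by norm_num) ?_ (by omega)
    (by omega) ?_).mono le_rfl ?_
  · intro j t' hj hjN ht'
    refine (markProc_wp (μ.num 2 j) _ t' ?_ (Frame.setNum_self _ _ _)).mono le_rfl ?_
    · rw [Frame.setNum_of_ne _ (by norm_num), Frame.setNum_of_ne _ (by norm_num),
        Frame.setNum_of_ne _ (by norm_num), hρ₁₁]
    · rintro g i ρ' t'' ⟨rfl, ht''⟩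
      have : Nat.log 2 (2 * μ.num 2 j) ≤ Nat.log 2 (2 * N) := Nat.log_mono_right (by omega)
      exact ⟨rfl, by omega⟩
  · have hS : affected μ M N ⊆ Finset.Icc 1 N := fun v hv => by
      obtain ⟨⟨j, hj, rfl⟩, hN⟩ := mem_affected.1 hv
      exact Finset.mem_Icc.2 ⟨hμ₂ j hj, hN⟩
    refine ⟨fun _ _ => rfl, rfl, fun v => .inl (hμ₄ v), fun v hv => absurd (hμ₄ v) hv,
      fun s hs _ => .inr ?_, fun v hv => .inr ?_, Nat.mul_le_mul_left _ (Finset.card_filter_le _ _)⟩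
    · obtain ⟨⟨j, hj, rfl⟩, hN⟩ := mem_affected.1 hs
      exact (mem_tokens (a := μ.num 2) (γ := id) hM).2 ⟨j, hj, hN, rfl⟩
    · obtain ⟨j, hj, hN, rfl⟩ := (mem_tokens (a := μ.num 2) (γ := id) hM).1 hv
      exact subset_upset hS (mem_affected.2 ⟨⟨j, hj, rfl⟩, hN⟩)
  · rintro μ' ρ' t' ⟨rfl, ⟨p', hI⟩, ht'⟩
    exact ⟨rfl, hI.done, by omega⟩

theorem order_of_local {κ : ℕ → WithTop K} {y w : ℕ} (h : Anc y w) (hy : 1 ≤ y)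
    (hloc : ∀ v, Anc y v → Anc v w → v ≠ y → κ (v / 2) ≤ κ v) : κ y ≤ κ w := by
  obtain ⟨i, rfl⟩ := h
  induction i with
  | zero => simp
  | succ i ih =>
    have e : w / 2 ^ (i + 1) = w / 2 ^ i / 2 := by rw [Nat.div_div_eq_div_mul, pow_succ]
    rw [e] at hy hloc ⊢
    refine (hloc _ (anc_half _) ⟨i, rfl⟩ (by omega)).trans (ih (by omega) fun v hv hvw hne => ?_)
    exact hloc v ((anc_half _).trans hv) hvw (by have := hv.le; omega)

open scoped Classical in
/-- The repair phase. -/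
theorem checkLoop_safe {M N : ℕ} {ρ : Frame K} {μ : Mem K} {t : ℕ} (hM : 0 < M)
    (hρ₀ : ρ.num 0 = 1) (hρ₁ : ρ.num 1 = M) (hρ₃ : ρ.num 3 = N) (hρ₁₀ : ρ.num 10 = 1)
    (hρ₁₁ : ρ.num 11 = 0) (hμ₄ : ∀ v ∈ upset N (affected μ M N), μ.num 4 v = v)
    (hμ₄' : ∀ v, v ∉ upset N (affected μ M N) → μ.num 4 v = 0)
    (hblank : μ.key 0 (N + 1) = ⊤)
    (hord : ∀ y w, Anc y w → 1 ≤ y → w ≤ N → y ∉ affected μ M N → w ∉ affected μ M N →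
      μ.key 0 y ≤ μ.key 0 w) :
    Safe updateProcs Set.univ Set.univ (fun μ' ρ' t' => ρ' = ρ ∧
      ((∀ b, b ≠ 4 → μ'.num b = μ.num b) ∧ (∀ v, μ'.num 4 v = 0) ∧
        (∀ w, 2 ≤ w → w ≤ N → μ'.key 0 (w / 2) ≤ μ'.key 0 w) ∧
        (Finset.Icc 1 N).val.map (μ'.key 0) = (Finset.Icc 1 N).val.map (μ.key 0)) ∧
      t' ≤ t + 238 * (Nat.log 2 M + 2) + 306 * Nat.log 2 N + 200)
      (300 * (∑ v ∈ upset N (affected μ M N), waveBound N (μ.key 0) v) +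
        (119 * (2 * M) + 2)) μ (.exec (.call 8) ρ t) := by
  set T := upset N (affected μ M N) with hT
  have hpos : ∀ v ∈ T, 1 ≤ v ∧ v ≤ N := fun v hv => (mem_upset.1 hv).1
  have hlab : ∀ v, μ.num 4 v ≠ 0 → v ∈ T ∧ μ.num 4 v = v := fun v hv => by
    by_cases h : v ∈ T
    · exact ⟨h, hμ₄ v h⟩
    · exact absurd (hμ₄' v h) hv
  refine (nodeLoop_safe (I := SiftI N μ) (q' := 10) (k := 105)
    (tB := t + 1 + 119 * (Nat.log 2 M + 2))
    (tE := t + 1 + 119 * (Nat.log 2 M + 2) + 10 + 306 * Nat.log 2 N + 164)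
    (p := 300 * (∑ v ∈ T, waveBound N (μ.key 0) v))
    (γ := fun v => {Tok.chk v (Nat.log 2 N + 1)}) (t := t)
    (fun p ν g ⟨κ, lab, h⟩ => h.num_eq 2 (by norm_num)) rfl hρ₀ hρ₁ hρ₃ hρ₁₀ hM (by norm_num) ?_
    (by omega) (by omega) ?_).mono le_rfl ?_
  · intro j t' hj hjN ht'
    refine checkSpec N μ (t + 1 + 119 * (Nat.log 2 M + 2) + 10) _ _ _ _ ⟨?_, ?_, ?_, ?_⟩ (by omega)
      (by omega)
    · rw [Frame.setNum_of_ne _ (by norm_num), Frame.setNum_of_ne _ (by norm_num),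
        Frame.setNum_of_ne _ (by norm_num), hρ₃]
    · rw [Frame.setNum_of_ne _ (by norm_num), Frame.setNum_of_ne _ (by norm_num),
        Frame.setNum_of_ne _ (by norm_num), hρ₁₀]
    · rw [Frame.setNum_of_ne _ (by norm_num), Frame.setNum_of_ne _ (by norm_num),
        Frame.setNum_of_ne _ (by norm_num), hρ₁₁]
    · rw [Frame.setNum_self]
  · refine ⟨μ.key 0, μ.num 4, fun _ _ => rfl, hblank, rfl, fun y w hy hy1 ha hw => ?_, fun v hv => ?_,
      fun y x ha hne hy hx => ?_, fun _ => .inl rfl, ?_, fun _ => .inl rfl, fun τ hτ => ?_,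
      fun x hx => ?_, ?_⟩
    · have hyT : y ∉ T := fun h => by have := hμ₄ y h; omega
      -- An unmarked node has no affected descendant, so its whole subtree satisfies the old order.
      have hno : ∀ v, Anc y v → v ∉ affected μ M N := fun v hv hS =>
        hyT (mem_upset.2 ⟨⟨hy1, ha.le.trans hw⟩, v, hS, hv⟩)
      exact hord y w ha hy1 hw (hno y (.refl y)) (hno w ha)
    · obtain ⟨h, e⟩ := hlab v hv
      exact ⟨(hpos v h).2, e.le⟩
    · obtain ⟨h, e⟩ := hlab y hy
      rw [e, (hlab x hx).2]
      exact ha.log_lt hne (hpos y h).1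
    · rw [show Multiset.filterMap Tok.owner _ = 0 from ?_]
      · exact Multiset.nodup_zero
      · rw [Multiset.eq_zero_iff_forall_notMem]
        intro a ha
        obtain ⟨τ, hτ, e⟩ := (Multiset.mem_filterMap _ _).1 ha
        obtain ⟨j, -, -, rfl⟩ :=
          (mem_tokens (a := μ.num 2) (γ := fun v => Tok.chk v (Nat.log 2 N + 1)) hM).1 hτ
        cases e
    · obtain ⟨j, hj, hjN, rfl⟩ :=
        (mem_tokens (a := μ.num 2) (γ := fun v => Tok.chk v (Nat.log 2 N + 1)) hM).1 hτ
      intro y ha hy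
      obtain ⟨h, e⟩ := hlab y hy
      rw [e]
      exact Nat.lt_succ_of_le (Nat.log_mono_right (hpos y h).2)
    · obtain ⟨h₁, h₂, h₃, h₄⟩ := hx
      obtain ⟨h, e⟩ := hlab x h₁.ne'
      obtain ⟨hx, s, hs, ha⟩ := mem_upset.1 h
      obtain ⟨⟨j, hj, rfl⟩, hsN⟩ := mem_affected.1 hs
      have hup : ∀ c, 1 ≤ c → Anc c (μ.num 2 j) → μ.num 4 c ≠ 0 := fun c hc hcs => by
        rw [hμ₄ c (mem_upset.2 ⟨⟨hc, hcs.le.trans hsN⟩, _, hs, hcs⟩)]; omega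
      -- A claimable node must itself be affected, and then the loop has a thread for it: otherwise
      -- the child on the path to the affected node below would be marked.
      by_cases hxs : x = μ.num 2 j
      · refine ⟨_,
          (mem_tokens (a := μ.num 2) (γ := fun v => Tok.chk v (Nat.log 2 N + 1)) hM).2 ⟨j, hj, hsN, rfl⟩, .inl ⟨Nat.log 2 N + 1, ?_⟩⟩
        rw [hxs]
      · obtain h' | h' := ha.child hxs
        · exact absurd h₃ (hup _ (by omega) h')
        · exact absurd h₄ (hup _ (by omega) h')
    · refine Nat.mul_le_mul_left _ ?_
      rw [potential, ← Finset.sum_filter_add_sum_filter_not _ (fun v => v ∈ T)]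
      refine (add_le_add (Finset.sum_le_sum (g := waveBound N (μ.key 0)) fun v _ => ?_)
        (Finset.sum_eq_zero fun v hv => ?_).le).trans ?_
      · split
        · exact Nat.zero_le _
        · exact le_rfl
      · rw [if_pos (hμ₄' v (Finset.mem_filter.1 hv).2)]
      · rw [add_zero]
        exact Finset.sum_le_sum_of_subset fun v hv => (Finset.mem_filter.1 hv).2
  · rintro μ' ρ' t' ⟨rfl, ⟨p', κ, lab, hI⟩, ht'⟩
    have hno : ∀ x, μ'.num 4 x = lab x := fun x => by
      obtain h | ⟨-, -, τ, hτ, -⟩ := hI.mark x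
      · exact h
      · simp at hτ
    have hzero : ∀ x, lab x = 0 := by
      -- Induction from the last node backwards: if all larger nodes are unmarked, a mark at `x`
      -- would make it claimable, but no token is left to be responsible.
      have key : ∀ d x, N + 1 - x = d → lab x = 0 := by
        intro d
        induction d using Nat.strong_induction_on with
        | _ d ih =>
        intro x hd
        by_contra hx
        obtain ⟨h₁, h₂⟩ := hI.lab_le x hx
        obtain ⟨τ, hτ, -⟩ := hI.resp x ⟨by rw [hno]; omega, by rw [hno]; exact h₂, by
          rw [hno]; exact ih _ (by omega) _ rfl, by rw [hno]; exact ih _ (by omega) _ rfl⟩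
        simp at hτ
      exact fun x => key _ x rfl
    have hk : μ'.key 0 = κ := funext fun w => by
      obtain h | ⟨x, a, lo, ph, h, -⟩ := hI.phys w
      · exact h
      · simp at h
    refine ⟨rfl, ⟨hI.num_eq, fun v => by rw [hno, hzero], fun w hw hwN => ?_, ?_⟩, by omega⟩
    · rw [hk]
      exact hI.order _ _ (hzero _) (by omega) (anc_half w) hwN
    · rw [hk, hI.keys]

end Phases

end ParHeap

namespace ParHeap

open Instr

/-! ### Partial sums and lists -/

theorem not_anc_siblings {v w : ℕ} (hv : 0 < v) (h : Anc (2 * v) w) (h' : Anc (2 * v + 1) w) :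
    False := by
  obtain h | h := h.total h'
  · obtain ⟨i, hi⟩ := h
    cases i with
    | zero => simp at hi
    | succ i =>
      rw [pow_succ', ← Nat.div_div_eq_div_mul] at hi
      have := Nat.div_le_self ((2 * v + 1) / 2) (2 ^ i)
      omega
  · have := h.le; omega

theorem anc_one {w : ℕ} (hw : 0 < w) : Anc 1 w := by
  induction w using Nat.strong_induction_on with
  | _ w ih =>
    by_cases h : w = 1
    · rw [h]; exact .refl 1
    · exact (ih (w / 2) (by omega) (by omega)).trans (anc_half w)

theorem Anc.eq_or_child {v w : ℕ} (h : Anc v w) : w = v ∨ Anc (2 * v) w ∨ Anc (2 * v + 1) w := by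
  by_cases hne : v = w
  · exact .inl hne.symm
  · exact .inr (h.child hne)

theorem anc_two_mul (v : ℕ) : Anc v (2 * v) := ⟨1, by simp⟩

theorem anc_two_mul_add_one (v : ℕ) : Anc v (2 * v + 1) := ⟨1, by omega⟩

theorem Frame.num_setNum {K : Type u} (ρ : Frame K) (r s x : ℕ) :
    (ρ.setNum r x).num s = if s = r then x else ρ.num s := by
  simp [Frame.setNum, Function.update_apply]

theorem Frame.num_setKey {K : Type u} (ρ : Frame K) (r : ℕ) (x : WithTop K) :
    (ρ.setKey r x).num = ρ.num := rfl

theorem Frame.key_setNum {K : Type u} (ρ : Frame K) (r x : ℕ) : (ρ.setNum r x).key = ρ.key := rfl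

theorem Frame.key_setKey {K : Type u} (ρ : Frame K) (r s : ℕ) (x : WithTop K) :
    (ρ.setKey r x).key s = if s = r then x else ρ.key s := by
  simp [Frame.setKey, Function.update_apply]

theorem Mem.num_setNum {K : Type u} (μ : Mem K) (b b' i j x : ℕ) :
    (μ.setNum b i x).num b' j = if b' = b ∧ j = i then x else μ.num b' j := by
  by_cases hb : b' = b
  · subst hb
    by_cases hj : j = i <;> simp [Mem.setNum, hj]
  · simp [Mem.setNum, hb]

theorem Mem.key_setKey {K : Type u} (μ : Mem K) (b b' i j : ℕ) (x : WithTop K) :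
    (μ.setKey b i x).key b' j = if b' = b ∧ j = i then x else μ.key b' j := by
  by_cases hb : b' = b
  · subst hb
    by_cases hj : j = i <;> simp [Mem.setKey, hj]
  · simp [Mem.setKey, hb]

/-- Locations of the data of a loop: the tree, the affected nodes, and the holes. -/
def dataLocs : Set Loc := {l | (∃ i, l = .num 2 i) ∨ ∃ i, l = .num 3 i}

section Trees

variable {K : Type u} [LinearOrder K] {procs : List Cmd} {p M c : ℕ} {leaf : Cmd} {ρ : Frame K}
  {val : ℕ → ℕ} {μ : Mem K}

theorem wlp.mono {F W : Set Loc} {d : Cmd} {P Q : Mem K → Frame K → Prop} {ν : Mem K} {σ : Frame K}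
    (h : wlp F W d P ν σ) (hPQ : ∀ ν σ, P ν σ → Q ν σ) : wlp F W d Q ν σ := by
  induction d generalizing ν σ P Q with
  | instr i => exact ⟨h.1, hPQ _ _ h.2⟩
  | seq c d ihc ihd => exact ihc h fun ν σ h' => ihd h' hPQ
  | ite b c d ihc ihd => exact ⟨fun hb => ihc (h.1 hb) hPQ, fun hb => ihd (h.2 hb) hPQ⟩
  | call p => exact h
  | par c d => exact h

/-- Each branch writes only the cells of its own subtree, and sibling subtrees are disjoint. The
leaf is specified for all footprints that contain its cells, since the actual footprint depends on
the node. -/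
theorem Safe.sumTree {t : ℕ}
    (hp : procs.getD p (.instr .skip) = treeCmd p loopRight sumAfter leaf)
    (hρ₁ : ρ.num 1 = M) (hρ₀ : ρ.num 0 = 1) (hρ : ρ.num 10 = 1) (hM : 0 < M)
    (hc : leaf.cost + 50 ≤ c)
    (hleaf : ∀ j (ν : Mem K) (F W : Set Loc), j < M → ν.num 2 = μ.num 2 → ν.num 3 = μ.num 3 →
      dataLocs ⊆ F → .num 0 (M + j) ∈ F → .num 0 (M + j) ∈ W →
      wlp F W leaf (fun ν' _ => ν' = ν.setNum 0 (M + j) (val j)) ν (ρ.setNum 0 (M + j))) :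
    Safe procs Set.univ Set.univ (fun μ' ρ' t' => ρ' = ρ ∧
      (∀ w, 0 < w → w < 2 * M → μ'.num 0 w = ((leaves M w).map val).sum) ∧
      Agree {l | ∀ w, 0 < w → l ≠ .num 0 w} μ μ' ∧
      t' ≤ t + c * (Nat.log 2 M + 2) + 2) (c * (2 * M) + 2) μ (.exec (.call p) ρ t) := by
  have main := Safe.tree (procs := procs) (p := p) (right := loopRight) (after := sumAfter)
    (leaf := leaf) (M := M) (c := c)
    (F := fun σ => dataLocs ∪ {l | ∃ w, Anc (σ.num 0) w ∧ l = .num 0 w})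
    (W := fun σ => {l | ∃ w, Anc (σ.num 0) w ∧ l = .num 0 w})
    (Pre := fun σ ν => σ = ρ.setNum 0 (σ.num 0) ∧ 0 < σ.num 0 ∧ σ.num 0 < 2 * M ∧
      ν.num 2 = μ.num 2 ∧ ν.num 3 = μ.num 3)
    (Post := fun σ ν => ∀ w, Anc (σ.num 0) w → w < 2 * M →
      ν.num 0 w = ((leaves M w).map val).sum) hp
    (fun σ ν h => ⟨by rw [h.1, ρ.setNum_of_ne (by norm_num), hρ₁], h.2.1, h.2.2.1⟩)
    (fun σ ν ν' h ha w hw hw' => by rw [← ha.num 0 w (.inr ⟨w, hw, rfl⟩)]; exact h w hw hw')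
    (by omega) (by simp only [loopRight, sumAfter, Cmd.cost]; omega) ?_ ?_
  · refine (Safe.root_call (p := p) (ρ := ρ) (μ := μ) (c := c)
      (F := dataLocs ∪ {l | ∃ w, Anc (ρ.num 0) w ∧ l = .num 0 w})
      (W := {l | ∃ w, Anc (ρ.num 0) w ∧ l = .num 0 w}) hM fun t => by
        have := main ρ μ t ⟨by rw [ρ.setNum_eq rfl], by omega, by omega, rfl, rfl⟩
        rw [hρ₀] at this ⊢
        rwa [hp]).mono le_rfl ?_
    rintro μ' ρ' t' ⟨rfl, hq, ha, ht⟩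
    refine ⟨rfl, fun w hw hw' => hq w (anc_one hw) hw', ha.mono ?_, ht⟩
    rintro l hl ⟨w, hw, rfl⟩
    rw [hρ₀] at hw
    exact hl w hw.le rfl
  · rintro σ ν ⟨hσ, h₀, h₁, h₂, h₃⟩ hle
    obtain ⟨j, hj⟩ : ∃ j, σ.num 0 = M + j := ⟨σ.num 0 - M, by omega⟩
    simp only [hj]
    rw [hσ, hj]
    refine (hleaf j ν (dataLocs ∪ {l | ∃ w, Anc (M + j) w ∧ l = .num 0 w})
      {l | ∃ w, Anc (M + j) w ∧ l = .num 0 w} (by omega) h₂ h₃ Set.subset_union_left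
      (.inr ⟨_, .refl _, rfl⟩) ⟨_, .refl _, rfl⟩).mono ?_
    rintro ν' σ' rfl w hw hw'
    obtain rfl : w = M + j := by
      obtain h | h | h := hw.eq_or_child
      · exact h
      all_goals have := h.le; omega
    rw [Mem.setNum_same, leaves_of_le (by omega)]
    simp
  · rintro σ ν ⟨hσ, h₀, h₁, h₂, h₃⟩ hlt
    have hσ10 : σ.num 10 = 1 := by rw [hσ, ρ.setNum_of_ne (by norm_num), hρ]
    obtain ⟨v, hv⟩ : ∃ v, σ.num 0 = v := ⟨_, rfl⟩
    rw [hv] at hσ h₀ h₁ hlt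
    have ev : v + v = 2 * v := by omega
    refine ⟨σ.setNum 0 (2 * v + 1), ⟨trivial, trivial, rfl, ?_⟩, ?_, ?_, ?_, ?_, ?_, ?_, ?_,
      fun ν' ha hL hR => ?_⟩
    · simp only [Instr.run]
      rw [Frame.setNum_self, Frame.setNum_of_ne _ (by norm_num), Frame.setNum_setNum, hσ10, hv, ev]
    · rw [Frame.setNum_self, hv]
    · rw [Frame.setNum_self, hv, ev]
      exact ⟨by rw [hσ, Frame.setNum_setNum], by omega, by omega, h₂, h₃⟩
    · intro ν' ha
      rw [Frame.setNum_self] at ha ⊢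
      refine ⟨by rw [hσ, Frame.setNum_setNum], by omega, by omega, ?_, ?_⟩
      · rw [← h₂]; exact funext fun i => (ha.num 2 i (.inl (.inl ⟨i, rfl⟩))).symm
      · rw [← h₃]; exact funext fun i => (ha.num 3 i (.inl (.inr ⟨i, rfl⟩))).symm
    · simp only [Frame.setNum_self, hv, ev]
      rintro l ((h | ⟨w, hw, rfl⟩) | h | ⟨w, hw, rfl⟩)
      · exact .inl h
      · exact .inr ⟨w, (anc_two_mul v).trans hw, rfl⟩
      · exact .inl h
      · exact .inr ⟨w, (anc_two_mul_add_one v).trans hw, rfl⟩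
    · simp only [Frame.setNum_self, hv, ev]
      rintro l (⟨w, hw, rfl⟩ | ⟨w, hw, rfl⟩)
      · exact ⟨w, (anc_two_mul v).trans hw, rfl⟩
      · exact ⟨w, (anc_two_mul_add_one v).trans hw, rfl⟩
    · simp only [Frame.setNum_self, hv, ev]
      rw [Set.disjoint_left]
      rintro l ⟨w, hw, rfl⟩ ((⟨i, h⟩ | ⟨i, h⟩) | ⟨w', hw', h⟩) <;> cases h
      exact not_anc_siblings h₀ hw hw'
    · simp only [Frame.setNum_self, hv, ev]
      rw [Set.disjoint_left]
      rintro l ⟨w, hw, rfl⟩ ((⟨i, h⟩ | ⟨i, h⟩) | ⟨w', hw', h⟩) <;> cases h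
      exact not_anc_siblings h₀ hw' hw
    · simp only [Frame.setNum_self, hv, ev] at hL hR ⊢
      simp [sumAfter, wlp, Instr.Ok, Instr.run, Frame.num_setNum, hv, hσ10, ev]
      refine ⟨.inr (anc_two_mul v), .inr (anc_two_mul_add_one v), .refl v,
        fun w hw hw' => ?_⟩
      rw [Mem.num_setNum]
      obtain rfl | h | h := hw.eq_or_child
      · rw [if_pos ⟨rfl, rfl⟩, hL _ (.refl _) (by omega), hR _ (.refl _) (by omega),
          leaves_of_lt h₀ hlt, List.map_append, List.sum_append]
      · have := h.le
        rw [if_neg (by omega), hL _ h hw']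
      · have := h.le
        rw [if_neg (by omega), hR _ h hw']

/-- The items of the selected leaves below `v`. -/
def listing (M : ℕ) (val item : ℕ → ℕ) (v : ℕ) : List ℕ :=
  ((leaves M v).filter fun j => val j = 1).map item

theorem listing_of_lt {val item : ℕ → ℕ} {v : ℕ} (h₀ : 0 < v) (h : v < M) :
    listing M val item v = listing M val item (2 * v) ++ listing M val item (2 * v + 1) := by
  simp only [listing, leaves_of_lt h₀ h, List.filter_append, List.map_append]

theorem length_listing {val item : ℕ → ℕ} (hval : ∀ j, val j = 0 ∨ val j = 1) (v : ℕ) :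
    (listing M val item v).length = ((leaves M v).map val).sum := by
  rw [listing, List.length_map]
  induction leaves M v with
  | nil => rfl
  | cons j l ih =>
    rw [List.map_cons, List.sum_cons, ← ih, List.filter_cons]
    obtain h | h := hval j
    · simp [h]
    · simp [h, add_comm]

/-- Since `val` is `0` or `1`, a stored sum is the length of the list of selected leaves below.
Advancing the offset by the sum of the left child makes the output blocks of siblings adjacent and
disjoint, so the list is their concatenation. -/
theorem Safe.rankTree {t o : ℕ} {item : ℕ → ℕ} (hval : ∀ j, val j = 0 ∨ val j = 1)
    (hp : procs.getD p (.instr .skip) = treeCmd p rankRight skip leaf)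
    (hρ₁ : ρ.num 1 = M) (hρ₀ : ρ.num 0 = 1) (hρ : ρ.num 10 = 1) (hρ₆ : ρ.num 6 = o) (hM : 0 < M)
    (hc : leaf.cost + 50 ≤ c)
    (hsum : ∀ w, 0 < w → w < 2 * M → μ.num 0 w = ((leaves M w).map val).sum)
    (hleaf : ∀ j (σ : Frame K) (ν : Mem K) (F W : Set Loc), j < M → ν.num 2 = μ.num 2 →
      ν.num 0 (M + j) = val j → σ.num 0 = M + j →
      (∀ r, r ≠ 0 → r ≠ 6 → r ≠ 21 → σ.num r = ρ.num r) →
      dataLocs ⊆ F → .num 0 (M + j) ∈ F → (val j = 1 → .num 1 (σ.num 6) ∈ W) →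
      wlp F W leaf (fun ν' _ => val j = 1 → ν'.num 1 (σ.num 6) = item j) ν σ) :
    Safe procs Set.univ Set.univ (fun μ' ρ' t' => ρ' = ρ ∧
      (∀ i (h : i < (listing M val item 1).length), μ'.num 1 (o + i) = (listing M val item 1)[i]) ∧
      Agree {l | ∀ i < (listing M val item 1).length, l ≠ .num 1 (o + i)} μ μ' ∧
      t' ≤ t + c * (Nat.log 2 M + 2) + 2) (c * (2 * M) + 2) μ (.exec (.call p) ρ t) := by
  set L := listing M val item with hL
  have hlen : ∀ v, (L v).length = ((leaves M v).map val).sum := length_listing hval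
  have main := Safe.tree (K := K) (procs := procs) (p := p) (right := rankRight) (after := skip)
    (leaf := leaf) (M := M) (c := c)
    (F := fun σ : Frame K => dataLocs ∪ {l | ∃ w, l = .num 0 w} ∪
      {l | ∃ i < (L (σ.num 0)).length, l = .num 1 (σ.num 6 + i)})
    (W := fun σ : Frame K => {l | ∃ i < (L (σ.num 0)).length, l = .num 1 (σ.num 6 + i)})
    (Pre := fun (σ : Frame K) (ν : Mem K) => (∀ r, r ≠ 0 → r ≠ 6 → r ≠ 21 → σ.num r = ρ.num r) ∧
      0 < σ.num 0 ∧ σ.num 0 < 2 * M ∧ ν.num 2 = μ.num 2 ∧ ν.num 0 = μ.num 0)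
    (Post := fun (σ : Frame K) (ν : Mem K) => ∀ i (h : i < (L (σ.num 0)).length),
      ν.num 1 (σ.num 6 + i) = (L (σ.num 0))[i]) hp
    (fun σ ν h => ⟨by rw [h.1 _ (by norm_num) (by norm_num) (by norm_num), hρ₁], h.2.1, h.2.2.1⟩)
    (fun σ ν ν' h ha i hi => by rw [← ha.num 1 _ (.inr ⟨i, hi, rfl⟩)]; exact h i hi)
    (by omega) (by simp only [rankRight, Cmd.cost]; omega) ?_ ?_
  · refine (Safe.root_call (p := p) (ρ := ρ) (μ := μ) (c := c)
      (F := dataLocs ∪ {l | ∃ w, l = .num 0 w} ∪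
        {l | ∃ i < (L (ρ.num 0)).length, l = .num 1 (ρ.num 6 + i)})
      (W := {l | ∃ i < (L (ρ.num 0)).length, l = .num 1 (ρ.num 6 + i)}) hM fun t => by
        have := main ρ μ t ⟨fun _ _ _ _ => rfl, by omega, by omega, rfl, rfl⟩
        rw [hρ₀] at this ⊢
        rwa [hp]).mono le_rfl ?_
    rintro μ' ρ' t' ⟨rfl, hq, ha, ht⟩
    rw [hρ₆] at hq ha
    rw [hρ₀] at ha
    refine ⟨rfl, hq, ha.mono ?_, ht⟩
    rintro l hl ⟨i, hi, rfl⟩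
    exact hl i hi rfl
  · rintro σ ν ⟨hσ, h₀, h₁, h₂, h₃⟩ hle
    obtain ⟨j, hj⟩ : ∃ j, σ.num 0 = M + j := ⟨σ.num 0 - M, by omega⟩
    have hLj : L (M + j) = if val j = 1 then [item j] else [] := by
      rw [hL, listing, leaves_of_le (by omega), Nat.add_sub_cancel_left]
      split <;> simp_all
    simp only [hj]
    refine (hleaf j σ ν (dataLocs ∪ {l | ∃ w, l = .num 0 w} ∪
        {l | ∃ i < (L (M + j)).length, l = .num 1 (σ.num 6 + i)})
      {l | ∃ i < (L (M + j)).length, l = .num 1 (σ.num 6 + i)} (by omega) h₂ ?_ hj hσ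
      (fun l hl => .inl (.inl hl)) (.inl (.inr ⟨_, rfl⟩)) fun hv => ⟨0, by simp [hLj, hv], rfl⟩).mono
      ?_
    · rw [h₃, hsum _ (by omega) (by omega), leaves_of_le (by omega)]
      simp
    · intro ν' σ' h i hi
      by_cases hv : val j = 1
      · simp only [hLj, if_pos hv, List.length_singleton, Nat.lt_one_iff] at hi ⊢
        subst hi
        simpa using h hv
      · simp [hLj, hv] at hi
  · rintro σ ν ⟨hσ, h₀, h₁, h₂, h₃⟩ hlt
    have hσ10 : σ.num 10 = 1 := by
      rw [hσ _ (by norm_num) (by norm_num) (by norm_num), hρ]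
    obtain ⟨v, hv⟩ : ∃ v, σ.num 0 = v := ⟨_, rfl⟩
    obtain ⟨k, hk⟩ : ∃ k, σ.num 6 = k := ⟨_, rfl⟩
    rw [hv] at h₀ h₁ hlt
    have ev : v + v = 2 * v := by omega
    have hLv : L v = L (2 * v) ++ L (2 * v + 1) := listing_of_lt h₀ hlt
    have hlv : (L v).length = (L (2 * v)).length + (L (2 * v + 1)).length := by
      rw [hLv, List.length_append]
    have hs : ν.num 0 (2 * v) = (L (2 * v)).length := by
      rw [h₃, hsum _ (by omega) (by omega), hlen]
    set σR := ((((σ.setNum 0 (2 * v)).setNum 21 (L (2 * v)).length).setNum 6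
      (k + (L (2 * v)).length)).setNum 0 (2 * v + 1)) with hσR
    have hR0 : σR.num 0 = 2 * v + 1 := by simp [hσR, Frame.num_setNum]
    have hR6 : σR.num 6 = k + (L (2 * v)).length := by simp [hσR, Frame.num_setNum]
    have hL0 : (σ.setNum 0 (2 * v)).num 0 = 2 * v := Frame.setNum_self _ _ _
    have hL6 : (σ.setNum 0 (2 * v)).num 6 = k := by simp [Frame.num_setNum, hk]
    refine ⟨σR, ?_, ?_⟩
    · simp only [rankRight, wlp, Instr.run, Instr.Ok, Frame.num_setNum, hv, hσ10, ev, hk]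
      simp [hs, hσR]
    simp only [hv, ev, hR0, hR6, hL0, hL6]
    refine ⟨trivial, ⟨fun r h₁ h₂ h₃ => ?_, by omega, by omega, h₂, h₃⟩, fun ν' ha =>
      ⟨fun r h₁ h₂ h₃ => ?_, by omega, by omega, ?_, ?_⟩, ?_, ?_, ?_, ?_, fun ν' ha hL hR =>
      ⟨trivial, fun i hi => ?_⟩⟩
    · rw [Frame.setNum_of_ne _ h₁, hσ r h₁ h₂ h₃]
    · simp [hσR, Frame.num_setNum, h₁, h₂, h₃, hσ]
    · rw [← h₂]; exact funext fun i => (ha.num 2 i (.inl (.inl (.inl ⟨i, rfl⟩)))).symm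
    · rw [← h₃]; exact funext fun i => (ha.num 0 i (.inl (.inr ⟨i, rfl⟩))).symm
    · rintro l ((h | ⟨i, hi, rfl⟩) | h | ⟨i, hi, rfl⟩)
      · exact .inl h
      · exact .inr ⟨i, by omega, by rw [hk]⟩
      · exact .inl h
      · exact .inr ⟨(L (2 * v)).length + i, by omega, by rw [hk, add_assoc]⟩
    · rintro l (⟨i, hi, rfl⟩ | ⟨i, hi, rfl⟩)
      · exact ⟨i, by omega, by rw [hk]⟩
      · exact ⟨(L (2 * v)).length + i, by omega, by rw [hk, add_assoc]⟩
    · rw [Set.disjoint_left]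
      rintro l ⟨i, hi, rfl⟩ (((⟨i', h⟩ | ⟨i', h⟩) | ⟨w, h⟩) | ⟨i', hi', h⟩) <;>
        (rw [Loc.num.injEq] at h; omega)
    · rw [Set.disjoint_left]
      rintro l ⟨i, hi, rfl⟩ (((⟨i', h⟩ | ⟨i', h⟩) | ⟨w, h⟩) | ⟨i', hi', h⟩) <;>
        (rw [Loc.num.injEq] at h; omega)
    · simp only [Instr.run, hk]
      by_cases h : i < (L (2 * v)).length
      · rw [hL i h]
        simp only [hLv]
        rw [List.getElem_append_left]
      · have := hR (i - (L (2 * v)).length) (by omega)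
        rw [show k + (L (2 * v)).length + (i - (L (2 * v)).length) = k + i by omega] at this
        rw [this]
        simp only [hLv]
        rw [List.getElem_append_right (by omega)]

end Trees

end ParHeap

namespace ParHeap

open Instr

/-! ### Entering the batch -/

section Enter

variable {K : Type u}

/-- The memory cells of update number `j`. -/
def enterLocs (n m : ℕ) (μ₀ : Mem K) (j : ℕ) : Set Loc :=
  {l | l = .num 1 j ∨ l = .key 1 j ∨ l = .num 2 j ∨ l = .num 2 (m + j) ∨ l = .num 3 (n + 1 + j) ∨
    l = .key 0 (n + 1 + j) ∨
    (μ₀.num 1 j ≠ 0 ∧ (l = .num 3 (μ₀.num 2 j) ∨ l = .key 0 (μ₀.num 2 j)))}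

/-- Update number `j` has been entered. -/
structure Entered (n m : ℕ) (μ₀ : Mem K) (j : ℕ) (μ : Mem K) : Prop where
  new : μ.num 2 (m + j) = n + 1 + j
  insert : μ₀.num 1 j = 0 → μ.num 2 j = n + m + 1 + j ∧ μ.key 0 (n + 1 + j) = μ₀.key 1 j ∧
    μ.num 3 (n + 1 + j) = 0
  other : μ₀.num 1 j ≠ 0 → μ.num 2 j = μ₀.num 2 j ∧ μ.num 3 (n + 1 + j) = 1
  delete : μ₀.num 1 j = 1 → μ.num 3 (μ₀.num 2 j) = 1
  change : 1 < μ₀.num 1 j → μ.num 3 (μ₀.num 2 j) = 0 ∧ μ.key 0 (μ₀.num 2 j) = μ₀.key 1 j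

theorem Entered.stable {n m j : ℕ} {μ₀ μ ν : Mem K} (h : Entered n m μ₀ j μ)
    (ha : Agree (enterLocs n m μ₀ j) μ ν) : Entered n m μ₀ j ν := by
  have e₁ := ha.num 2 (m + j) (by simp [enterLocs])
  have e₂ := ha.num 2 j (by simp [enterLocs])
  have e₃ := ha.key 0 (n + 1 + j) (by simp [enterLocs])
  have e₄ := ha.num 3 (n + 1 + j) (by simp [enterLocs])
  refine ⟨e₁ ▸ h.new, fun h' => ?_, fun h' => ?_, fun h' => ?_, fun h' => ?_⟩
  · rw [← e₂, ← e₃, ← e₄]; exact h.insert h'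
  · rw [← e₂, ← e₄]; exact h.other h'
  · rw [← ha.num 3 _ (by simp [enterLocs, h'])]; exact h.delete h'
  · have h₀ : μ₀.num 1 j ≠ 0 := by omega
    rw [← ha.num 3 (μ₀.num 2 j) (by simp [enterLocs, h₀]),
      ← ha.key 0 (μ₀.num 2 j) (by simp [enterLocs, h₀])]
    exact h.change h'

variable [LinearOrder K]

theorem enterLeaf_wlp {n m j : ℕ} {μ₀ μ : Mem K} {ρ : Frame K} (hj : j < m)
    (hv : μ₀.num 1 j ≠ 0 → μ₀.num 2 j ≤ n) (h₃ : ∀ i, μ₀.num 3 i = 0)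
    (ha : Agree (enterLocs n m μ₀ j) μ₀ μ) (hρ₁ : ρ.num 1 = m) (hρ₂ : ρ.num 2 = n)
    (hρ₄ : ρ.num 4 = m) (hρ₈ : ρ.num 8 = n + m) (hρ₁₀ : ρ.num 10 = 1) (hρ₁₁ : ρ.num 11 = 0) :
    wlp (enterLocs n m μ₀ j) (enterLocs n m μ₀ j) enterLeaf
      (fun μ' _ => Entered n m μ₀ j μ') μ (ρ.setNum 0 (m + j)) := by
  have e₁ := ha.num 1 j (by simp [enterLocs])
  have e₂ := ha.num 2 j (by simp [enterLocs])
  have e₃ := ha.key 1 j (by simp [enterLocs])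
  have e₄ := ha.num 3 (n + 1 + j) (by simp [enterLocs])
  have hmj : m + j ≠ j := by omega
  have hm : m ≠ 0 := by omega
  have e₅ := h₃ (n + 1 + j)
  simp [enterLeaf, wlp, Instr.Ok, Instr.run, Frame.num_setNum, Frame.key_setKey, Frame.num_setKey,
    Test.Holds, hρ₁, hρ₂, hρ₄, hρ₈, hρ₁₀, hρ₁₁, Mem.num_setNum, ← e₁, ← e₂, ← e₃, Mem.setNum_key, hm]
  refine ⟨by simp [enterLocs], by simp [enterLocs], fun h => ⟨by simp [enterLocs],
    by simp [enterLocs], fun h' => ⟨by simp [enterLocs], by simp [enterLocs, h.ne'], ?_⟩, fun h' =>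
    ⟨by simp [enterLocs, h.ne'], ?_⟩⟩, fun h => ⟨by simp [enterLocs], by simp [enterLocs],
    by simp [enterLocs], ?_⟩⟩
  · have h₄ := hv h.ne'
    have e₆ := ha.num 3 (μ₀.num 2 j) (by simp [enterLocs, h.ne'])
    have h₅ : μ₀.num 2 j ≠ n + 1 + j := by omega
    constructor <;> simp [Mem.num_setNum, Mem.key_setKey, Mem.setKey_num, e₂, h.ne', h'.ne', hm]
    rw [← e₂, ← e₆, h₃]
    simp [h₅]
  · have h₄ := hv h.ne'
    have h₅ : μ₀.num 1 j = 1 := by omega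
    constructor <;> simp [Mem.num_setNum, e₂, h₅, hm]
  · constructor <;> simp [Mem.num_setNum, Mem.key_setKey, Mem.setKey_num, Mem.setNum_key, h, hm,
      ← e₄, e₅]

/-- The state of the memory when the batch has been entered: `ks` are the keys. -/
structure Prepared (n m : ℕ) (ks : Multiset (WithTop K)) (μ : Mem K) : Prop where
  inj : ∀ i j, i < 2 * m → j < 2 * m → μ.num 2 i = μ.num 2 j → i = j
  pos : ∀ j < 2 * m, 1 ≤ μ.num 2 j
  flag : ∀ v, μ.num 3 v = 0 ∨ μ.num 3 v = 1
  hole : ∀ v, μ.num 3 v = 1 → 1 ≤ v ∧ v ≤ n + m ∧ ∃ j < 2 * m, μ.num 2 j = v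
  new : ∀ v, n < v → v ≤ n + m → ∃ j < 2 * m, μ.num 2 j = v
  order : ∀ y w, Anc y w → 1 ≤ y → w ≤ n → (∀ j < 2 * m, μ.num 2 j ≠ y) →
    (∀ j < 2 * m, μ.num 2 j ≠ w) → μ.key 0 y ≤ μ.key 0 w
  keys : ((Finset.Icc 1 (n + m)).filter fun v => μ.num 3 v = 0).val.map (μ.key 0) = ks
  zero : ∀ b, 4 ≤ b → ∀ i, μ.num b i = 0

/-- The node at which the key of an update is put. -/
def Update.node {n : ℕ} (i : ℕ) : Update K n → Option ℕ
  | .insert _ => some (n + 1 + i)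
  | .delete _ => none
  | .setKey v _ => some (v.val + 1)

/-- Distinct updates own distinct cells. What no update owns is as in the old heap, which gives the
order of unaffected nodes and the keys of the nodes that are not targets. -/
theorem prepared_of_entered {n m : ℕ} {a : Fin n → K} {B : Fin m → Update K n} {μ₀ μ : Mem K}
    (ho : IsMinHeap a) (hs : StoresHeap μ₀ a) (hB : ValidBatch B) (hb : StoresBatch μ₀ B)
    (h : ∀ j < m, Entered n m μ₀ j μ)
    (ha : Agree {l | ∀ j < m, l ∉ enterLocs n m μ₀ j} μ₀ μ) :
    Prepared n m ((keysAfter a B).map (↑)) μ := by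
  classical
  have htgt : ∀ i : Fin m, ∀ v, (B i).target = some v ↔ μ₀.num 1 i ≠ 0 ∧ μ₀.num 2 i = v.val + 1 := by
    intro i v
    have := hb.2 i
    generalize B i = b at this
    cases b <;> simp_all [StoresUpdate, Update.target, Fin.ext_iff]
  have htgt' : ∀ i : Fin m, μ₀.num 1 i ≠ 0 → ∃ v : Fin n, μ₀.num 2 i = v.val + 1 ∧
      (B i).target = some v := by
    intro i
    have := hb.2 i
    generalize B i = b at this
    cases b <;> simp_all [StoresUpdate, Update.target]
  have hinj : ∀ i j, i < m → j < m → μ₀.num 1 i ≠ 0 → μ₀.num 1 j ≠ 0 →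
      μ₀.num 2 i = μ₀.num 2 j → i = j := by
    intro i j hi hj h₁ h₂ e
    obtain ⟨v, hv, hv'⟩ := htgt' ⟨i, hi⟩ h₁
    have := hB ⟨i, hi⟩ ⟨j, hj⟩ v hv' ((htgt _ _).2 ⟨h₂, by rw [← e, hv]⟩)
    simpa using this
  -- The listed nodes lie in three separate ranges: targets in `1, …, n`, new nodes in `n + 1, …, n
  -- + m`, and for inserts a dummy beyond `n + m`, which every later phase ignores. So all `2 * m`
  -- entries differ.
  have hcand : ∀ j < m, μ₀.num 1 j = 0 ∧ μ.num 2 j = n + m + 1 + j ∨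
      μ₀.num 1 j ≠ 0 ∧ μ.num 2 j = μ₀.num 2 j ∧ 1 ≤ μ.num 2 j ∧ μ.num 2 j ≤ n := by
    intro j hj
    by_cases h₀ : μ₀.num 1 j = 0
    · exact .inl ⟨h₀, ((h j hj).insert h₀).1⟩
    · obtain ⟨v, hv, -⟩ := htgt' ⟨j, hj⟩ h₀
      have := ((h j hj).other h₀).1
      simp only at hv
      exact .inr ⟨h₀, this, by omega, by omega⟩
  have hcand' : ∀ j < 2 * m, j < m ∨ ∃ i < m, j = m + i ∧ μ.num 2 j = n + 1 + i := by
    intro j hj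
    by_cases h₁ : j < m
    · exact .inl h₁
    · refine .inr ⟨j - m, by omega, by omega, ?_⟩
      rw [← (h (j - m) (by omega)).new]; congr 1; omega
  have hnum3 : ∀ v, (∃ j < m, v = n + 1 + j) ∨ (∃ j < m, μ₀.num 1 j ≠ 0 ∧ v = μ₀.num 2 j) ∨
      μ.num 3 v = 0 := by
    intro v
    by_contra! hc
    refine hc.2.2 ?_
    rw [← ha.num 3 v, hs.2.2 3 le_rfl]
    rintro j hj (h' | h' | h' | h' | h' | h' | ⟨h₁, h' | h'⟩) <;> cases h'
    · exact hc.1 j hj rfl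
    · exact hc.2.1 j hj h₁ rfl
  have hnew : ∀ j < m, μ.num 2 (m + j) = n + 1 + j := fun j hj => (h j hj).new
  have hkey : ∀ v, v ≤ n → (∀ j < m, μ₀.num 1 j ≠ 0 → μ₀.num 2 j ≠ v) →
      μ.key 0 v = μ₀.key 0 v := by
    intro v hv hno
    refine (ha.key 0 v ?_).symm
    rintro j hj (h' | h' | h' | h' | h' | h' | ⟨h₁, h' | h'⟩) <;> cases h'
    · omega
    · exact hno j hj h₁ rfl
  refine ⟨fun i j hi hj e => ?_, fun j hj => ?_, fun v => ?_, fun v hv => ?_, fun v h₁ h₂ => ?_,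
    fun y w hyw hy hw h₃ h₄ => ?_, ?_, fun b hb' i => ?_⟩
  · obtain h₁ | ⟨i', h₁, e₁, c₁⟩ := hcand' i hi <;> obtain h₂ | ⟨j', h₂, e₂, c₂⟩ := hcand' j hj
    · obtain ⟨k₁, c₁⟩ | ⟨k₁, c₁, b₁, b₁'⟩ := hcand i h₁ <;>
        obtain ⟨k₂, c₂⟩ | ⟨k₂, c₂, b₂, b₂'⟩ := hcand j h₂
      any_goals omega
      exact hinj i j h₁ h₂ k₁ k₂ (by omega)
    · have := hcand i h₁; omega
    · have := hcand j h₂; omega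
    · omega
  · obtain h₁ | ⟨i', h₁, e₁, c₁⟩ := hcand' j hj
    · have := hcand j h₁; omega
    · omega
  · obtain ⟨j, hj, rfl⟩ | ⟨j, hj, h₁, rfl⟩ | h' := hnum3 v
    · by_cases h₀ : μ₀.num 1 j = 0
      · exact .inl ((h j hj).insert h₀).2.2
      · exact .inr ((h j hj).other h₀).2
    · by_cases h₀ : μ₀.num 1 j = 1
      · exact .inr ((h j hj).delete h₀)
      · exact .inl ((h j hj).change (by omega)).1
    · exact .inl h'
  · obtain ⟨j, hj, rfl⟩ | ⟨j, hj, h₁, rfl⟩ | h' := hnum3 v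
    · exact ⟨by omega, by omega, m + j, by omega, hnew j hj⟩
    · have := hcand j hj
      exact ⟨by omega, by omega, j, by omega, ((h j hj).other h₁).1⟩
    · omega
  · refine ⟨m + (v - n - 1), by omega, ?_⟩
    rw [hnew _ (by omega)]; omega
  · have hno : ∀ v, (∀ j < 2 * m, μ.num 2 j ≠ v) → ∀ j < m, μ₀.num 1 j ≠ 0 → μ₀.num 2 j ≠ v :=
      fun v hv j hj h₁ => by rw [← ((h j hj).other h₁).1]; exact hv j (by omega)
    rw [hkey w hw (hno w h₄), hkey y (hyw.le.trans hw) (hno y h₃)]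
    refine order_of_local hyw hy fun v hv hvw hne => ?_
    have hv' := hv.le
    have hvn := hvw.le.trans hw
    have := (hv.half hne.symm).le
    have e₁ := hs.2.1 ⟨v - 1, by omega⟩
    have e₂ := hs.2.1 ⟨v / 2 - 1, by omega⟩
    simp only [show v - 1 + 1 = v by omega, show v / 2 - 1 + 1 = v / 2 by omega] at e₁ e₂
    rw [e₁, e₂, WithTop.coe_le_coe]
    exact ho _ _ (by simp only; omega)
  · have hnode : ∀ (i : Fin m) v, (B i).node i = some v ↔
        μ₀.num 1 i = 0 ∧ n + 1 + i = v ∨ 1 < μ₀.num 1 i ∧ μ₀.num 2 i = v := by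
      intro i v
      have := hb.2 i
      generalize B i = b at this
      cases b <;> simp_all [StoresUpdate, Update.node]
    have hkeys : ∀ i : Fin m, ((B i).node i).map (μ.key 0) = (B i).newKey.map (↑) := by
      intro i
      have h₁ := hb.2 i
      have h₂ := h i i.2
      generalize B i = b at h₁
      cases b with
      | insert k => simp [Update.node, Update.newKey, (h₂.insert h₁.1).2.1, h₁.2]
      | delete v => rfl
      | setKey v k =>
        have h₃ := (h₂.change (by rw [h₁.1]; norm_num)).2
        rw [h₁.2.1, h₁.2.2] at h₃
        simp [Update.node, Update.newKey, h₃]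
    -- The nodes that are not holes split into the untouched old nodes and those at which updates
    -- have put their keys, matching the two summands of `keysAfter`.
    have hset : ((Finset.Icc 1 (n + m)).filter fun v => μ.num 3 v = 0).val =
        (Finset.univ.filter fun v => ∀ i, (B i).target ≠ some v).val.map (fun v => v.val + 1) +
          Finset.univ.val.filterMap fun i : Fin m => (B i).node i := by
      refine (Multiset.Nodup.ext (Finset.nodup _) (Multiset.nodup_add.2 ⟨?_, ?_, ?_⟩)).2 fun v => ?_
      · exact (Finset.nodup _).map fun v w e => by simpa [Fin.ext_iff] using e
      · refine (Finset.nodup _).filterMap _ fun i j v hi hj => ?_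
        rw [Option.mem_def, hnode] at hi hj
        have hi' := hcand i i.2
        have hj' := hcand j j.2
        obtain hi | hi := hi <;> obtain hj | hj := hj
        any_goals omega
        exact Fin.ext (hinj i j i.2 j.2 (by omega) (by omega) (by omega))
      · rw [Multiset.disjoint_left]
        intro v hv hv'
        obtain ⟨w, hw, rfl⟩ := Multiset.mem_map.1 hv
        obtain ⟨i, -, hi⟩ := (Multiset.mem_filterMap _ _).1 hv'
        obtain hi | hi := (hnode _ _).1 hi
        · omega
        · exact (Finset.mem_filter.1 (Finset.mem_def.2 hw)).2 i ((htgt _ _).2 ⟨by omega, hi.2⟩)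
      · simp only [Finset.mem_val, Finset.mem_filter, Finset.mem_Icc, Multiset.mem_add,
          Multiset.mem_map, Multiset.mem_filterMap, Finset.mem_univ, true_and, hnode]
        constructor
        · rintro ⟨⟨h₁, h₂⟩, h₃⟩
          by_cases hvn : v ≤ n
          · by_cases hex : ∃ i : Fin m, (B i).target = some ⟨v - 1, by omega⟩
            · obtain ⟨i, hi⟩ := hex
              obtain ⟨hi₁, hi₂⟩ := (htgt _ _).1 hi
              have hi₂ : μ₀.num 2 i = v := by simp only at hi₂; omega
              refine .inr ⟨i, .inr ⟨?_, hi₂⟩⟩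
              by_contra hlt
              have := (h i i.2).delete (by omega)
              rw [hi₂] at this; omega
            · push Not at hex
              exact .inl ⟨⟨v - 1, by omega⟩, hex, by simp only; omega⟩
          · refine .inr ⟨⟨v - n - 1, by omega⟩, .inl ⟨?_, by simp only; omega⟩⟩
            by_contra h₀
            have := ((h (v - n - 1) (by omega)).other h₀).2
            rw [show n + 1 + (v - n - 1) = v by omega] at this
            omega
        · rintro (⟨w, hw, rfl⟩ | ⟨i, ⟨h₀, rfl⟩ | ⟨h₀, rfl⟩⟩)
          · refine ⟨by omega, ?_⟩
            obtain ⟨j, hj, e⟩ | ⟨j, hj, h₁, e⟩ | h' := hnum3 (w + 1)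
            · omega
            · exact absurd ((htgt ⟨j, hj⟩ w).2 ⟨h₁, e.symm⟩) (hw _)
            · exact h'
          · exact ⟨by omega, ((h i i.2).insert h₀).2.2⟩
          · have := hcand i i.2
            exact ⟨by omega, ((h i i.2).change h₀).1⟩
    rw [hset, keysAfter, Multiset.map_add, Multiset.map_add, Multiset.map_map, Multiset.map_map,
      Multiset.map_filterMap, Multiset.map_filterMap]
    congr 1
    · refine Multiset.map_congr (by congr!) fun v hv => ?_
      rw [Function.comp_apply, Function.comp_apply, hkey _ (by omega), hs.2.1]
      intro j hj h₁ e
      exact (Finset.mem_filter.1 (Finset.mem_def.2 hv)).2 ⟨j, hj⟩ ((htgt ⟨j, hj⟩ v).2 ⟨h₁, e⟩)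
    · simp_rw [hkeys]
  · rw [← ha.num b i, hs.2.2 b (by omega)]
    rintro j hj (h' | h' | h' | h' | h' | h' | ⟨h₁, h' | h'⟩) <;> cases h' <;> omega

/-- The first phase. -/
theorem enterLoop_safe {n m : ℕ} {a : Fin n → K} {B : Fin m → Update K n} {μ : Mem K}
    {ρ : Frame K} {t : ℕ} (hm : 0 < m) (ho : IsMinHeap a) (hs : StoresHeap μ a)
    (hB : ValidBatch B) (hb : StoresBatch μ B) (hρ₀ : ρ.num 0 = 1) (hρ₁ : ρ.num 1 = m)
    (hρ₂ : ρ.num 2 = n) (hρ₄ : ρ.num 4 = m) (hρ₈ : ρ.num 8 = n + m) (hρ₁₀ : ρ.num 10 = 1)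
    (hρ₁₁ : ρ.num 11 = 0) :
    Safe updateProcs Set.univ Set.univ (fun μ' ρ' t' => ρ' = ρ ∧
      Prepared n m ((keysAfter a B).map (↑)) μ' ∧ t' ≤ t + 90 * (Nat.log 2 m + 2) + 2)
      (90 * (2 * m) + 2) μ (.exec (.call 0) ρ t) := by
  have htgt : ∀ j < m, μ.num 1 j ≠ 0 → ∃ v : Fin n, μ.num 2 j = v.val + 1 ∧
      ∀ h : j < m, (B ⟨j, h⟩).target = some v := by
    intro j hj h₁
    have := hb.2 ⟨j, hj⟩
    generalize hB : B ⟨j, hj⟩ = b at this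
    cases b <;> simp_all [StoresUpdate, Update.target]
  refine (Safe.loop (procs := updateProcs) (p := 0) (M := m) (c := 90) (leaf := enterLeaf) (ρ := ρ)
    (F := enterLocs n m μ) (W := enterLocs n m μ) (P := fun j ν => Agree (enterLocs n m μ j) μ ν)
    (Post := Entered n m μ) rfl hρ₁ hρ₀ hρ₁₀ hm (fun i j hi hj hne => ?_)
    (fun j ν ν' h h' => h.trans h') (fun j ν ν' h h' => h.stable h') ?_ (fun j ν hj h => ?_)
    fun j hj => .refl _ _).mono le_rfl ?_
  · rw [Set.disjoint_left]
    have hi' := htgt i hi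
    have hj' := htgt j hj
    have : μ.num 1 i ≠ 0 → μ.num 1 j ≠ 0 → μ.num 2 i ≠ μ.num 2 j := by
      intro h₁ h₂ e
      obtain ⟨v, hv, hv'⟩ := hi' h₁
      obtain ⟨w, hw, hw'⟩ := hj' h₂
      obtain rfl : v = w := Fin.ext (by omega)
      exact hne (by simpa using hB _ _ v (hv' hi) (hw' hj))
    have hi'' : μ.num 1 i ≠ 0 → μ.num 2 i ≤ n := fun h => by
      obtain ⟨v, hv, -⟩ := hi' h; omega
    have hj'' : μ.num 1 j ≠ 0 → μ.num 2 j ≤ n := fun h => by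
      obtain ⟨v, hv, -⟩ := hj' h; omega
    clear hi' hj' htgt
    rintro l (rfl | rfl | rfl | rfl | rfl | rfl | ⟨h, rfl | rfl⟩)
      (h' | h' | h' | h' | h' | h' | ⟨h₂, h' | h'⟩) <;>
      simp only [Loc.num.injEq, Loc.key.injEq, reduceCtorEq, true_and,
        false_and] at h' <;> omega
  · simp [enterLeaf, Cmd.cost]
  · refine enterLeaf_wlp hj (fun h₁ => ?_) (hs.2.2 3 le_rfl) h hρ₁ hρ₂ hρ₄ hρ₈ hρ₁₀ hρ₁₁
    obtain ⟨v, hv, -⟩ := htgt j hj h₁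
    omega
  · rintro μ' ρ' t' ⟨rfl, h, ha, ht⟩
    exact ⟨rfl, prepared_of_entered ho hs hB hb h ha, ht⟩

end Enter

end ParHeap

namespace ParHeap

open Instr

/-! ### Filling the holes -/

/-- Only the multiset of listed nodes is needed later, so the order of the leaves plays no role; for
distinct items a multiset is determined by membership. -/
theorem coe_listing {M : ℕ} {val item : ℕ → ℕ} {s : Finset ℕ} (hM : 0 < M)
    (hinj : ∀ i j, i < M → j < M → val i = 1 → val j = 1 → item i = item j → i = j)
    (hs : ∀ v, v ∈ s ↔ ∃ j < M, val j = 1 ∧ item j = v) :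
    (listing M val item 1 : Multiset ℕ) = s.val := by
  have hnd : (listing M val item 1).Nodup := by
    refine List.Nodup.map_on (fun i hi j hj e => ?_) ((nodup_leaves_root hM).filter _)
    simp only [List.mem_filter, mem_leaves_root hM, decide_eq_true_eq] at hi hj
    exact hinj i j hi.1 hj.1 hi.2 hj.2 e
  refine (Multiset.Nodup.ext (Multiset.coe_nodup.2 hnd) s.nodup).2 fun v => ?_
  rw [Finset.mem_val, hs]
  simp [listing, mem_leaves_root hM, and_assoc]

theorem range_map_eq_coe {L : List ℕ} {f : ℕ → ℕ} (h : ∀ i (h : i < L.length), f i = L[i]) :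
    (Finset.range L.length).val.map f = (L : Multiset ℕ) := by
  change ((List.range L.length).map f : Multiset ℕ) = _
  congr 1
  refine List.ext_getElem (by simp) fun i h₁ h₂ => ?_
  simp [h i h₂]

section

variable {K : Type u}

/-- Is the affected node number `j` a hole that is not beyond `b`? -/
def holeVal (μ : Mem K) (b j : ℕ) : ℕ := if b < μ.num 2 j then 0 else μ.num 3 (μ.num 2 j)

/-- Is node `e - j` beyond `N`, but not a hole? -/
def tailVal (μ : Mem K) (N e j : ℕ) : ℕ := if N < e - j then 1 - μ.num 3 (e - j) else 0

/-- The holes that are not beyond `b`. -/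
def holes (μ : Mem K) (b : ℕ) : Finset ℕ := (Finset.Icc 1 b).filter fun v => μ.num 3 v = 1

/-- The keys beyond `N`. -/
def tails (μ : Mem K) (N e : ℕ) : Finset ℕ := (Finset.Ioc N e).filter fun v => μ.num 3 v = 0

/-- The heap and the data of the batch are the same. -/
def SameData (μ ν : Mem K) : Prop := (∀ b, 2 ≤ b → ν.num b = μ.num b) ∧ ν.key = μ.key

theorem SameData.of_agree {μ ν : Mem K} {S : Set Loc} (h : Agree S μ ν)
    (hn : ∀ b i, 2 ≤ b → .num b i ∈ S) (hk : ∀ b i, .key b i ∈ S) : SameData μ ν :=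
  ⟨fun b hb => funext fun i => (h.num b i (hn b i hb)).symm,
    funext fun b => funext fun i => (h.key b i (hk b i)).symm⟩

variable {n m N : ℕ} {ks : Multiset (WithTop K)} {μ : Mem K}

theorem card_holes_le_bound (μ : Mem K) (b : ℕ) : (holes μ b).card ≤ b :=
  (Finset.card_filter_le _ _).trans (by simp)

/-- There are at most `2 * m` nodes beyond `N`, so counting backwards from `e` with `2 * m` leaves
reaches them all; truncated differences do not exceed `N` and are not selected. -/
theorem listing_tails (μ : Mem K) (hm : 0 < m) {e : ℕ} (he : e ≤ N + 2 * m) :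
    (listing (2 * m) (tailVal μ N e) (fun j => e - j) 1 : Multiset ℕ) = (tails μ N e).val := by
  refine coe_listing (by omega) (fun i j hi hj h₁ h₂ he => ?_) fun v => ?_
  · rw [tailVal] at h₁ h₂
    split at h₁ <;> split at h₂ <;> omega
  simp only [tails, Finset.mem_filter, Finset.mem_Ioc, tailVal]
  constructor
  · rintro ⟨⟨h₁, h₂⟩, h₃⟩
    refine ⟨e - v, by omega, ?_, by omega⟩
    rw [show e - (e - v) = v by omega, if_pos h₁, h₃]
  · rintro ⟨j, hj, h₁, rfl⟩
    split at h₁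
    · exact ⟨by omega, by omega⟩
    · omega

theorem holeVal_le_one [LinearOrder K] (h : Prepared n m ks μ) (b j : ℕ) :
    holeVal μ b j = 0 ∨ holeVal μ b j = 1 := by
  rw [holeVal]; split
  · exact .inl rfl
  · exact h.flag _

theorem tailVal_le_one [LinearOrder K] (h : Prepared n m ks μ) (N e j : ℕ) :
    tailVal μ N e j = 0 ∨ tailVal μ N e j = 1 := by
  rw [tailVal]; split
  · obtain h | h := h.flag (e - j) <;> simp [h]
  · exact .inl rfl

variable [LinearOrder K]

theorem Prepared.listing_holes (h : Prepared n m ks μ) (hm : 0 < m) (b : ℕ) :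
    (listing (2 * m) (holeVal μ b) (μ.num 2) 1 : Multiset ℕ) = (holes μ b).val := by
  refine coe_listing (by omega) (fun i j hi hj _ _ e => h.inj i j hi hj e) fun v => ?_
  simp only [holes, Finset.mem_filter, Finset.mem_Icc, holeVal]
  constructor
  · rintro ⟨⟨h₁, h₂⟩, h₃⟩
    obtain ⟨-, -, j, hj, rfl⟩ := h.hole v h₃
    exact ⟨j, hj, by rw [if_neg (by omega), h₃], rfl⟩
  · rintro ⟨j, hj, h₁, rfl⟩
    split at h₁
    · omega
    · exact ⟨⟨h.pos j hj, by omega⟩, h₁⟩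

theorem Prepared.card_holes_le (h : Prepared n m ks μ) (hm : 0 < m) (b : ℕ) :
    (holes μ b).card ≤ 2 * m := by
  have : (holes μ b).val.card ≤ 2 * m := by
    rw [← h.listing_holes hm b, Multiset.coe_card, listing, List.length_map]
    refine (List.length_filter_le _ _).trans ?_
    rw [(leaves_root_perm (by omega)).length_eq, List.length_range]
  exact this

/-- There are as many holes among the first nodes as keys beyond. -/
theorem Prepared.card_tails (h : Prepared n m ks μ)
    (hN : N = n + m - (holes μ (n + m)).card) :
    (tails μ N (n + m)).card = (holes μ N).card := by
  classical
  have h₁ := card_holes_le_bound μ (n + m)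
  have e₁ : (holes μ (n + m)).card = (holes μ N).card +
      ((Finset.Ioc N (n + m)).filter fun v => μ.num 3 v = 1).card := by
    rw [← Finset.card_union_of_disjoint]
    · congr 1
      ext v
      simp only [holes, Finset.mem_filter, Finset.mem_Icc, Finset.mem_Ioc, Finset.mem_union]
      omega
    · rw [Finset.disjoint_left]
      intro v hv hv'
      simp only [holes, Finset.mem_filter, Finset.mem_Icc, Finset.mem_Ioc] at hv hv'
      omega
  have e₂ : (tails μ N (n + m)).card +
      ((Finset.Ioc N (n + m)).filter fun v => μ.num 3 v = 1).card = n + m - N := by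
    rw [← Nat.card_Ioc, ← Finset.card_filter_add_card_filter_not (s := Finset.Ioc N (n + m))
      (fun v => μ.num 3 v = 0), tails]
    congr 2
    refine Finset.filter_congr fun v _ => ?_
    have := h.flag v
    omega
  omega

theorem SameData.prepared {ν : Mem K} (hs : SameData μ ν) (h : Prepared n m ks μ) :
    Prepared n m ks ν := by
  obtain ⟨h₁, h₂, h₃, h₄, h₅, h₆, h₇, h₈⟩ := h
  have e₂ := hs.1 2 le_rfl
  have e₃ := hs.1 3 (by norm_num)
  refine ⟨?_, ?_, ?_, ?_, ?_, ?_, ?_, fun b hb => hs.1 b (by omega) ▸ h₈ b hb⟩ <;>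
    simpa only [e₂, e₃, hs.2]

/-! The leaves of the loops. -/

variable {M j e : ℕ} {ρ σ : Frame K} {ν : Mem K} {F W : Set Loc}

theorem holeLeaf_wlp (hρ₁ : ρ.num 1 = M) (hρ₃ : ρ.num 3 = N) (h₂ : ν.num 2 = μ.num 2)
    (h₃ : ν.num 3 = μ.num 3) (hF : dataLocs ⊆ F) (hW : .num 0 (M + j) ∈ W) :
    wlp F W holeLeaf (fun ν' _ => ν' = ν.setNum 0 (M + j) (holeVal μ N j)) ν
      (ρ.setNum 0 (M + j)) := by
  have f₂ : ∀ i, .num 2 i ∈ F := fun i => hF (.inl ⟨i, rfl⟩)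
  have f₃ : ∀ i, .num 3 i ∈ F := fun i => hF (.inr ⟨i, rfl⟩)
  simp [holeLeaf, wlp, Instr.Ok, Instr.run, Frame.num_setNum, Test.Holds, hρ₁, hρ₃, h₂, h₃, f₂, f₃,
    hW, holeVal]
  exact ⟨fun h => by rw [if_pos h], fun h => by rw [if_neg (by omega)]⟩

theorem tailLeaf_wlp (hρ₁ : ρ.num 1 = M) (hρ₃ : ρ.num 3 = N) (hρ₈ : ρ.num 8 = e)
    (hρ₁₀ : ρ.num 10 = 1) (h₃ : ν.num 3 = μ.num 3) (hF : dataLocs ⊆ F)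
    (hW : .num 0 (M + j) ∈ W) :
    wlp F W tailLeaf (fun ν' _ => ν' = ν.setNum 0 (M + j) (tailVal μ N e j)) ν
      (ρ.setNum 0 (M + j)) := by
  have f₃ : ∀ i, .num 3 i ∈ F := fun i => hF (.inr ⟨i, rfl⟩)
  simp [tailLeaf, wlp, Instr.Ok, Instr.run, Frame.num_setNum, Test.Holds, hρ₁, hρ₃, hρ₈, hρ₁₀, h₃,
    f₃, hW, tailVal]
  exact ⟨fun h => by rw [if_pos h], fun h => by rw [if_neg (by omega)]⟩

theorem listHoleLeaf_wlp {val : ℕ → ℕ} (hval : ∀ j, val j = 0 ∨ val j = 1) (h₂ : ν.num 2 = μ.num 2)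
    (hv : ν.num 0 (M + j) = val j) (hσ₀ : σ.num 0 = M + j) (hσ₁ : σ.num 1 = M)
    (hσ₁₁ : σ.num 11 = 0) (hF : dataLocs ⊆ F) (hF₀ : .num 0 (M + j) ∈ F)
    (hW : val j = 1 → .num 1 (σ.num 6) ∈ W) :
    wlp F W listHoleLeaf (fun ν' _ => val j = 1 → ν'.num 1 (σ.num 6) = μ.num 2 j) ν σ := by
  have f₂ : ∀ i, .num 2 i ∈ F := fun i => hF (.inl ⟨i, rfl⟩)
  obtain h | h := hval j
  · simp [listHoleLeaf, wlp, Instr.Ok, Instr.run, Frame.num_setNum, Test.Holds, hσ₀, hσ₁, hσ₁₁, hv,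
      hF₀, h]
  · simp [listHoleLeaf, wlp, Instr.Ok, Instr.run, Frame.num_setNum, Test.Holds, hσ₀, hσ₁, hσ₁₁, hv,
      hF₀, h, h₂, f₂, hW h, Mem.num_setNum]

theorem listTailLeaf_wlp {val : ℕ → ℕ} (hval : ∀ j, val j = 0 ∨ val j = 1)
    (hv : ν.num 0 (M + j) = val j) (hσ₀ : σ.num 0 = M + j) (hσ₁ : σ.num 1 = M)
    (hσ₈ : σ.num 8 = e) (hσ₁₁ : σ.num 11 = 0) (hF₀ : .num 0 (M + j) ∈ F)
    (hW : val j = 1 → .num 1 (σ.num 6) ∈ W) :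
    wlp F W listTailLeaf (fun ν' _ => val j = 1 → ν'.num 1 (σ.num 6) = e - j) ν σ := by
  obtain h | h := hval j
  · simp [listTailLeaf, wlp, Instr.Ok, Instr.run, Frame.num_setNum, Test.Holds, hσ₀, hσ₁, hσ₁₁, hv,
      hF₀, h]
  · simp [listTailLeaf, wlp, Instr.Ok, Instr.run, Frame.num_setNum, Test.Holds, hσ₀, hσ₁, hσ₁₁, hv,
      hF₀, h, hσ₈, hW h, Mem.num_setNum]

/-- The moves are race-free because the destinations are distinct and no destination is a source. -/
theorem moveLoop_safe {c t : ℕ} (hM : 0 < M) (hρ₀ : ρ.num 0 = 1) (hρ₁ : ρ.num 1 = M)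
    (hρ₉ : ρ.num 9 = c) (hρ₁₀ : ρ.num 10 = 1) (hc : c ≤ M)
    (hinj : ∀ i j, i < c → j < c → μ.num 1 i = μ.num 1 j → i = j)
    (hne : ∀ i j, i < c → j < c → μ.num 1 i ≠ μ.num 1 (M + j)) :
    Safe updateProcs Set.univ Set.univ (fun μ' ρ' t' => ρ' = ρ ∧
      (∀ j < c, μ'.key 0 (μ.num 1 j) = μ.key 0 (μ.num 1 (M + j))) ∧
      (∀ v, (∀ j < c, μ.num 1 j ≠ v) → μ'.key 0 v = μ.key 0 v) ∧ μ'.num = μ.num ∧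
      t' ≤ t + 60 * (Nat.log 2 M + 2) + 2) (60 * (2 * M) + 2) μ (.exec (.call 5) ρ t) := by
  refine (Safe.loop (procs := updateProcs) (p := 5) (M := M) (c := 60) (leaf := moveLeaf) (ρ := ρ)
    (F := fun j => {l | j < c ∧ (l = .num 1 j ∨ l = .num 1 (M + j) ∨ l = .key 0 (μ.num 1 j) ∨
      l = .key 0 (μ.num 1 (M + j)))})
    (W := fun j => {l | j < c ∧ l = .key 0 (μ.num 1 j)})
    (P := fun j ν => j < c → ν.num 1 j = μ.num 1 j ∧ ν.num 1 (M + j) = μ.num 1 (M + j) ∧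
      ν.key 0 (μ.num 1 (M + j)) = μ.key 0 (μ.num 1 (M + j)))
    (Post := fun j ν => j < c → ν.key 0 (μ.num 1 j) = μ.key 0 (μ.num 1 (M + j))) rfl hρ₁ hρ₀ hρ₁₀
    hM (fun i j hi hj hij => ?_) (fun j ν ν' h ha hj => ?_) (fun j ν ν' h ha hj => ?_) ?_
    (fun j ν hj h => ?_) fun j hj _ => ⟨rfl, rfl, rfl⟩).mono le_rfl ?_
  · rw [Set.disjoint_left]
    rintro l ⟨hi, rfl⟩ ⟨hj, h | h | h | h⟩ <;> simp only [Loc.key.injEq, reduceCtorEq, true_and] at h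
    · exact hij (hinj i j hi hj h)
    · exact hne i j hi hj h
  · rw [← ha.num 1 j ⟨hj, .inl rfl⟩, ← ha.num 1 (M + j) ⟨hj, .inr (.inl rfl)⟩,
      ← ha.key 0 _ ⟨hj, .inr (.inr (.inr rfl))⟩]
    exact h hj
  · rw [← ha.key 0 _ ⟨hj, .inr (.inr (.inl rfl))⟩]
    exact h hj
  · simp [moveLeaf, Cmd.cost]
  · by_cases hjc : j < c
    · obtain ⟨h₁, h₂, h₃⟩ := h hjc
      simp [moveLeaf, wlp, Instr.Ok, Instr.run, Frame.num_setNum, Frame.key_setKey,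
        Frame.num_setKey, Test.Holds, hρ₁, hρ₉, hjc, h₁, h₂, h₃, Mem.key_setKey]
    · simp [moveLeaf, wlp, Instr.Ok, Instr.run, Frame.num_setNum, Test.Holds, hρ₁, hρ₉, hjc]
  · rintro μ' ρ' t' ⟨rfl, h, ha, ht⟩
    refine ⟨rfl, fun j hj => h j (by omega) hj, fun v hv => (ha.key 0 v ?_).symm,
      funext fun b => funext fun i => (ha.num b i ?_).symm, ht⟩
    · rintro j - ⟨hj, e⟩
      simp only [Loc.key.injEq, true_and] at e
      exact hv j hj e.symm
    · rintro j - ⟨hj, e⟩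
      cases e

/-- It restores the clean workspace with `O(m)` work, because holes occur only at affected nodes. -/
theorem cleanLoop_safe {t : ℕ} (hM : 0 < M) (hρ₀ : ρ.num 0 = 1) (hρ₁ : ρ.num 1 = M)
    (hρ₁₀ : ρ.num 10 = 1) (hρ₁₁ : ρ.num 11 = 0)
    (hinj : ∀ i j, i < M → j < M → μ.num 2 i = μ.num 2 j → i = j) :
    Safe updateProcs Set.univ Set.univ (fun μ' ρ' t' => ρ' = ρ ∧
      (∀ j < M, μ'.num 3 (μ.num 2 j) = 0) ∧
      (∀ v, (∀ j < M, μ.num 2 j ≠ v) → μ'.num 3 v = μ.num 3 v) ∧ (∀ b, b ≠ 3 → μ'.num b = μ.num b) ∧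
      μ'.key = μ.key ∧ t' ≤ t + 60 * (Nat.log 2 M + 2) + 2) (60 * (2 * M) + 2) μ
      (.exec (.call 6) ρ t) := by
  refine (Safe.loop (procs := updateProcs) (p := 6) (M := M) (c := 60) (leaf := cleanLeaf) (ρ := ρ)
    (F := fun j => {l | l = .num 2 j ∨ l = .num 3 (μ.num 2 j)})
    (W := fun j => {l | l = .num 3 (μ.num 2 j)})
    (P := fun j ν => ν.num 2 j = μ.num 2 j)
    (Post := fun j ν => ν.num 3 (μ.num 2 j) = 0) rfl hρ₁ hρ₀ hρ₁₀
    hM (fun i j hi hj hij => ?_) (fun j ν ν' h ha => ?_) (fun j ν ν' h ha => ?_) ?_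
    (fun j ν hj h => ?_) fun j hj => rfl).mono le_rfl ?_
  · rw [Set.disjoint_left]
    rintro l rfl (h | h) <;> rw [Loc.num.injEq] at h
    · omega
    · exact hij (hinj i j hi hj h.2)
  · rw [← ha.num 2 j (.inl rfl)]; exact h
  · rw [← ha.num 3 _ (.inr rfl)]; exact h
  · simp [cleanLeaf, Cmd.cost]
  · simp [cleanLeaf, wlp, Instr.Ok, Instr.run, Frame.num_setNum, hρ₁, hρ₁₁, h, Mem.num_setNum]
  · rintro μ' ρ' t' ⟨rfl, h, ha, ht⟩
    refine ⟨rfl, h, fun v hv => (ha.num 3 v ?_).symm, fun b hb => funext fun i =>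
      (ha.num b i ?_).symm, funext fun b => funext fun i => (ha.key b i ?_).symm, ht⟩
    · rintro j hj e
      rw [Set.mem_ofPred_eq, Loc.num.injEq] at e
      exact hv j hj e.2.symm
    · rintro j hj e
      rw [Set.mem_ofPred_eq, Loc.num.injEq] at e
      exact hb e.1
    · rintro j hj e
      cases e

/-- The holes have been filled: `N` is the new size. -/
structure Filled (n m N : ℕ) (ks : Multiset (WithTop K)) (μ : Mem K) : Prop where
  size : N ≤ n + m
  pos : ∀ j < 2 * m, 1 ≤ μ.num 2 j
  order : ∀ y w, Anc y w → 1 ≤ y → w ≤ N → y ∉ affected μ (2 * m) N → w ∉ affected μ (2 * m) N →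
    μ.key 0 y ≤ μ.key 0 w
  keys : (Finset.Icc 1 N).val.map (μ.key 0) = ks
  zero : ∀ b, 3 ≤ b → ∀ i, μ.num b i = 0

/-- With `A` the nodes up to `N` that have a key, the new heap is `A` together with the holes up to
`N`, and the old keys are at `A` and at the tail. The moves match holes and tail; on `A`, and so at
every unaffected node, nothing changes. -/
theorem Prepared.filled {c : ℕ} {h t : ℕ → ℕ} (hp : Prepared n m ks μ)
    (hN : N = n + m - (holes μ (n + m)).card)
    (hh : (Finset.range c).val.map h = (holes μ N).val)
    (ht : (Finset.range c).val.map t = (tails μ N (n + m)).val)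
    (hmove : ∀ j < c, ν.key 0 (h j) = μ.key 0 (t j))
    (hkeep : ∀ v, (∀ j < c, h j ≠ v) → ν.key 0 v = μ.key 0 v)
    (hν₂ : ν.num 2 = μ.num 2) (hν : ∀ b, 3 ≤ b → ∀ i, ν.num b i = 0) : Filled n m N ks ν := by
  have hmem : ∀ v, v ∈ holes μ N ↔ ∃ j < c, h j = v := fun v => by
    rw [← Finset.mem_val, ← hh]; simp
  refine ⟨by omega, fun j hj => hν₂ ▸ hp.pos j hj, fun y w hyw h₁ h₂ h₃ h₄ => ?_, ?_, hν⟩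
  · simp only [mem_affected, hν₂, not_and, not_le] at h₃ h₄
    have hw : ∀ v, v ≤ N → (v ≤ N → ¬ ∃ j < 2 * m, μ.num 2 j = v) → ν.key 0 v = μ.key 0 v := by
      intro v hv hno
      refine hkeep v fun j hj e => hno hv ?_
      have := (hmem v).2 ⟨j, hj, e⟩
      simp only [holes, Finset.mem_filter] at this
      exact (hp.hole v this.2).2.2
    have h₃' : y ≤ N → ¬ ∃ j < 2 * m, μ.num 2 j = y := fun h h' => by have := h₃ h'; omega
    have h₄' : w ≤ N → ¬ ∃ j < 2 * m, μ.num 2 j = w := fun h h' => by have := h₄ h'; omega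
    have hyN := hyw.le.trans h₂
    rw [hw y hyN h₃', hw w h₂ h₄']
    refine hp.order y w hyw h₁ ?_ (fun j hj e => h₃' hyN ⟨j, hj, e⟩)
      fun j hj e => h₄' h₂ ⟨j, hj, e⟩
    -- All nodes beyond `n` are affected, so an unaffected `w` belongs to the old heap.
    by_contra hn
    exact h₄' h₂ (hp.new w (by omega) (by omega))
  · set A := (Finset.Icc 1 N).filter fun v => μ.num 3 v = 0 with hA
    have e₁ : (Finset.Icc 1 N).val = A.val + (holes μ N).val := by
      rw [← Finset.disjUnion_val A (holes μ N)]
      · congr 1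
        ext v
        have := hp.flag v
        simp only [hA, holes, Finset.mem_disjUnion, Finset.mem_filter, Finset.mem_Icc]
        omega
      · rw [Finset.disjoint_left]
        intro v hv hv'
        simp only [hA, holes, Finset.mem_filter] at hv hv'
        omega
    have e₂ : ((Finset.Icc 1 (n + m)).filter fun v => μ.num 3 v = 0).val =
        A.val + (tails μ N (n + m)).val := by
      rw [← Finset.disjUnion_val A (tails μ N (n + m))]
      · congr 1
        ext v
        simp only [hA, tails, Finset.mem_disjUnion, Finset.mem_filter, Finset.mem_Icc,
          Finset.mem_Ioc]
        omega
      · rw [Finset.disjoint_left]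
        intro v hv hv'
        simp only [hA, tails, Finset.mem_filter, Finset.mem_Icc, Finset.mem_Ioc] at hv hv'
        omega
    rw [← hp.keys, e₁, e₂, Multiset.map_add, Multiset.map_add, ← hh, ← ht, Multiset.map_map,
      Multiset.map_map]
    congr 1
    · refine Multiset.map_congr rfl fun v hv => hkeep v fun j hj e => ?_
      have := (hmem v).2 ⟨j, hj, e⟩
      rw [Finset.mem_val] at hv
      simp only [hA, holes, Finset.mem_filter] at hv this
      omega
    · refine Multiset.map_congr rfl fun j hj => hmove j ?_
      simpa using hj

end

end ParHeap

namespace ParHeap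

/-! ### Bounds on the work -/

/-- An exact formula is what the induction needs; it distinguishes whether `m + 1` is a power of
two, where the logarithm jumps. -/
theorem sum_log_add (m : ℕ) (hm : 0 < m) :
    ∑ v ∈ Finset.Icc 1 m, Nat.log 2 v + 2 ^ (Nat.log 2 m + 1) = (m + 1) * Nat.log 2 m + 2 := by
  induction m, hm using Nat.le_induction with
  | base => simp
  | succ m hm ih =>
    rw [Finset.sum_Icc_succ_top (by omega)]
    have h₁ : 2 ^ Nat.log 2 m ≤ m := Nat.pow_log_le_self 2 (by omega)
    have h₂ : m < 2 ^ (Nat.log 2 m + 1) := Nat.lt_pow_succ_log_self (by norm_num) m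
    obtain h | h : m + 1 < 2 ^ (Nat.log 2 m + 1) ∨ m + 1 = 2 ^ (Nat.log 2 m + 1) := by omega
    · have e : Nat.log 2 (m + 1) = Nat.log 2 m :=
        Nat.log_eq_of_pow_le_of_lt_pow (by omega) h
      rw [e]
      linarith
    · have e : Nat.log 2 (m + 1) = Nat.log 2 m + 1 := by
        conv_lhs => rw [h]
        exact Nat.log_pow (by norm_num) _
      rw [e, pow_succ]
      rw [← h] at ih ⊢
      linarith

/-- The sum of the heights in a complete binary tree is linear, as for heap construction. -/
theorem sum_log_sub_le (m : ℕ) (hm : 0 < m) :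
    ∑ v ∈ Finset.Icc 1 m, (Nat.log 2 m - Nat.log 2 v) ≤ 2 * m := by
  have h₁ : ∑ v ∈ Finset.Icc 1 m, (Nat.log 2 m - Nat.log 2 v) + ∑ v ∈ Finset.Icc 1 m, Nat.log 2 v =
      m * Nat.log 2 m := by
    rw [← Finset.sum_add_distrib, Finset.sum_congr rfl (g := fun _ => Nat.log 2 m)]
    · simp
    · intro v hv
      exact Nat.sub_add_cancel (Nat.log_mono_right (Finset.mem_Icc.1 hv).2)
  have h₂ := sum_log_add m hm
  have h₃ : 2 ^ Nat.log 2 m ≤ m := Nat.pow_log_le_self 2 (by omega)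
  rw [pow_succ] at h₂
  rw [add_mul] at h₂
  omega

theorem log_le_log_add_log_div {m e : ℕ} (hm : 0 < m) :
    Nat.log 2 e ≤ Nat.log 2 m + Nat.log 2 (e / m) + 1 := by
  have h₁ : e / m < 2 ^ (Nat.log 2 (e / m) + 1) := Nat.lt_pow_succ_log_self (by norm_num) _
  have h₂ : m < 2 ^ (Nat.log 2 m + 1) := Nat.lt_pow_succ_log_self (by norm_num) _
  rw [Nat.div_lt_iff_lt_mul hm] at h₁
  have h₃ : e < 2 ^ (Nat.log 2 m + Nat.log 2 (e / m) + 2) := by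
    refine h₁.trans_le ((Nat.mul_le_mul_left _ h₂.le).trans_eq ?_)
    rw [← pow_add]; congr 1; omega
  by_cases he : e = 0
  · simp [he]
  · have := Nat.log_lt_of_lt_pow he h₃
    omega

/-- A node has few ancestors that are not among the first nodes. -/
theorem card_anc_le {m e s : ℕ} {T : Finset ℕ} (hm : 0 < m) (hs : s ≤ e) (hT : ∀ v ∈ T, m ≤ v)
    (h : ∀ v ∈ T, Anc v s) : T.card ≤ Nat.log 2 (e / m) + 1 := by
  classical
  have hsub : T ⊆ (Finset.range (Nat.log 2 (e / m) + 1)).image fun i => s / 2 ^ i := by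
    intro v hv
    obtain ⟨i, rfl⟩ := h v hv
    have h₁ := hT _ hv
    refine Finset.mem_image.2 ⟨i, Finset.mem_range.2 (Nat.lt_succ_of_le ?_), rfl⟩
    rw [Nat.le_div_iff_mul_le (by positivity)] at h₁
    have h₂ : 2 ^ i ≤ e / m := (Nat.le_div_iff_mul_le hm).2 (by rw [mul_comm]; omega)
    exact Nat.le_log_of_pow_le (by norm_num) h₂
  exact (Finset.card_le_card hsub).trans (Finset.card_image_le.trans (by simp))

open scoped Classical in
/-- The marked nodes and the steps of the waves. -/
theorem upset_bound {K : Type u} [LinearOrder K] {N m e : ℕ} {S : Finset ℕ} {κ : ℕ → WithTop K}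
    (hm : 0 < m) (hN : N ≤ e) (hS : S ⊆ Finset.Icc 1 N) (hcard : S.card ≤ 2 * m)
    (hord : ∀ y w, Anc y w → 1 ≤ y → w ≤ N → y ∉ S → w ∉ S → κ y ≤ κ w) :
    (upset N S).card ≤ 3 * (m * (Nat.log 2 (e / m) + 1)) ∧
      ∑ v ∈ upset N S, waveBound N κ v ≤ 10 * (m * (Nat.log 2 (e / m) + 1)) := by
  set L := Nat.log 2 (e / m) with hL
  have hlog : Nat.log 2 N ≤ Nat.log 2 m + (L + 1) := by
    have h₁ := log_le_log_add_log_div (e := e) hm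
    have h₂ : Nat.log 2 N ≤ Nat.log 2 e := Nat.log_mono_right hN
    omega
  -- Nodes below `m` are so few that their heights may be summed directly; all others have height at
  -- most `L + 1`.
  set A := (upset N S).filter fun v => v < m with hA
  set B := (upset N S).filter fun v => ¬ v < m with hB
  have hAm : A ⊆ Finset.Icc 1 m := fun v hv => by
    rw [Finset.mem_filter, mem_upset] at hv
    exact Finset.mem_Icc.2 ⟨hv.1.1.1, hv.2.le⟩
  have hAcard : A.card ≤ m := (Finset.card_le_card hAm).trans (by simp)
  have hBm : ∀ v ∈ B, m ≤ v := fun v hv => not_lt.1 (Finset.mem_filter.1 hv).2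
  have hSe : ∀ s ∈ S, s ≤ e := fun s hs => (Finset.mem_Icc.1 (hS hs)).2.trans hN
  have hSL : S.card * (L + 1) ≤ 2 * (m * (L + 1)) := by
    rw [← mul_assoc]; exact Nat.mul_le_mul_right _ hcard
  -- Double counting of pairs of an affected node and an ancestor in `B`.
  have hD : ∑ v ∈ B, (S.filter fun s => Anc v s).card ≤ 2 * (m * (L + 1)) := by
    have := Finset.sum_card_bipartiteAbove_eq_sum_card_bipartiteBelow (s := B) (t := S) Anc
    simp only [Finset.bipartiteAbove, Finset.bipartiteBelow] at this
    rw [this]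
    refine (Finset.sum_le_card_nsmul S _ (L + 1) fun s hs => ?_).trans (by simpa using hSL)
    exact card_anc_le hm (hSe s hs) (fun v hv => hBm v (Finset.mem_filter.1 hv).1)
      fun v hv => (Finset.mem_filter.1 hv).2
  have hBcard : B.card ≤ 2 * (m * (L + 1)) := by
    refine le_trans ?_ hD
    rw [Finset.card_eq_sum_ones]
    refine Finset.sum_le_sum fun v hv => ?_
    obtain ⟨-, s, hs, ha⟩ := mem_upset.1 (Finset.mem_filter.1 hv).1
    exact Finset.card_pos.2 ⟨s, Finset.mem_filter.2 ⟨hs, ha⟩⟩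
  have hmL : m ≤ m * (L + 1) := Nat.le_mul_of_pos_right _ (by omega)
  refine ⟨?_, ?_⟩
  · have : (upset N S).card ≤ A.card + B.card :=
      (Finset.card_le_card fun v hv => by
        rw [Finset.mem_union, hA, hB, Finset.mem_filter, Finset.mem_filter]
        exact (em (v < m)).imp (⟨hv, ·⟩) (⟨hv, ·⟩)).trans (Finset.card_union_le A B)
    omega
  rw [← Finset.sum_filter_add_sum_filter_not _ (fun v => v < m)]
  have h₁ : ∑ v ∈ A, waveBound N κ v ≤ 3 * m + m * (L + 1) := by
    calc ∑ v ∈ A, waveBound N κ v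
        ≤ ∑ v ∈ A, (1 + (Nat.log 2 m - Nat.log 2 v) + (L + 1)) := by
          refine Finset.sum_le_sum fun v _ => ?_
          have := min_le_left (Nat.log 2 N - Nat.log 2 v) (smaller N κ v)
          rw [waveBound]; omega
      _ ≤ ∑ v ∈ Finset.Icc 1 m, (1 + (Nat.log 2 m - Nat.log 2 v) + (L + 1)) :=
          Finset.sum_le_sum_of_subset hAm
      _ ≤ 3 * m + m * (L + 1) := by
          rw [Finset.sum_add_distrib, Finset.sum_add_distrib]
          have := sum_log_sub_le m hm
          simp only [Finset.sum_const, Nat.card_Icc, smul_eq_mul, Nat.add_sub_cancel]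
          omega
  have h₂ : ∑ v ∈ B, waveBound N κ v ≤ 6 * (m * (L + 1)) := by
    calc ∑ v ∈ B, waveBound N κ v
        ≤ ∑ v ∈ B, (1 + (S.filter fun s => Anc v s).card + if v ∈ S then L + 1 else 0) := by
          refine Finset.sum_le_sum fun v hv => ?_
          rw [waveBound]
          split
          · have := min_le_left (Nat.log 2 N - Nat.log 2 v) (smaller N κ v)
            have : Nat.log 2 m ≤ Nat.log 2 v := Nat.log_mono_right (hBm v hv)
            omega
          · rename_i hvS
            have := min_le_right (Nat.log 2 N - Nat.log 2 v) (smaller N κ v)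
            -- Below an unaffected node only affected nodes can have smaller keys. Bounding by the
            -- height here would cost a second logarithmic factor.
            suffices smaller N κ v ≤ (S.filter fun s => Anc v s).card by omega
            refine Finset.card_le_card fun w hw => ?_
            simp only [Finset.mem_filter, Finset.mem_Icc] at hw ⊢
            refine ⟨?_, hw.2.1⟩
            by_contra hwS
            refine not_le.2 hw.2.2 (hord v w hw.2.1 ?_ hw.1.2 hvS hwS)
            exact hm.trans_le (hBm v hv)
      _ ≤ 6 * (m * (L + 1)) := by
          rw [Finset.sum_add_distrib, Finset.sum_add_distrib, ← Finset.card_eq_sum_ones,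
            ← Finset.sum_filter, Finset.sum_const, smul_eq_mul]
          have : (B.filter fun v => v ∈ S).card * (L + 1) ≤ S.card * (L + 1) :=
            Nat.mul_le_mul_right _ (Finset.card_le_card fun v hv => (Finset.mem_filter.1 hv).2)
          omega
  rw [← hA, ← hB]
  omega

end ParHeap

namespace ParHeap

open Instr

/-! ### The whole program -/

section Main

variable {K : Type u}

/-- The registers of the main thread. -/
structure Regs (n m : ℕ) (ρ : Frame K) : Prop where
  node : ρ.num 0 = 1
  old : ρ.num 2 = n
  batch : ρ.num 4 = m
  bound : ρ.num 8 = n + m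
  one : ρ.num 10 = 1
  zero : ρ.num 11 = 0
  blank : ρ.key 0 = ⊤

theorem Regs.setNum {ρ : Frame K} {n m : ℕ} (h : Regs n m ρ) {r : ℕ}
    (hr : r ≠ 0 ∧ r ≠ 2 ∧ r ≠ 4 ∧ r ≠ 8 ∧ r ≠ 10 ∧ r ≠ 11) (v : ℕ) :
    Regs n m (ρ.setNum r v) :=
  ⟨by rw [ρ.setNum_of_ne (by omega), h.node], by rw [ρ.setNum_of_ne (by omega), h.old],
    by rw [ρ.setNum_of_ne (by omega), h.batch], by rw [ρ.setNum_of_ne (by omega), h.bound],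
    by rw [ρ.setNum_of_ne (by omega), h.one], by rw [ρ.setNum_of_ne (by omega), h.zero], h.blank⟩

variable [LinearOrder K]

/-- The command runs with at most `k` steps and time `T`. -/
def Runs (c : Cmd) (μ : Mem K) (ρ : Frame K) (A : Mem K → Frame K → Prop) (k T : ℕ) : Prop :=
  ∀ t, Safe updateProcs Set.univ Set.univ (fun μ' ρ' t' => A μ' ρ' ∧ t' ≤ t + T) k μ
    (.exec c ρ t)

variable {c d : Cmd} {μ : Mem K} {ρ : Frame K} {A B : Mem K → Frame K → Prop} {k k' T T' : ℕ}

theorem Runs.mono (h : Runs c μ ρ A k T) (hA : ∀ μ ρ, A μ ρ → B μ ρ) (hk : k ≤ k') (hT : T ≤ T') :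
    Runs c μ ρ B k' T' := fun t =>
  (h t).mono hk fun μ' ρ' t' h => ⟨hA _ _ h.1, by omega⟩

theorem Runs.seq (h : Runs c μ ρ A k T) (hd : ∀ μ' ρ', A μ' ρ' → Runs d μ' ρ' B k' T') :
    Runs (c ;; d) μ ρ B (k + k' + 2) (T + T' + 2) := fun t =>
  Safe.exec_seq (h (t + 1)) fun μ' ρ' t' h => (hd μ' ρ' h.1 (t' + 1)).mono le_rfl
    fun _ _ _ h' => ⟨h'.1, by omega⟩

theorem runs_of_wlp (h : wlp Set.univ Set.univ c A μ ρ) (hk : c.cost ≤ k) : Runs c μ ρ A k k :=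
  fun _ => h.safe.mono hk fun _ _ _ ⟨⟨_, hν, hA⟩, ht⟩ => ⟨hν.eq ▸ hA, by omega⟩

/-- The result of the program: a heap with the keys `ks`. -/
def Result (ks : Multiset (WithTop K)) (μ : Mem K) : Prop :=
  ∃ N, μ.num 0 0 = N ∧ (∀ b, 3 ≤ b → ∀ i, μ.num b i = 0) ∧
    (∀ w, 2 ≤ w → w ≤ N → μ.key 0 (w / 2) ≤ μ.key 0 w) ∧
    (Finset.Icc 1 N).val.map (μ.key 0) = ks

variable {n m N : ℕ} {ks : Multiset (WithTop K)}

theorem Filled.card_affected {a : ℕ → ℕ} : ((Finset.range (2 * m)).image a |>.filter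
    fun v => v ≤ N).card ≤ 2 * m :=
  (Finset.card_filter_le _ _).trans (Finset.card_image_le.trans (by simp))

/-- The blank key at `N + 1` serves as the right sibling if the last node is a left child. The
constants are 20 credits for each of `3 * X` nodes to mark, 300 for each of `10 * X` steps of waves,
and the two loops. -/
theorem repair_runs (hm : 0 < m) (h : Filled n m N ks μ) (hρ : Regs n m ρ) (hρ₁ : ρ.num 1 = 2 * m)
    (hρ₃ : ρ.num 3 = N) :
    Runs ((store 0 11 3 ;; add 20 3 10 ;; keyStore 0 20 0) ;; .call 7 ;; .call 8) μ ρ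
      (fun μ' _ => Result ks μ')
      (3060 * (m * (Nat.log 2 ((n + m) / m) + 1)) + 612 * m + 20)
      (306 * (Nat.log 2 (2 * m) + 2) + 326 * Nat.log 2 (n + m) + 300) := by
  have hNlog : Nat.log 2 N ≤ Nat.log 2 (n + m) := Nat.log_mono_right h.size
  have hNlog' : Nat.log 2 (2 * N) ≤ Nat.log 2 (n + m) + 1 := by
    rw [← Nat.log_mul_base (by norm_num) (by omega), mul_comm]
    exact Nat.log_mono_right (Nat.mul_le_mul_right _ h.size)
  set X := m * (Nat.log 2 ((n + m) / m) + 1) with hX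
  set μ₁ := (μ.setNum 0 0 N).setKey 0 (N + 1) ⊤ with hμ₁
  have hnum : ∀ b, b ≠ 0 → μ₁.num b = μ.num b := fun b hb => Mem.setNum_array_ne _ hb _ _
  have hkey : ∀ v, v ≠ N + 1 → μ₁.key 0 v = μ.key 0 v := fun v hv => by
    rw [hμ₁, Mem.key_setKey, if_neg (by simp [hv])]; rfl
  have hkeys : ∀ v ∈ Finset.Icc 1 N, μ₁.key 0 v = μ.key 0 v := fun v hv =>
    hkey v (by have := (Finset.mem_Icc.1 hv).2; omega)
  have hblank : μ₁.key 0 (N + 1) = ⊤ := by rw [hμ₁, Mem.key_setKey, if_pos ⟨rfl, rfl⟩]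
  have haff : affected μ₁ (2 * m) N = affected μ (2 * m) N := by
    rw [affected, affected, hnum 2 (by norm_num)]
  have hS : affected μ (2 * m) N ⊆ Finset.Icc 1 N := fun v hv => by
    obtain ⟨⟨j, hj, rfl⟩, hv⟩ := mem_affected.1 hv
    exact Finset.mem_Icc.2 ⟨h.pos j hj, hv⟩
  have hord : ∀ y w, Anc y w → 1 ≤ y → w ≤ N → y ∉ affected μ (2 * m) N →
      w ∉ affected μ (2 * m) N → μ₁.key 0 y ≤ μ₁.key 0 w := fun y w hyw hy hw h₁ h₂ => by
    have := hyw.le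
    rw [hkey y (by omega), hkey w (by omega)]
    exact h.order y w hyw hy hw h₁ h₂
  obtain ⟨hb₁, hb₂⟩ := upset_bound hm h.size hS Filled.card_affected hord
  rw [← hX] at hb₁ hb₂
  refine (Runs.seq (A := fun μ' ρ' => μ' = μ₁ ∧ ρ' = ρ.setNum 20 (N + 1)) (k := 7) (T := 7)
    (B := fun μ' _ => Result ks μ') (k' := 3060 * X + 612 * m + 6)
    (T' := 306 * (Nat.log 2 (2 * m) + 2) + 326 * Nat.log 2 (n + m) + 285) (runs_of_wlp ?_ ?_)
    ?_).mono (fun _ _ h => h) (by omega) (by omega)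
  · simp [wlp, Instr.Ok, Instr.run, hρ.zero, hρ.one, hρ.blank, hρ₃, Frame.num_setNum,
      Frame.key_setNum, hμ₁]
  · simp [Cmd.cost]
  rintro _ _ ⟨rfl, rfl⟩
  have hρ' := hρ.setNum (r := 20) (by norm_num) (N + 1)
  have h₁' : (ρ.setNum 20 (N + 1)).num 1 = 2 * m := by rw [ρ.setNum_of_ne (by norm_num), hρ₁]
  have h₃' : (ρ.setNum 20 (N + 1)).num 3 = N := by rw [ρ.setNum_of_ne (by norm_num), hρ₃]
  refine (Runs.seq (A := fun μ' ρ' => ρ' = ρ.setNum 20 (N + 1) ∧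
    ((∀ b, b ≠ 4 → μ'.num b = μ₁.num b) ∧ μ'.key = μ₁.key ∧
        (∀ v ∈ upset N (affected μ (2 * m) N), μ'.num 4 v = v) ∧
        ∀ v, v ∉ upset N (affected μ (2 * m) N) → μ'.num 4 v = 0))
    (k := 60 * X + 136 * m + 2)
    (T := 68 * (Nat.log 2 (2 * m) + 2) + 20 * Nat.log 2 (n + m) + 70)
    (B := fun μ' _ => Result ks μ') (k' := 3000 * X + 476 * m + 2)
    (T' := 238 * (Nat.log 2 (2 * m) + 2) + 306 * Nat.log 2 (n + m) + 200) ?_ ?_).mono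
    (fun _ _ h => h) (by omega) (by omega)
  · intro t
    have := markLoop_safe (N := N) (μ := μ₁) (t := t) (ρ := ρ.setNum 20 (N + 1)) (by omega : 0 < 2 * m)
      hρ'.node h₁' h₃' hρ'.one hρ'.zero (fun i => by rw [hnum 4 (by norm_num), h.zero 4 (by norm_num)])
      (fun j hj => by rw [hnum 2 (by norm_num)]; exact h.pos j hj)
    rw [haff] at this
    refine this.mono (by omega) ?_
    rintro μ' ρ' t' ⟨h₁, h₂, h₃⟩
    exact ⟨⟨h₁, h₂⟩, by omega⟩
  rintro μ₂ _ ⟨rfl, hn, hk, hm₁, hm₂⟩ t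
  have haff' : affected μ₂ (2 * m) N = affected μ (2 * m) N := by
    rw [← haff, affected, affected, hn 2 (by norm_num)]
  have := checkLoop_safe (N := N) (μ := μ₂) (t := t) (ρ := ρ.setNum 20 (N + 1)) (by omega : 0 < 2 * m)
    hρ'.node h₁' h₃' hρ'.one hρ'.zero (by rw [haff']; exact hm₁) (by rw [haff']; exact hm₂)
    (by rw [hk, hblank]) (by rw [haff', hk]; exact hord)
  rw [haff', hk] at this
  refine this.mono (by omega) ?_
  rintro μ' ρ' t' ⟨-, ⟨h₁, h₂, h₃, h₄⟩, h₅⟩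
  refine ⟨⟨N, ?_, fun b hb i => ?_, h₃, ?_⟩, by omega⟩
  · rw [h₁ 0 (by norm_num), hn 0 (by norm_num), hμ₁, Mem.setKey_num, Mem.setNum_same]
  · by_cases hb4 : b = 4
    · rw [hb4, h₂]
    · rw [h₁ b hb4, hn b hb4, hnum b (by omega), h.zero b hb]
  · rw [h₄, ← h.keys]
    exact Multiset.map_congr rfl fun v hv => hkeys v hv

/-- The lists are known as multisets of finite sets, which suffices: absence of duplicates makes the
destinations distinct, and holes up to `N` differ from nodes beyond `N`. -/
theorem move_runs (hm : 0 < m) (h : Prepared n m ks μ) (hρ : Regs n m ρ) (hρ₁ : ρ.num 1 = 2 * m)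
    (hρ₃ : ρ.num 3 = N) (hρ₉ : ρ.num 9 = (holes μ N).card)
    (hN : N = n + m - (holes μ (n + m)).card)
    (hh : (Finset.range (holes μ N).card).val.map (fun i => μ.num 1 (0 + i)) = (holes μ N).val)
    (ht : (Finset.range (holes μ N).card).val.map (fun i => μ.num 1 (2 * m + i)) =
      (tails μ N (n + m)).val) :
    Runs (.call 5 ;; .call 6 ;; (store 0 11 3 ;; add 20 3 10 ;; keyStore 0 20 0) ;;
      .call 7 ;; .call 8) μ ρ (fun μ' _ => Result ks μ')
      (3060 * (m * (Nat.log 2 ((n + m) / m) + 1)) + 1092 * m + 30)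
      (426 * (Nat.log 2 (2 * m) + 2) + 326 * Nat.log 2 (n + m) + 310) := by
  set c := (holes μ N).card with hc
  simp only [zero_add] at hh
  have hinj : ∀ i j, i < c → j < c → μ.num 1 i = μ.num 1 j → i = j := by
    have := (holes μ N).nodup
    rw [← hh] at this
    intro i j hi hj e
    exact Multiset.inj_on_of_nodup_map this i (by simpa using hi) j (by simpa using hj) e
  have hh' : ∀ j < c, μ.num 1 j ≤ N := fun j hj => by
    have : μ.num 1 j ∈ (holes μ N).val := by
      rw [← hh]; exact Multiset.mem_map_of_mem _ (by simpa using hj)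
    rw [Finset.mem_val, holes, Finset.mem_filter, Finset.mem_Icc] at this
    exact this.1.2
  have ht' : ∀ j < c, N < μ.num 1 (2 * m + j) := fun j hj => by
    have : μ.num 1 (2 * m + j) ∈ (tails μ N (n + m)).val := by
      rw [← ht]
      exact Multiset.mem_map_of_mem (fun i => μ.num 1 (2 * m + i)) (by simpa using hj)
    rw [Finset.mem_val, tails, Finset.mem_filter, Finset.mem_Ioc] at this
    exact this.1.1
  refine (Runs.seq (A := fun μ' ρ' => ρ' = ρ ∧
      (∀ j < c, μ'.key 0 (μ.num 1 j) = μ.key 0 (μ.num 1 (2 * m + j))) ∧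
      (∀ v, (∀ j < c, μ.num 1 j ≠ v) → μ'.key 0 v = μ.key 0 v) ∧ μ'.num = μ.num)
    (k := 240 * m + 2) (T := 60 * (Nat.log 2 (2 * m) + 2) + 2)
    (B := fun μ' _ => Result ks μ')
    (k' := 3060 * (m * (Nat.log 2 ((n + m) / m) + 1)) + 852 * m + 24)
    (T' := 366 * (Nat.log 2 (2 * m) + 2) + 326 * Nat.log 2 (n + m) + 304) ?_ ?_).mono
    (fun _ _ h => h) (by omega) (by omega)
  · intro t
    refine (moveLoop_safe (c := c) (t := t) (by omega) hρ.node hρ₁ hρ₉ hρ.one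
      (h.card_holes_le hm N) hinj fun i j hi hj => ?_).mono (by omega) ?_
    · have := hh' i hi
      have := ht' j hj
      omega
    · rintro μ' ρ' t' ⟨h₁, h₂, h₃, h₄, h₅⟩
      exact ⟨⟨h₁, h₂, h₃, h₄⟩, by omega⟩
  rintro μ₁ ρ' ⟨e, hmv, hkp, hnum⟩
  subst ρ'
  refine (Runs.seq (A := fun μ' ρ' => ρ' = ρ ∧ Filled n m N ks μ')
    (k := 240 * m + 2) (T := 60 * (Nat.log 2 (2 * m) + 2) + 2)
    (B := fun μ' _ => Result ks μ')
    (k' := 3060 * (m * (Nat.log 2 ((n + m) / m) + 1)) + 612 * m + 20)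
    (T' := 306 * (Nat.log 2 (2 * m) + 2) + 326 * Nat.log 2 (n + m) + 300) ?_
    fun μ' ρ' hq => ?_).mono (fun _ _ h => h) (by omega) (by omega)
  · intro t
    refine (cleanLoop_safe (t := t) (M := 2 * m) (μ := μ₁) (by omega) hρ.node hρ₁ hρ.one hρ.zero
      (by rw [hnum]; exact h.inj)).mono (by omega) ?_
    rintro μ' ρ' t' ⟨h₁, h₂, h₃, h₄, h₅, h₆⟩
    refine ⟨⟨h₁, h.filled (c := c) (h := fun j => μ.num 1 j) (t := fun j => μ.num 1 (2 * m + j)) hN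
      hh ht (by rw [h₅]; exact hmv) (by rw [h₅]; exact hkp) (by rw [h₄ 2 (by norm_num), hnum])
      fun b hb i => ?_⟩, by omega⟩
    by_cases hb3 : b = 3
    · subst hb3
      by_cases hi : ∃ j < 2 * m, μ₁.num 2 j = i
      · obtain ⟨j, hj, rfl⟩ := hi
        exact h₂ j hj
      -- A cell that the loop does not clear is not an affected node, hence never was a hole.
      · push Not at hi
        rw [h₃ i hi, hnum]
        refine (h.flag i).resolve_right fun h1 => ?_
        obtain ⟨-, -, j, hj, e⟩ := h.hole i h1
        exact hi j hj (by rw [hnum, e])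
    · rw [h₄ b hb3, hnum, h.zero b (by omega)]
  · obtain ⟨e, hq⟩ := hq
    subst ρ'
    exact repair_runs hm hq hρ hρ₁ hρ₃

end Main

end ParHeap

namespace ParHeap

open Instr

/-! ### Composition of the phases -/

section Main

variable {K : Type u} {n m N b : ℕ} {ks : Multiset (WithTop K)} {μ : Mem K}
  {ρ : Frame K}

/-- The sum tree of `val` is stored. -/
def StoresSums (M : ℕ) (val : ℕ → ℕ) (μ : Mem K) : Prop :=
  ∀ w, 0 < w → w < 2 * M → μ.num 0 w = ((leaves M w).map val).sum

theorem SameData.holes_eq {ν : Mem K} (h : SameData μ ν) (b : ℕ) : holes ν b = holes μ b := by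
  rw [holes, holes, h.1 3 (by norm_num)]

theorem SameData.tails_eq {ν : Mem K} (h : SameData μ ν) (N e : ℕ) :
    tails ν N e = tails μ N e := by
  rw [tails, tails, h.1 3 (by norm_num)]

theorem SameData.holeVal_eq {ν : Mem K} (h : SameData μ ν) (b : ℕ) : holeVal ν b = holeVal μ b := by
  funext j
  rw [holeVal, holeVal, h.1 3 (by norm_num), h.1 2 le_rfl]

variable [LinearOrder K]

theorem sumHoles_runs (hm : 0 < m) (hρ : Regs n m ρ) (hρ₁ : ρ.num 1 = 2 * m)
    (hρ₃ : ρ.num 3 = b) :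
    Runs (.call 1) μ ρ (fun μ' ρ' => ρ' = ρ ∧ SameData μ μ' ∧ StoresSums (2 * m) (holeVal μ b) μ')
      (400 * m + 2) (100 * (Nat.log 2 (2 * m) + 2) + 2) := by
  intro t
  refine (Safe.sumTree (procs := updateProcs) (p := 1) (c := 100) (M := 2 * m) (leaf := holeLeaf)
    (val := holeVal μ b) rfl hρ₁ hρ.node hρ.one (by omega) (by simp [holeLeaf, Cmd.cost])
    fun j ν F W hj h₂ h₃ hF _ hW => holeLeaf_wlp hρ₁ hρ₃ h₂ h₃ hF hW).mono (by omega) ?_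
  rintro μ' ρ' t' ⟨h₁, h₂, h₃, h₄⟩
  exact ⟨⟨h₁, SameData.of_agree h₃ (fun b i hb w _ h => by cases h; omega) fun b i w _ h => (by cases h), h₂⟩,
    by omega⟩

theorem sumTails_runs (hm : 0 < m) (hρ : Regs n m ρ) (hρ₁ : ρ.num 1 = 2 * m)
    (hρ₃ : ρ.num 3 = N) :
    Runs (.call 2) μ ρ (fun μ' ρ' => ρ' = ρ ∧ (SameData μ μ' ∧ μ'.num 1 = μ.num 1) ∧
        StoresSums (2 * m) (tailVal μ N (n + m)) μ')
      (400 * m + 2) (100 * (Nat.log 2 (2 * m) + 2) + 2) := by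
  intro t
  refine (Safe.sumTree (procs := updateProcs) (p := 2) (c := 100) (M := 2 * m) (leaf := tailLeaf)
    (val := tailVal μ N (n + m)) rfl hρ₁ hρ.node hρ.one (by omega) (by simp [tailLeaf, Cmd.cost])
    fun j ν F W hj h₂ h₃ hF _ hW => tailLeaf_wlp hρ₁ hρ₃ hρ.bound hρ.one h₃ hF hW).mono
    (by omega) ?_
  rintro μ' ρ' t' ⟨h₁, h₂, h₃, h₄⟩
  exact ⟨⟨h₁, ⟨SameData.of_agree h₃ (fun b i hb w _ h => by cases h; omega) fun b i w _ h => (by cases h),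
    funext fun i => (h₃.num 1 i fun w _ h => by cases h).symm⟩, h₂⟩, by omega⟩

theorem listHoles_runs (hm : 0 < m) (h : Prepared n m ks μ) (hρ : Regs n m ρ)
    (hρ₁ : ρ.num 1 = 2 * m) (hρ₆ : ρ.num 6 = 0) (hs : StoresSums (2 * m) (holeVal μ N) μ) :
    Runs (.call 3) μ ρ (fun μ' ρ' => ρ' = ρ ∧ SameData μ μ' ∧
        (Finset.range (holes μ N).card).val.map (fun i => μ'.num 1 (0 + i)) = (holes μ N).val)
      (400 * m + 2) (100 * (Nat.log 2 (2 * m) + 2) + 2) := by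
  intro t
  have hval := holeVal_le_one h N
  refine (Safe.rankTree (procs := updateProcs) (p := 3) (c := 100) (M := 2 * m)
    (leaf := listHoleLeaf) (item := μ.num 2) hval rfl hρ₁ hρ.node hρ.one hρ₆ (by omega)
    (by simp [listHoleLeaf, Cmd.cost]) hs
    fun j σ ν F W hj h₂ hv hσ₀ hσ hF hF₀ hW => listHoleLeaf_wlp hval h₂ hv hσ₀
      (by rw [hσ 1 (by norm_num) (by norm_num) (by norm_num), hρ₁])
      (by rw [hσ 11 (by norm_num) (by norm_num) (by norm_num), hρ.zero]) hF hF₀ hW).mono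
    (by omega) ?_
  rintro μ' ρ' t' ⟨h₁, h₂, h₃, h₄⟩
  have hl := h.listing_holes hm N
  refine ⟨⟨h₁, SameData.of_agree h₃ (fun b i hb w _ h => by cases h; omega) fun b i w _ h => (by cases h),
    ?_⟩, by omega⟩
  have hcard : (listing (2 * m) (holeVal μ N) (μ.num 2) 1).length = (holes μ N).card := by
    rw [← Multiset.coe_card, hl]; rfl
  rw [← hl, ← hcard]
  exact range_map_eq_coe h₂

theorem listTails_runs (hm : 0 < m) (h : Prepared n m ks μ) (hρ : Regs n m ρ)
    (hρ₁ : ρ.num 1 = 2 * m) (hρ₆ : ρ.num 6 = 2 * m) (he : n + m ≤ N + 2 * m)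
    (hs : StoresSums (2 * m) (tailVal μ N (n + m)) μ) :
    Runs (.call 4) μ ρ (fun μ' ρ' => ρ' = ρ ∧ (SameData μ μ' ∧
        ∀ i < 2 * m, μ'.num 1 i = μ.num 1 i) ∧
        (Finset.range (tails μ N (n + m)).card).val.map (fun i => μ'.num 1 (2 * m + i)) =
          (tails μ N (n + m)).val)
      (400 * m + 2) (100 * (Nat.log 2 (2 * m) + 2) + 2) := by
  intro t
  have hval := tailVal_le_one h N (n + m)
  refine (Safe.rankTree (procs := updateProcs) (p := 4) (c := 100) (M := 2 * m)
    (leaf := listTailLeaf) (item := fun j => n + m - j) hval rfl hρ₁ hρ.node hρ.one hρ₆ (by omega)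
    (by simp [listTailLeaf, Cmd.cost]) hs
    fun j σ ν F W hj h₂ hv hσ₀ hσ hF hF₀ hW => listTailLeaf_wlp hval hv hσ₀
      (by rw [hσ 1 (by norm_num) (by norm_num) (by norm_num), hρ₁])
      (by rw [hσ 8 (by norm_num) (by norm_num) (by norm_num), hρ.bound])
      (by rw [hσ 11 (by norm_num) (by norm_num) (by norm_num), hρ.zero]) hF₀ hW).mono
    (by omega) ?_
  rintro μ' ρ' t' ⟨h₁, h₂, h₃, h₄⟩
  have hl := listing_tails μ hm he
  refine ⟨⟨h₁, ⟨SameData.of_agree h₃ (fun b i hb w _ h => by cases h; omega) fun b i w _ h => (by cases h),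
    fun i hi => (h₃.num 1 i fun w _ h => by cases h; omega).symm⟩, ?_⟩, by omega⟩
  have hcard : (listing (2 * m) (tailVal μ N (n + m)) (fun j => n + m - j) 1).length =
      (tails μ N (n + m)).card := by
    rw [← Multiset.coe_card, hl]; rfl
  rw [← hl, ← hcard]
  exact range_map_eq_coe h₂

theorem StoresSums.root (h : Prepared n m ks μ) (hm : 0 < m) {ν : Mem K}
    (hs : StoresSums (2 * m) (holeVal μ b) ν) : ν.num 0 1 = (holes μ b).card := by
  rw [hs 1 (by omega) (by omega), ← length_listing (holeVal_le_one h b) (item := μ.num 2),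
    ← Multiset.coe_card, h.listing_holes hm b]
  rfl

/-- Everything after the size of the new heap is known. -/
theorem fill_runs (hm : 0 < m) (h : Prepared n m ks μ) (hρ : Regs n m ρ) (hρ₁ : ρ.num 1 = 2 * m)
    (hρ₃ : ρ.num 3 = N) (hρ₆ : ρ.num 6 = 0) (hN : N = n + m - (holes μ (n + m)).card) :
    Runs (.call 1 ;; load 9 0 10 ;; .call 3 ;; .call 2 ;; add 6 4 4 ;; .call 4 ;;
      .call 5 ;; .call 6 ;; (store 0 11 3 ;; add 20 3 10 ;; keyStore 0 20 0) ;;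
      .call 7 ;; .call 8) μ ρ (fun μ' _ => Result ks μ')
      (3060 * (m * (Nat.log 2 ((n + m) / m) + 1)) + 2692 * m + 52)
      (826 * (Nat.log 2 (2 * m) + 2) + 326 * Nat.log 2 (n + m) + 332) := by
  set X := m * (Nat.log 2 ((n + m) / m) + 1) with hX
  refine (Runs.seq (sumHoles_runs hm hρ hρ₁ hρ₃) (B := fun μ' _ => Result ks μ')
    (k' := 3060 * X + 2292 * m + 48)
    (T' := 726 * (Nat.log 2 (2 * m) + 2) + 326 * Nat.log 2 (n + m) + 328)
    ?_).mono (fun _ _ h => h) (by omega) (by omega)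
  rintro μ₁ ρ' ⟨e, hs₁, hsum₁⟩
  subst ρ'
  have p₁ := hs₁.prepared h
  have hroot := hsum₁.root h hm
  rw [← hs₁.holeVal_eq] at hsum₁
  rw [← hs₁.holes_eq] at hroot hN
  refine (Runs.seq (A := fun μ' ρ' => μ' = μ₁ ∧ ρ' = ρ.setNum 9 (holes μ₁ N).card) (k := 1) (T := 1)
    (B := fun μ' _ => Result ks μ') (k' := 3060 * X + 2292 * m + 45)
    (T' := 726 * (Nat.log 2 (2 * m) + 2) + 326 * Nat.log 2 (n + m) + 325) (runs_of_wlp ?_ ?_)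
    ?_).mono (fun _ _ h => h) (by omega) (by omega)
  · simp [wlp, Instr.Ok, Instr.run, hρ.one, hroot]
  · simp [Cmd.cost]
  rintro μ' ρ₂ ⟨e, hρ₂⟩
  subst μ'
  have r₂ : Regs n m ρ₂ := hρ₂ ▸ hρ.setNum (by norm_num) _
  have r₂₁ : ρ₂.num 1 = 2 * m := by rw [hρ₂, ρ.setNum_of_ne (by norm_num), hρ₁]
  have r₂₃ : ρ₂.num 3 = N := by rw [hρ₂, ρ.setNum_of_ne (by norm_num), hρ₃]
  have r₂₆ : ρ₂.num 6 = 0 := by rw [hρ₂, ρ.setNum_of_ne (by norm_num), hρ₆]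
  have r₂₉ : ρ₂.num 9 = (holes μ₁ N).card := by rw [hρ₂, ρ.setNum_self]
  clear hρ₂ hroot
  refine (Runs.seq (listHoles_runs hm p₁ r₂ r₂₁ r₂₆ hsum₁) (B := fun μ' _ => Result ks μ')
    (k' := 3060 * X + 1892 * m + 41)
    (T' := 626 * (Nat.log 2 (2 * m) + 2) + 326 * Nat.log 2 (n + m) + 321)
    ?_).mono (fun _ _ h => h) (by omega) (by omega)
  rintro μ₂ ρ' ⟨e, hs₂, hl₂⟩
  subst ρ'
  have p₂ := hs₂.prepared p₁
  rw [← hs₂.holes_eq] at hl₂ hN r₂₉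
  refine (Runs.seq (sumTails_runs hm r₂ r₂₁ r₂₃) (B := fun μ' _ => Result ks μ')
    (k' := 3060 * X + 1492 * m + 37)
    (T' := 526 * (Nat.log 2 (2 * m) + 2) + 326 * Nat.log 2 (n + m) + 317)
    ?_).mono (fun _ _ h => h) (by omega) (by omega)
  rintro μ₃ ρ' ⟨e, ⟨hs₃, hout₃⟩, hsum₃⟩
  subst ρ'
  have p₃ := hs₃.prepared p₂
  rw [← hs₃.holes_eq] at hl₂ hN r₂₉
  simp only [← hout₃] at hl₂
  have hval : tailVal μ₂ N (n + m) = tailVal μ₃ N (n + m) := by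
    funext j; rw [tailVal, tailVal, hs₃.1 3 (by norm_num)]
  rw [hval] at hsum₃
  refine (Runs.seq (A := fun μ' ρ' => μ' = μ₃ ∧ ρ' = ρ₂.setNum 6 (2 * m)) (k := 1) (T := 1)
    (B := fun μ' _ => Result ks μ') (k' := 3060 * X + 1492 * m + 34)
    (T' := 526 * (Nat.log 2 (2 * m) + 2) + 326 * Nat.log 2 (n + m) + 314) (runs_of_wlp ?_ ?_)
    ?_).mono (fun _ _ h => h) (by omega) (by omega)
  · simp [wlp, Instr.Ok, Instr.run, r₂.batch, two_mul]
  · simp [Cmd.cost]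
  rintro μ' ρ₃ ⟨e, hρ₃'⟩
  subst μ'
  have r₃ : Regs n m ρ₃ := hρ₃' ▸ r₂.setNum (by norm_num) _
  have r₃₁ : ρ₃.num 1 = 2 * m := by rw [hρ₃', ρ₂.setNum_of_ne (by norm_num), r₂₁]
  have r₃₃ : ρ₃.num 3 = N := by rw [hρ₃', ρ₂.setNum_of_ne (by norm_num), r₂₃]
  have r₃₆ : ρ₃.num 6 = 2 * m := by rw [hρ₃', ρ₂.setNum_self]
  have r₃₉ : ρ₃.num 9 = (holes μ₃ N).card := by rw [hρ₃', ρ₂.setNum_of_ne (by norm_num), r₂₉]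
  -- The size shrinks from `n + m` by the number of holes, of which there are at most `2 * m`.
  have he : n + m ≤ N + 2 * m := by
    have := p₃.card_holes_le hm (n + m)
    omega
  refine (Runs.seq (listTails_runs hm p₃ r₃ r₃₁ r₃₆ he hsum₃) (B := fun μ' _ => Result ks μ')
    (k' := 3060 * X + 1092 * m + 30)
    (T' := 426 * (Nat.log 2 (2 * m) + 2) + 326 * Nat.log 2 (n + m) + 310)
    ?_).mono (fun _ _ h => h) (by omega) (by omega)
  rintro μ₄ ρ' ⟨e, ⟨hs₄, hout₄⟩, hl₄⟩
  subst ρ'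
  have hcard := p₃.card_holes_le hm N
  rw [p₃.card_tails hN] at hl₄
  refine move_runs hm (hs₄.prepared p₃) r₃ r₃₁ r₃₃ (by rw [hs₄.holes_eq, r₃₉])
    (by rw [hs₄.holes_eq, hN]) ?_ (by rw [hs₄.holes_eq, hs₄.tails_eq, hl₄])
  rw [hs₄.holes_eq, ← hl₂]
  refine Multiset.map_congr rfl fun i hi => hout₄ _ ?_
  have : i < (holes μ₃ N).card := by simpa using hi
  omega

theorem update_runs {a : Fin n → K} {B : Fin m → Update K n} (hm : 0 < m) (ho : IsMinHeap a)
    (hs : StoresHeap μ a) (hB : ValidBatch B) (hb : StoresBatch μ B) :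
    Runs updateMain μ (Frame.init K) (fun μ' _ => Result ((keysAfter a B).map (↑)) μ')
      (3060 * (m * (Nat.log 2 ((n + m) / m) + 1)) + 3272 * m + 90)
      (1016 * (Nat.log 2 (2 * m) + 2) + 326 * Nat.log 2 (n + m) + 370) := by
  set X := m * (Nat.log 2 ((n + m) / m) + 1) with hX
  have hlog : Nat.log 2 m ≤ Nat.log 2 (2 * m) := Nat.log_mono_right (by omega)
  set ks : Multiset (WithTop K) := (keysAfter a B).map (↑) with hks
  refine (Runs.seq (A := fun μ' ρ' => μ' = μ ∧ Regs n m ρ' ∧ ρ'.num 1 = m ∧ ρ'.num 6 = 0) (k := 16)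
    (T := 16) (B := fun μ' _ => Result ks μ') (k' := 3060 * X + 3272 * m + 72)
    (T' := 1016 * (Nat.log 2 (2 * m) + 2) + 326 * Nat.log 2 (n + m) + 352) (runs_of_wlp ?_ ?_)
    ?_).mono (fun _ _ h => h) (by omega) (by omega)
  · simp [wlp, Instr.Ok, Instr.run, Frame.init, Frame.num_setNum, hs.1, hb.1]
    constructor <;> simp [Frame.num_setNum, Frame.key_setNum]
  · simp [Cmd.cost]
  rintro μ' ρ ⟨e, hρ, hρ₁, hρ₆⟩
  subst μ'
  refine (Runs.seq (A := fun μ' ρ' => ρ' = ρ ∧ Prepared n m ks μ') (k := 180 * m + 2)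
    (T := 90 * (Nat.log 2 m + 2) + 2) (B := fun μ' _ => Result ks μ')
    (k' := 3060 * X + 3092 * m + 68)
    (T' := 926 * (Nat.log 2 (2 * m) + 2) + 326 * Nat.log 2 (n + m) + 348) (fun t => ?_)
    ?_).mono (fun _ _ h => h) (by omega) (by omega)
  · refine (enterLoop_safe hm ho hs hB hb hρ.node hρ₁ hρ.old hρ.batch hρ.bound hρ.one hρ.zero).mono
      (by omega) fun μ' ρ' t' h => ⟨⟨h.1, h.2.1⟩, by omega⟩
  rintro μ₁ ρ' ⟨e, h⟩
  subst ρ'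
  refine (Runs.seq (A := fun μ' ρ' => μ' = μ₁ ∧ ρ' = (ρ.setNum 1 (2 * m)).setNum 3 (n + m)) (k := 4)
    (T := 4) (B := fun μ' _ => Result ks μ') (k' := 3060 * X + 3092 * m + 62)
    (T' := 926 * (Nat.log 2 (2 * m) + 2) + 326 * Nat.log 2 (n + m) + 342) (runs_of_wlp ?_ ?_)
    ?_).mono (fun _ _ h => h) (by omega) (by omega)
  · simp [wlp, Instr.Ok, Instr.run, Frame.num_setNum, hρ.batch, hρ.bound, hρ.zero, two_mul]
  · simp [Cmd.cost]
  rintro μ' ρ₂ ⟨e, hρ₂⟩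
  subst μ'
  have r₂ : Regs n m ρ₂ := hρ₂ ▸ (hρ.setNum (by norm_num) _).setNum (by norm_num) _
  have r₂₁ : ρ₂.num 1 = 2 * m := by simp [hρ₂, Frame.num_setNum]
  have r₂₃ : ρ₂.num 3 = n + m := by simp [hρ₂, Frame.num_setNum]
  have r₂₆ : ρ₂.num 6 = 0 := by simp [hρ₂, Frame.num_setNum, hρ₆]
  clear hρ₂
  refine (Runs.seq (sumHoles_runs hm r₂ r₂₁ r₂₃) (B := fun μ' _ => Result ks μ')
    (k' := 3060 * X + 2692 * m + 58)
    (T' := 826 * (Nat.log 2 (2 * m) + 2) + 326 * Nat.log 2 (n + m) + 338)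
    ?_).mono (fun _ _ h => h) (by omega) (by omega)
  rintro μ₂ ρ' ⟨e, hs₂, hsum⟩
  subst ρ'
  have hroot := hsum.root h hm
  rw [← hs₂.holes_eq] at hroot
  obtain ⟨N, hN⟩ : ∃ N, N = n + m - (holes μ₂ (n + m)).card := ⟨_, rfl⟩
  refine (Runs.seq (A := fun μ' ρ' => μ' = μ₂ ∧ Regs n m ρ' ∧ ρ'.num 1 = 2 * m ∧ ρ'.num 3 = N ∧
      ρ'.num 6 = 0) (k := 4)
    (T := 4) (B := fun μ' _ => Result ks μ') (k' := 3060 * X + 2692 * m + 52)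
    (T' := 826 * (Nat.log 2 (2 * m) + 2) + 326 * Nat.log 2 (n + m) + 332) (runs_of_wlp ?_ ?_)
    ?_).mono (fun _ _ h => h) (by omega) (by omega)
  · refine ⟨trivial, trivial, rfl, (r₂.setNum (by norm_num) _).setNum (by norm_num) _, ?_, ?_, ?_⟩ <;>
      simp [Instr.run, Frame.num_setNum, r₂.one, r₂.bound, r₂₁, r₂₆, hroot, hN]
  · simp [Cmd.cost]
  rintro μ' ρ₃ ⟨e, r₃, r₃₁, r₃₃, r₃₆⟩
  subst μ'
  exact fill_runs hm (hs₂.prepared h) r₃ r₃₁ r₃₃ r₃₆ hN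

end Main

end ParHeap

namespace ParHeap

open Instr

/-! ### Real-valued bounds and the stored heap -/

section Final

variable {K : Type u} [LinearOrder K] {n m : ℕ} {μ : Mem K}

theorem log_two_mul_log_two_le {q : ℕ} {r : ℝ} (hq : 0 < q) (h : (q : ℝ) ≤ r) :
    (Nat.log 2 q : ℝ) * Real.log 2 ≤ Real.log r := by
  rw [← Real.log_pow]
  refine Real.log_le_log (by positivity) (le_trans ?_ h)
  exact_mod_cast Nat.pow_log_le_self 2 hq.ne'

theorem half_le_log_two : (1 / 2 : ℝ) ≤ Real.log 2 := by
  linarith [Real.log_two_gt_d9]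

/-- Since `(n + m) / m ≥ 1`, the logarithm on the right is at least `Real.log 2 ≥ 1 / 2`, so it
absorbs the terms linear in `m` and the constant. The number 20000 is a generous round bound. -/
theorem work_le (hm : 0 < m) :
    ((3060 * (m * (Nat.log 2 ((n + m) / m) + 1)) + 3272 * m + 90 : ℕ) : ℝ) ≤
      20000 * (m * Real.log (1 + ((n : ℝ) + m) / m)) := by
  have hm' : (0 : ℝ) < m := by exact_mod_cast hm
  have hm1 : (1 : ℝ) ≤ m := by exact_mod_cast hm
  have hr : (1 : ℝ) ≤ ((n : ℝ) + m) / m := by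
    rw [le_div_iff₀ hm']; linarith [Nat.cast_nonneg (α := ℝ) n]
  set r : ℝ := ((n : ℝ) + m) / m with hrdef
  have hq : (((n + m) / m : ℕ) : ℝ) ≤ r := by
    rw [hrdef]; exact_mod_cast Nat.cast_div_le (α := ℝ) (m := n + m) (n := m)
  have h₁ := log_two_mul_log_two_le (Nat.div_pos (by omega) hm) (hq.trans (by linarith : r ≤ 1 + r))
  have h₂ : Real.log 2 ≤ Real.log (1 + r) := Real.log_le_log (by norm_num) (by linarith)
  have h₃ := half_le_log_two
  set L : ℝ := (Nat.log 2 ((n + m) / m) : ℝ) with hL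
  have hL0 : 0 ≤ L := Nat.cast_nonneg _
  have h₄ : L ≤ 2 * Real.log (1 + r) := by nlinarith
  push_cast
  rw [← hL]
  have h₅ : (1 : ℝ) ≤ 2 * Real.log (1 + r) := by linarith
  have h₆ : (m : ℝ) * L ≤ m * (2 * Real.log (1 + r)) := by gcongr
  have h₇ : (m : ℝ) * 1 ≤ m * (2 * Real.log (1 + r)) := by gcongr
  nlinarith

theorem depth_le (hm : 0 < m) :
    ((1016 * (Nat.log 2 (2 * m) + 2) + 326 * Nat.log 2 (n + m) + 370 : ℕ) : ℝ) ≤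
      20000 * Real.log (1 + ((n : ℝ) + m)) := by
  have hn : (0 : ℝ) ≤ n := Nat.cast_nonneg n
  have hm1 : (1 : ℝ) ≤ m := by exact_mod_cast hm
  have h₁ := log_two_mul_log_two_le (q := n + m) (r := 1 + ((n : ℝ) + m)) (by omega)
    (by push_cast; linarith)
  have h₂ : Real.log 2 ≤ Real.log (1 + ((n : ℝ) + m)) :=
    Real.log_le_log (by norm_num) (by linarith)
  have h₃ := half_le_log_two
  have h₄ : Nat.log 2 (2 * m) ≤ Nat.log 2 (n + m) + 1 := by
    rw [mul_comm, Nat.log_mul_base (by norm_num) hm.ne']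
    exact Nat.succ_le_succ (Nat.log_mono_right (by omega))
  have h₄' : (Nat.log 2 (2 * m) : ℝ) ≤ Nat.log 2 (n + m) + 1 := by exact_mod_cast h₄
  set L : ℝ := (Nat.log 2 (n + m) : ℝ) with hL
  have hL0 : 0 ≤ L := Nat.cast_nonneg _
  have h₅ : L ≤ 2 * Real.log (1 + ((n : ℝ) + m)) := by nlinarith
  push_cast
  rw [← hL]
  linarith

omit [LinearOrder K] in
theorem keys_eq_map_Icc (f : ℕ → WithTop K) (N : ℕ) :
    (Finset.Icc 1 N).val.map f = (Finset.univ : Finset (Fin N)).val.map fun v => f (v.val + 1) := by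
  have hinj : Function.Injective fun v : Fin N => v.val + 1 := fun v w h =>
    Fin.ext (Nat.add_right_cancel h)
  have e : Finset.Icc 1 N = (Finset.univ : Finset (Fin N)).map ⟨_, hinj⟩ := by
    ext w
    simp only [Finset.mem_Icc, Finset.mem_map, Finset.mem_univ, true_and]
    exact ⟨fun h => ⟨⟨w - 1, by omega⟩, Nat.sub_add_cancel h.1⟩,
      by rintro ⟨v, rfl⟩; exact ⟨Nat.succ_pos _, v.2⟩⟩
  rw [e, Finset.map_val, Multiset.map_map]
  rfl

/-- No node up to `N` can hold the blank word, because the stored multiset is the image of proper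
keys. -/
theorem Result.exists_heap {ks : Multiset K} (h : Result (ks.map (↑)) μ) :
    ∃ (N : ℕ) (a : Fin N → K), IsMinHeap a ∧ StoresHeap μ a ∧ keys a = ks := by
  obtain ⟨N, h₀, hz, hord, hkeys⟩ := h
  rw [keys_eq_map_Icc] at hkeys
  have : ∀ v : Fin N, ∃ k : K, (k : WithTop K) = μ.key 0 (v.val + 1) := fun v => by
    have hv : μ.key 0 (v.val + 1) ∈ ks.map ((↑) : K → WithTop K) := by
      rw [← hkeys]
      exact Multiset.mem_map_of_mem (fun v : Fin N => μ.key 0 (v.val + 1)) (Finset.mem_univ v)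
    obtain ⟨k, -, hk⟩ := Multiset.mem_map.1 hv
    exact ⟨k, hk⟩
  choose a ha using this
  refine ⟨N, a, fun v w hvw => ?_, ⟨h₀, fun v => (ha v).symm, hz⟩, ?_⟩
  · have := hord (w.val + 1) (by omega) w.2
    rwa [hvw, ← ha, ← ha, WithTop.coe_le_coe] at this
  · refine Multiset.map_injective (WithTop.coe_injective (α := K)) ?_
    rw [← hkeys, keys, Multiset.map_map]
    exact Multiset.map_congr rfl fun v _ => ha v

theorem update_runsWithin {a : Fin n → K} {B : Fin m → Update K n} (hm : 0 < m) (ho : IsMinHeap a)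
    (hs : StoresHeap μ a) (hB : ValidBatch B) (hb : StoresBatch μ B) :
    updateProgram.RunsWithin μ (20000 * (m * Real.log (1 + ((n : ℝ) + m) / m)))
      (20000 * Real.log (1 + ((n : ℝ) + m)))
      (fun ν _ => ∃ (n' : ℕ) (a' : Fin n' → K), IsMinHeap a' ∧ StoresHeap ν a' ∧
        keys a' = keysAfter a B) := by
  refine Program.runsWithin_of_safe (update_runs hm ho hs hB hb 0) (work_le hm)
    fun ν ρ t ⟨h, ht⟩ => ⟨le_trans ?_ (depth_le hm), h.exists_heap⟩
  rw [zero_add] at ht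
  exact_mod_cast ht

theorem IsMinHeap.root_le {a : Fin n → K} (ho : IsMinHeap a) (hn : 0 < n) (v : Fin n) :
    a ⟨0, hn⟩ ≤ a v := by
  obtain ⟨v, hv⟩ := v
  induction v using Nat.strong_induction_on with
  | _ v ih =>
    by_cases h : v = 0
    · subst h; exact le_rfl
    · exact (ih ((v + 1) / 2 - 1) (by omega) (by omega)).trans (ho _ _ (by simp; omega))

theorem findMin_runsWithin {a : Fin n → K} (ho : IsMinHeap a) (hs : StoresHeap μ a) (hn : 0 < n) :
    findMinProgram.RunsWithin μ 20000 20000 (fun ν ρ => ν = μ ∧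
      ∃ k : K, ρ.key 0 = (k : WithTop K) ∧ IsLeast (Set.range a) k) := by
  have h : wlp Set.univ Set.univ findMinProgram.main
      (fun ν ρ => ν = μ ∧ ρ.key 0 = (a ⟨0, hn⟩ : WithTop K)) μ (Frame.init K) := by
    have := hs.2.1 ⟨0, hn⟩
    simp [findMinProgram, wlp, Instr.Ok, Instr.run, Frame.key_setKey, Frame.num_setNum, ← this]
  refine Program.runsWithin_of_safe (h.safe (t := 0)) (by norm_num [findMinProgram, Cmd.cost])
    fun ν ρ t ⟨⟨ν', hν, hA⟩, ht⟩ => ⟨?_, ?_⟩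
  · have : t ≤ 4 := by simpa [findMinProgram, Cmd.cost] using ht
    have : (t : ℝ) ≤ 4 := by exact_mod_cast this
    linarith
  · rw [hν.eq] at hA
    exact ⟨hA.1, _, hA.2, ⟨_, rfl⟩, by rintro _ ⟨v, rfl⟩; exact ho.root_le hn v⟩

end Final

end ParHeap

theorem mainTheorem2 :
    ∃ (update findMin : ParHeap.Program) (C : ℝ),
      ∀ (K : Type u) [LinearOrder K] (n : ℕ) (a : Fin n → K) (μ : ParHeap.Mem K),
        ParHeap.IsMinHeap a → ParHeap.StoresHeap μ a →
        (∀ (m : ℕ) (B : Fin m → ParHeap.Update K n),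
          0 < m → ParHeap.ValidBatch B → ParHeap.StoresBatch μ B →
          update.RunsWithin μ
            (C * (m * Real.log (1 + ((n : ℝ) + m) / m)))
            (C * Real.log (1 + ((n : ℝ) + m)))
            (fun ν _ => ∃ (n' : ℕ) (a' : Fin n' → K),
              ParHeap.IsMinHeap a' ∧ ParHeap.StoresHeap ν a' ∧
                ParHeap.keys a' = ParHeap.keysAfter a B)) ∧
        (0 < n →
          findMin.RunsWithin μ C C
            (fun ν ρ => ν = μ ∧ ∃ k : K, ρ.key 0 = (k : WithTop K) ∧ IsLeast (Set.range a) k)) :=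
  ⟨ParHeap.updateProgram, ParHeap.findMinProgram, 20000, fun _ _ _ _ _ ho hs =>
    ⟨fun _ _ hm hB hb => ParHeap.update_runsWithin hm ho hs hB hb,
      fun hn => ParHeap.findMin_runsWithin ho hs hn⟩⟩
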